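/- A red-blue colouring of a graph is a *bisection* if the numbers of red and blue vertices differ by at most one. Given $\varepsilon>0$, a colouring of an $n$-vertex graph is *$\varepsilon$-almost-internal* (respectively, *$\varepsilon$-almost-external*) if all but at most $\varepsilon n$ vertices have at least half of their neighbours in their own colour (respectively, in the opposite colour). Write $\mathbb G(n,p)$ for the random graph on $n$ labelled vertices in which each of the $\binom n2$ possible edges is present with probability $p$ independently, and say that an event holds *whp* if its probability tends to $1$ as $n\to\infty$. **Theorem.** Let $p_n\in[0,1]$ be such that $\limsup_{n\to\infty} np_n<\infty$. Then: 1. There is a sequence $\varepsilon_n\in(0,1)$ with $\varepsilon_n\to0$ such that whp $G\sim\mathbb G(n,p_n)$ has an $\varepsilon_n$-almost-internal bisection; and there is a sequence $\varepsilon_n\in(0,1)$ with $\varepsilon_n\to 0$ such that whp $G\sim\mathbb G(n,p_n)$ has an $\varepsilon_n$-almost-external bisection. 2. There is a randomised algorithm, whose input is a graph $G$ (given by adjacency lists in an arbitrary order) and an integer $k\ge1$, such that for every fixed $k$ there is a constant $C=C(k)$ with the following properties, where $G\sim \mathbb G(n,p_n)$. - For all sufficiently large $n$, the expected running time, over both $G$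 and the coin flips of the algorithm, is at most $Cn$ (whatever the order of the adjacency lists). - Whp $G$ is such that, whatever the order of its adjacency lists, the expected running time over the coin flips alone is at most $Cn$, and the algorithm almost surely halts and outputs a $\frac1k$-almost-internal bisection of $G$. There is likewise such an algorithm for $\frac1k$-almost-external bisections. Here an algorithm is a finite program (not depending on $n$, $k$ or $G$) for a random-access machine with finitely many registers and arrays of natural numbers, whose elementary operations, each of unit cost, are: loading a constant, copying a register, adding or subtracting one, reading or writing an array cell addressed by a register, comparing two registers (in conditionals and while loops), and flipping a fair coin. -/

import Mathlib

open Filter Topology MeasureTheory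
open scoped ENNReal

namespace AlmostBisection

/-! ### Red-blue colourings of a finite graph -/

section Colourings

variable {V : Type*} [Fintype V]

open Classical in
/-- A bisection: a red-blue colouring (`true` is red, `false` is blue) whose two colour classes
have sizes differing by at most one. -/
def IsBisection (c : V → Bool) : Prop :=
  (Finset.univ.filter fun v => c v = true).card ≤ (Finset.univ.filter fun v => c v = false).card + 1 ∧
  (Finset.univ.filter fun v => c v = false).card ≤ (Finset.univ.filter fun v => c v = true).card + 1

open Classical in
/-- At least half of the neighbours of `v` have the same colour as `v`. -/
def IsInternalAt (G : SimpleGraph V) (c : V → Bool) (v : V) : Prop :=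
  (Finset.univ.filter fun u => G.Adj v u).card ≤
    2 * (Finset.univ.filter fun u => G.Adj v u ∧ c u = c v).card

open Classical in
/-- At least half of the neighbours of `v` have the colour opposite to that of `v`. -/
def IsExternalAt (G : SimpleGraph V) (c : V → Bool) (v : V) : Prop :=
  (Finset.univ.filter fun u => G.Adj v u).card ≤
    2 * (Finset.univ.filter fun u => G.Adj v u ∧ c u ≠ c v).card

open Classical in
/-- `c` is a bisection and all but at most `ε |V|` vertices are internal. -/
def IsAlmostInternalBisection (ε : ℝ) (G : SimpleGraph V) (c : V → Bool) : Prop :=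
  IsBisection c ∧
    ((Finset.univ.filter fun v => ¬ IsInternalAt G c v).card : ℝ) ≤ ε * Fintype.card V

open Classical in
/-- `c` is a bisection and all but at most `ε |V|` vertices are external. -/
def IsAlmostExternalBisection (ε : ℝ) (G : SimpleGraph V) (c : V → Bool) : Prop :=
  IsBisection c ∧
    ((Finset.univ.filter fun v => ¬ IsExternalAt G c v).card : ℝ) ≤ ε * Fintype.card V

end Colourings

/-! ### Randomised random-access machines

A program is a finite text over registers `R 0, R 1, …` and arrays `A 0, A 1, …`, all of whose
cells hold natural numbers. The only arithmetic is adding or subtracting one, and every elementary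
step costs one unit of time; so after `t` steps no cell can exceed the largest of the numbers in the
input and the program by more than `t`, and no computation is hidden in operations on long words.
The only source of randomness is a fair coin. -/

/-- Randomised programs. Registers and arrays are referred to by their (fixed) numbers. -/
inductive Prog : Type
  /-- do nothing -/
  | skip : Prog
  /-- `R x := m`, with `m` a constant of the program text -/
  | const (x m : ℕ) : Prog
  /-- `R x := R y` -/
  | copy (x y : ℕ) : Prog
  /-- `R x := R x + 1` -/
  | succ (x : ℕ) : Prog
  /-- `R x := R x - 1`, truncated at zero -/
  | pred (x : ℕ) : Prog
  /-- `R x := A a [R i]` -/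
  | load (x a i : ℕ) : Prog
  /-- `A a [R i] := R x` -/
  | store (a i x : ℕ) : Prog
  /-- `R x :=` a fresh fair random bit -/
  | coin (x : ℕ) : Prog
  /-- first `P`, then `Q` -/
  | seq (P Q : Prog) : Prog
  /-- if `R x < R y` then `P` else `Q` -/
  | ifLt (x y : ℕ) (P Q : Prog) : Prog
  /-- while `R x < R y` do `P` -/
  | whileLt (x y : ℕ) (P : Prog) : Prog

/-- The contents of the memory. -/
@[ext] structure Store where
  reg : ℕ → ℕ
  arr : ℕ → ℕ → ℕ

/-- `R x := m` -/
def Store.setReg (s : Store) (x m : ℕ) : Store :=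
  { s with reg := Function.update s.reg x m }

/-- `A a [i] := m` -/
def Store.setArr (s : Store) (a i m : ℕ) : Store :=
  { s with arr := Function.update s.arr a (Function.update (s.arr a) i m) }

/-- A configuration: the list of programs that remain to be executed, and the memory.
The machine has halted when nothing remains. -/
abbrev Config : Type := List Prog × Store

/-- One step of the machine. The argument `b` is a fresh random bit, used only by `coin`. -/
def step (b : Bool) : Config → Config
  | ([], s) => ([], s)
  | (.skip :: K, s) => (K, s)
  | (.const x m :: K, s) => (K, s.setReg x m)
  | (.copy x y :: K, s) => (K, s.setReg x (s.reg y))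
  | (.succ x :: K, s) => (K, s.setReg x (s.reg x + 1))
  | (.pred x :: K, s) => (K, s.setReg x (s.reg x - 1))
  | (.load x a i :: K, s) => (K, s.setReg x (s.arr a (s.reg i)))
  | (.store a i x :: K, s) => (K, s.setArr a (s.reg i) (s.reg x))
  | (.coin x :: K, s) => (K, s.setReg x b.toNat)
  | (.seq P Q :: K, s) => (P :: Q :: K, s)
  | (.ifLt x y P Q :: K, s) => ((if s.reg x < s.reg y then P else Q) :: K, s)
  | (.whileLt x y P :: K, s) =>
      if s.reg x < s.reg y then (P :: .whileLt x y P :: K, s) else (K, s)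

/-- The configuration after `t` steps from `C`, when the bit offered at step `i` is `ω i`. -/
def run (ω : ℕ → Bool) (C : Config) : ℕ → Config
  | 0 => C
  | t + 1 => step (ω t) (run ω C t)

/-- The number of steps until the machine halts (`∞` if it never does). -/
noncomputable def runtime (ω : ℕ → Bool) (C : Config) : ℝ≥0∞ :=
  ⨅ (t : ℕ) (_ : (run ω C t).1 = []), (t : ℝ≥0∞)

/-- The law of an infinite sequence of independent fair random bits. -/
noncomputable def fairCoins : Measure (ℕ → Bool) :=
  Measure.infinitePi fun _ => (PMF.uniformOfFintype Bool).toMeasure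

/-! ### Graphs as inputs, colourings as outputs -/

/-- Adjacency lists of `G`: every vertex has a list of its neighbours, without repetition, in an
arbitrary order. -/
def IsAdjacencyLists {n : ℕ} (G : SimpleGraph (Fin n)) (L : Fin n → List (Fin n)) : Prop :=
  ∀ v, (L v).Nodup ∧ ∀ u, u ∈ L v ↔ G.Adj v u

/-- The initial memory. Register `0` holds the number `n` of vertices and register `1` the accuracy
parameter `k`. Array `1` holds the adjacency lists of the vertices `0, …, n - 1`, one after the
other; the list of `v` occupies the positions from `A 0 [v]` (included) to `A 0 [v + 1]` (excluded).
Everything else is zero. -/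
def inputStore {n : ℕ} (L : Fin n → List (Fin n)) (k : ℕ) : Store where
  reg x := if x = 0 then n else if x = 1 then k else 0
  arr a i :=
    if a = 0 then (if i ≤ n then (((List.ofFn L).take i).map List.length).sum else 0)
    else if a = 1 then (((List.ofFn L).flatten[i]?).map Fin.val).getD 0
    else 0

/-- The colouring that a final memory stands for: vertex `v` is red if `A 2 [v]` is nonzero, and
blue otherwise. -/
def outputColouring (n : ℕ) (s : Store) : Fin n → Bool := fun v => decide (s.arr 2 v ≠ 0)

/-- The initial configuration of the program `P`. -/
def start (P : Prog) {n : ℕ} (L : Fin n → List (Fin n)) (k : ℕ) : Config := ([P], inputStore L k)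

/-- The expectation, over the coins, of the running time on the input `L`, `k`. -/
noncomputable def expectedRuntime (P : Prog) {n : ℕ} (L : Fin n → List (Fin n)) (k : ℕ) : ℝ≥0∞ :=
  ∫⁻ ω, runtime ω (start P L k) ∂fairCoins

/-- The expected running time on the graph `G`, for the worst choice of adjacency lists. -/
noncomputable def graphExpectedRuntime (P : Prog) {n : ℕ} (G : SimpleGraph (Fin n)) (k : ℕ) :
    ℝ≥0∞ :=
  ⨆ (L : Fin n → List (Fin n)) (_ : IsAdjacencyLists G L), expectedRuntime P L k

/-- For all adjacency lists of `G`, the program `P` halts almost surely, and its output has the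
property `Good`. -/
def AlwaysFinds (P : Prog) {n : ℕ} (G : SimpleGraph (Fin n)) (k : ℕ)
    (Good : (Fin n → Bool) → Prop) : Prop :=
  ∀ L : Fin n → List (Fin n), IsAdjacencyLists G L →
    ∀ᵐ ω ∂fairCoins, ∃ t : ℕ, (run ω (start P L k) t).1 = [] ∧
      Good (outputColouring n (run ω (start P L k) t).2)

/-! ### Random graphs -/

/-- The property `E` holds with high probability for the binomial random graph with `n` vertices and
edge probability `p n`, as `n → ∞`. -/
def Whp (p : ℕ → unitInterval) (E : ∀ n : ℕ, SimpleGraph (Fin n) → Prop) : Prop :=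
  Tendsto (fun n => SimpleGraph.binomialRandom (Fin n) (p n) {G | E n G}) atTop (𝓝 1)

/-- The program `P`, given an accuracy parameter `k`, finds colourings with the property `Good k` in
expected linear time: for each `k ≥ 1` there is a constant `C` such that, for large `n`, the running
time has expectation at most `C n` (over the random graph and the coins), and such that whp the
random graph is one on which the running time has expectation at most `C n` (over the coins alone)
and the output is almost surely a colouring with the property `Good k`. -/
def FindsInExpectedLinearTime (p : ℕ → unitInterval) (P : Prog)
    (Good : ℕ → ∀ n : ℕ, SimpleGraph (Fin n) → (Fin n → Bool) → Prop) : Prop :=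
  ∀ k : ℕ, 1 ≤ k → ∃ C : ℕ,
    (∀ᶠ n : ℕ in atTop,
      ∫⁻ G, graphExpectedRuntime P G k ∂(SimpleGraph.binomialRandom (Fin n) (p n)) ≤
        (C : ℝ≥0∞) * n) ∧
    Whp p fun n G =>
      graphExpectedRuntime P G k ≤ (C : ℝ≥0∞) * n ∧ AlwaysFinds P G k (Good k n G)

end AlmostBisection

/-! The proof analyses a local search that flips no coins; `e = true` is its internal version, `e =
false` the external one. Let np ≤ c for large n, C = 3c and d = 8Ck. A vertex is frozen if it has
degree above d or a neighbour congruent to it modulo d; any other vertex may change its colour in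
the round numbered by its residue modulo d. Vertices that move in the same round are pairwise
non-adjacent, so every change made by an unhappy vertex improves the number of monochromatic minus
bichromatic arcs by at least 4 (`score_flipRound`). With at most Cn arcs, this difference stays
between -Cn and Cn, so one of the first d² cycles of d rounds makes at most n/(16kd) changes. An
unfrozen vertex that is unhappy at the start of this cycle has a change in its closed neighbourhood
(`card_movableUnhappy_le`), so there are few of these. There are also few frozen vertices
(`card_frozen_le`).

It remains to balance the colours. Moving unfrozen vertices greedily from the larger class changes
at most half as many vertices as the imbalance, and each change disturbs at most d + 1 vertices;
hence an imbalance below a small multiple of n is harmless. To achieve it, the search starts from a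
pattern of M bits, repeated periodically. After boundedly many rounds the sign of each vertex is an
odd function of a set of the bits. For a uniformly random pattern, signs with disjoint sets are
uncorrelated, so the mean square of the imbalance is at most the sum over the bits of the squared
number of vertices that the bit can affect (`sum_sq_le_of_local`). Unfrozen degrees are bounded, so
that number is O(n/M) (`card_dependent_le`), and the mean square is O(n²/M). For a large constant M
some pattern therefore keeps all d² colourings nearly balanced (`exists_pattern`). The program does
not know M: it tries q = 2, 3, ... and uses the binary digits of q below the leading one as the
pattern, so a good q occurs below the constant 2^(M+1) (`exists_not_fails`).

Of the random graph only `Regular` is used: bounds on the number of arcs in total, inside the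
residue classes modulo d, and out of each residue class modulo M. By Chebyshev's inequality it fails
with probability O(1/n). Graphs with too many arcs are rejected and q stays below n, so the program
stops after O(n²) steps on every graph; the exceptional graphs thus contribute O(n) to the
expectation. Part 1 follows from the success for each fixed k by a diagonal argument. -/

namespace AlmostBisection

/-! ### Deterministic programs: execution in a given time -/

/-- `Exec P s t s'`: without flipping coins, `P` turns the memory `s` into `s'` in `t` steps. -/
inductive Exec : Prog → Store → ℕ → Store → Prop
  | skip (s) : Exec .skip s 1 s
  | const (x m s) : Exec (.const x m) s 1 (s.setReg x m)
  | copy (x y s) : Exec (.copy x y) s 1 (s.setReg x (s.reg y))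
  | succ (x s) : Exec (.succ x) s 1 (s.setReg x (s.reg x + 1))
  | pred (x s) : Exec (.pred x) s 1 (s.setReg x (s.reg x - 1))
  | load (x a i s) : Exec (.load x a i) s 1 (s.setReg x (s.arr a (s.reg i)))
  | store (a i x s) : Exec (.store a i x) s 1 (s.setArr a (s.reg i) (s.reg x))
  | seq {P Q s t s₁ t' s₂} : Exec P s t s₁ → Exec Q s₁ t' s₂ → Exec (.seq P Q) s (t + t' + 1) s₂
  | ifTrue {x y P Q s t s'} : s.reg x < s.reg y → Exec P s t s' →
      Exec (.ifLt x y P Q) s (t + 1) s'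
  | ifFalse {x y P Q s t s'} : ¬ s.reg x < s.reg y → Exec Q s t s' →
      Exec (.ifLt x y P Q) s (t + 1) s'
  | whileDone {x y P s} : ¬ s.reg x < s.reg y → Exec (.whileLt x y P) s 1 s
  | whileStep {x y P s t s₁ t' s₂} : s.reg x < s.reg y → Exec P s t s₁ →
      Exec (.whileLt x y P) s₁ t' s₂ → Exec (.whileLt x y P) s (t + t' + 1) s₂

/-- The starting time and the continuation `K` are arbitrary, so that the induction hypotheses apply
to a subprogram executed in the middle of a longer run. -/
theorem Exec.run_eq {P : Prog} {s s' : Store} {t : ℕ} (h : Exec P s t s') (ω : ℕ → Bool)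
    (C : Config) : ∀ (t₀ : ℕ) (K : List Prog), run ω C t₀ = (P :: K, s) →
      run ω C (t₀ + t) = (K, s') := by
  induction h with
  | seq _ _ ih₁ ih₂ =>
    rename_i t _ _ t' _ _ _
    intro t₀ K h
    have h1 := ih₁ (t₀ + 1) (_ :: K) (by rw [run, h]; rfl)
    have h2 := ih₂ _ _ h1
    rw [← h2]; congr 1; omega
  | ifTrue hlt _ ih =>
    intro t₀ K h
    have h1 := ih (t₀ + 1) K (by rw [run, h]; simp [step, hlt])
    rw [← h1]; congr 1; omega
  | ifFalse hlt _ ih =>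
    intro t₀ K h
    have h1 := ih (t₀ + 1) K (by rw [run, h]; simp [step, hlt])
    rw [← h1]; congr 1; omega
  | whileDone hlt =>
    intro t₀ K h
    rw [run, h]; simp [step, hlt]
  | whileStep hlt _ _ ih₁ ih₂ =>
    intro t₀ K h
    have h1 := ih₁ (t₀ + 1) (_ :: K) (by rw [run, h]; simp [step, hlt]; rfl)
    have h2 := ih₂ _ _ h1
    rw [← h2]; congr 1; omega
  | _ => intro t₀ K h; rw [run, h]; rfl

/-- Whether the program text contains an assignment to the register `z`. -/
def Prog.writesReg : Prog → ℕ → Bool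
  | .const x _, z => x == z
  | .copy x _, z => x == z
  | .succ x, z => x == z
  | .pred x, z => x == z
  | .load x _ _, z => x == z
  | .coin x, z => x == z
  | .seq P Q, z => P.writesReg z || Q.writesReg z
  | .ifLt _ _ P Q, z => P.writesReg z || Q.writesReg z
  | .whileLt _ _ P, z => P.writesReg z
  | _, _ => false

/-- Whether the program text contains an assignment to a cell of the array `b`. -/
def Prog.writesArr : Prog → ℕ → Bool
  | .store a _ _, b => a == b
  | .seq P Q, b => P.writesArr b || Q.writesArr b
  | .ifLt _ _ P Q, b => P.writesArr b || Q.writesArr b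
  | .whileLt _ _ P, b => P.writesArr b
  | _, _ => false

/-- The memories `s` and `s'` agree outside the registers and arrays that `P` assigns to. -/
structure Frame (P : Prog) (s s' : Store) : Prop where
  reg : ∀ x, P.writesReg x = false → s'.reg x = s.reg x
  arr : ∀ a, P.writesArr a = false → s'.arr a = s.arr a

theorem Frame.refl (P : Prog) (s : Store) : Frame P s s := ⟨fun _ _ => rfl, fun _ _ => rfl⟩

theorem Frame.trans {P : Prog} {s s' s'' : Store} (h : Frame P s s') (h' : Frame P s' s'') :
    Frame P s s'' :=
  ⟨fun x hx => (h'.reg x hx).trans (h.reg x hx), fun a ha => (h'.arr a ha).trans (h.arr a ha)⟩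

theorem Frame.mono {P Q : Prog} {s s' : Store} (h : Frame P s s')
    (hr : ∀ x, Q.writesReg x = false → P.writesReg x = false)
    (ha : ∀ x, Q.writesArr x = false → P.writesArr x = false) : Frame Q s s' :=
  ⟨fun x hx => h.reg x (hr x hx), fun a hx => h.arr a (ha a hx)⟩

/-- Whatever the text does not assign to keeps its value. Hence invariants need to mention only what
a block changes, and the rest is a syntactic check, mostly by `rfl`. -/
theorem Exec.frame {P : Prog} {s s' : Store} {t : ℕ} (h : Exec P s t s') : Frame P s s' := by
  induction h with
  | skip s => exact Frame.refl _ _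
  | seq _ _ ih₁ ih₂ =>
    refine Frame.trans (ih₁.mono ?_ ?_) (ih₂.mono ?_ ?_) <;>
      intro x hx <;> simp [Prog.writesReg, Prog.writesArr] at hx <;> simp [hx]
  | ifTrue _ _ ih =>
    refine ih.mono ?_ ?_ <;>
      intro x hx <;> simp [Prog.writesReg, Prog.writesArr] at hx <;> simp [hx]
  | ifFalse _ _ ih =>
    refine ih.mono ?_ ?_ <;>
      intro x hx <;> simp [Prog.writesReg, Prog.writesArr] at hx <;> simp [hx]
  | whileDone _ => exact Frame.refl _ _
  | whileStep _ _ _ ih₁ ih₂ =>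
    exact Frame.trans (ih₁.mono (fun _ h => h) (fun _ h => h)) ih₂
  | store a i x s =>
    refine ⟨fun _ _ => rfl, fun b hb => ?_⟩
    have : b ≠ a := by simp [Prog.writesArr] at hb; exact fun h => hb h.symm
    simp [Store.setArr, this]
  | _ =>
    refine ⟨fun z hz => ?_, fun _ _ => rfl⟩
    simp [Prog.writesReg] at hz
    simp [Store.setReg, Function.update_of_ne (Ne.symm hz)]

/-- Started at `s`, the program `P` halts within `c` steps, in a memory that satisfies `Q`. -/
def Spec (P : Prog) (s : Store) (c : ℕ) (Q : Store → Prop) : Prop :=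
  ∃ t ≤ c, ∃ s', Exec P s t s' ∧ Q s'

theorem Spec.mono {P : Prog} {s : Store} {c c' : ℕ} {Q Q' : Store → Prop} (h : Spec P s c Q)
    (hc : c ≤ c') (hQ : ∀ s', Frame P s s' → Q s' → Q' s') : Spec P s c' Q' := by
  obtain ⟨t, ht, s', he, hq⟩ := h
  exact ⟨t, ht.trans hc, s', he, hQ s' he.frame hq⟩

theorem Spec.seq {P R : Prog} {s : Store} {c₁ c₂ c : ℕ} {Q₁ Q : Store → Prop}
    (h₁ : Spec P s c₁ Q₁) (h₂ : ∀ s₁, Frame P s s₁ → Q₁ s₁ → Spec R s₁ c₂ Q)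
    (hc : c₁ + c₂ + 1 ≤ c) : Spec (.seq P R) s c Q := by
  obtain ⟨t, ht, s', he, hq⟩ := h₁
  obtain ⟨t', ht', s'', he', hq'⟩ := h₂ s' he.frame hq
  exact ⟨t + t' + 1, by omega, s'', he.seq he', hq'⟩

theorem Spec.ifLt {x y : ℕ} {P R : Prog} {s : Store} {c c' : ℕ} {Q : Store → Prop}
    (h₁ : s.reg x < s.reg y → Spec P s c Q) (h₂ : ¬ s.reg x < s.reg y → Spec R s c Q)
    (hc : c + 1 ≤ c') : Spec (.ifLt x y P R) s c' Q := by
  by_cases h : s.reg x < s.reg y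
  · obtain ⟨t, ht, s', he, hq⟩ := h₁ h
    exact ⟨t + 1, by omega, s', he.ifTrue h, hq⟩
  · obtain ⟨t, ht, s', he, hq⟩ := h₂ h
    exact ⟨t + 1, by omega, s', he.ifFalse h, hq⟩

/-- Programs without loops and coins. -/
def Prog.straight : Prog → Bool
  | .coin _ => false
  | .whileLt _ _ _ => false
  | .seq P Q => P.straight && Q.straight
  | .ifLt _ _ P Q => P.straight && Q.straight
  | _ => true

/-- The number of nodes of the program text. -/
def Prog.size : Prog → ℕ
  | .seq P Q => P.size + Q.size + 1
  | .ifLt _ _ P Q => P.size + Q.size + 1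
  | .whileLt _ _ P => P.size + 1
  | _ => 1

/-- The effect of a program without loops and coins. -/
def Prog.eval : Prog → Store → Store
  | .const x m, s => s.setReg x m
  | .copy x y, s => s.setReg x (s.reg y)
  | .succ x, s => s.setReg x (s.reg x + 1)
  | .pred x, s => s.setReg x (s.reg x - 1)
  | .load x a i, s => s.setReg x (s.arr a (s.reg i))
  | .store a i x, s => s.setArr a (s.reg i) (s.reg x)
  | .seq P Q, s => Q.eval (P.eval s)
  | .ifLt x y P Q, s => if s.reg x < s.reg y then P.eval s else Q.eval s
  | _, s => s

/-- Every node of a loop-free text is executed at most once, so its size bounds the time. Such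
pieces can then be verified by computing their effect with `simp`. -/
theorem Spec.eval {P : Prog} {s : Store} {c : ℕ} {Q : Store → Prop} (h : P.straight = true)
    (hc : P.size ≤ c) (hQ : Q (P.eval s)) : Spec P s c Q := by
  suffices H : ∀ s, ∃ t ≤ P.size, Exec P s t (P.eval s) by
    obtain ⟨t, ht, he⟩ := H s
    exact ⟨t, ht.trans hc, _, he, hQ⟩
  clear hc hQ
  induction P with
  | coin x => simp [Prog.straight] at h
  | whileLt => simp [Prog.straight] at h
  | seq P Q ihP ihQ =>
    intro s
    simp [Prog.straight] at h
    obtain ⟨t, ht, he⟩ := ihP h.1 s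
    obtain ⟨t', ht', he'⟩ := ihQ h.2 (P.eval s)
    exact ⟨_, by simp only [Prog.size]; omega, he.seq he'⟩
  | ifLt x y P Q ihP ihQ =>
    intro s
    simp [Prog.straight] at h
    obtain ⟨t, ht, he⟩ := ihP h.1 s
    obtain ⟨t', ht', he'⟩ := ihQ h.2 s
    by_cases hlt : s.reg x < s.reg y
    · exact ⟨t + 1, by simp only [Prog.size]; omega, by
        simp only [Prog.eval, hlt, if_true]; exact he.ifTrue hlt⟩
    · exact ⟨t' + 1, by simp only [Prog.size]; omega, by
        simp only [Prog.eval, hlt, if_false]; exact he'.ifFalse hlt⟩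
  | skip => exact fun s => ⟨1, le_rfl, .skip s⟩
  | const x m => exact fun s => ⟨1, le_rfl, .const x m s⟩
  | copy x y => exact fun s => ⟨1, le_rfl, .copy x y s⟩
  | succ x => exact fun s => ⟨1, le_rfl, .succ x s⟩
  | pred x => exact fun s => ⟨1, le_rfl, .pred x s⟩
  | load x a i => exact fun s => ⟨1, le_rfl, .load x a i s⟩
  | store a i x => exact fun s => ⟨1, le_rfl, .store a i x s⟩

/-! ### Counting loops -/

/-- The increment belongs to the loop, so the body has to establish the next invariant for the
memory in which the counter has already been raised. The 3 per iteration pays for the test, the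
sequencing and the increment, the final 1 for the test that fails. -/
theorem Spec.whileUp {x y : ℕ} {body : Prog} {s : Store} {len cost : ℕ} {Q : Store → Prop}
    (I : ℕ → Store → Prop) (c : ℕ → ℕ)
    (hx : body.writesReg x = false) (hy : body.writesReg y = false) (hxy : x ≠ y)
    (hlen : s.reg y = s.reg x + len) (h0 : I 0 s)
    (hs : ∀ i < len, ∀ s', Frame (.whileLt x y (.seq body (.succ x))) s s' →
      s'.reg x = s.reg x + i → s'.reg y = s.reg x + len → I i s' →
      Spec body s' (c i) fun s'' => I (i + 1) (s''.setReg x (s.reg x + i + 1)))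
    (hQ : ∀ s', Frame (.whileLt x y (.seq body (.succ x))) s s' → I len s' → Q s')
    (hc : ∑ i ∈ Finset.range len, (c i + 3) + 1 ≤ cost) :
    Spec (.whileLt x y (.seq body (.succ x))) s cost Q := by
  set W : Prog := .whileLt x y (.seq body (.succ x)) with hW
  have key : ∀ r i, i + r = len → ∀ s', Frame W s s' → s'.reg x = s.reg x + i → I i s' →
      ∃ t ≤ ∑ j ∈ Finset.Ico i len, (c j + 3) + 1, ∃ s'', Exec W s' t s'' ∧ I len s'' := by
    intro r
    induction r with
    | zero =>
      intro i hi s' hf hreg hI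
      obtain rfl : i = len := by omega
      have hyy : s'.reg y = s.reg y := hf.reg y (by simp [hW, Prog.writesReg, hy, hxy])
      exact ⟨1, by simp, s', .whileDone (by omega), hI⟩
    | succ r ih =>
      intro i hi s' hf hreg hI
      have hyy : s'.reg y = s.reg y := hf.reg y (by simp [hW, Prog.writesReg, hy, hxy])
      obtain ⟨t, ht, s₁, he, hI₁⟩ := hs i (by omega) s' hf hreg (by omega) hI
      have hx₁ : s₁.reg x = s.reg x + i := (he.frame.reg x hx).trans hreg
      have he₁ : Exec (.seq body (.succ x)) s' (t + 1 + 1) (s₁.setReg x (s.reg x + i + 1)) := by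
        have := he.seq (Exec.succ x s₁)
        rwa [hx₁] at this
      have hf₁ : Frame W s' (s₁.setReg x (s.reg x + i + 1)) :=
        he₁.frame.mono (fun _ h => h) (fun _ h => h)
      obtain ⟨t', ht', s₂, he₂, hI₂⟩ := ih (i + 1) (by omega) _ (hf.trans hf₁)
        (by simp [Store.setReg]; omega) hI₁
      refine ⟨_, ?_, s₂, Exec.whileStep (by omega) he₁ he₂, hI₂⟩
      rw [Finset.sum_eq_sum_Ico_succ_bot (by omega : i < len)]
      omega
  obtain ⟨t, ht, s', he, hI⟩ := key len 0 (by omega) s (Frame.refl _ _) (by simp) h0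
  refine ⟨t, ?_, s', he, hQ s' he.frame hI⟩
  rw [Finset.range_eq_Ico] at hc
  omega

/-- `for x from 0 to R y - 1 do body` -/
def Prog.forUp (x y : ℕ) (body : Prog) : Prog :=
  .seq (.const x 0) (.whileLt x y (.seq body (.succ x)))

theorem Spec.forUp_var {x y : ℕ} {body : Prog} {s : Store} {len cost : ℕ} {Q : Store → Prop}
    (I : ℕ → Store → Prop) (c : ℕ → ℕ)
    (hx : body.writesReg x = false) (hy : body.writesReg y = false) (hxy : x ≠ y)
    (hlen : s.reg y = len) (h0 : I 0 (s.setReg x 0))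
    (hs : ∀ i < len, ∀ s', Frame (.forUp x y body) s s' →
      s'.reg x = i → s'.reg y = len → I i s' →
      Spec body s' (c i) fun s'' => I (i + 1) (s''.setReg x (i + 1)))
    (hQ : ∀ s', Frame (.forUp x y body) s s' → I len s' → Q s')
    (hc : ∑ i ∈ Finset.range len, (c i + 3) + 3 ≤ cost) :
    Spec (.forUp x y body) s cost Q := by
  have hfr : ∀ s', Frame (.whileLt x y (.seq body (.succ x))) (s.setReg x 0) s' →
      Frame (.forUp x y body) s s' := by
    intro s' h
    refine Frame.trans ((Exec.const x 0 s).frame.mono ?_ ?_) (h.mono ?_ ?_) <;>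
      intro z hz <;> simp_all [Prog.forUp, Prog.writesReg, Prog.writesArr]
  refine Spec.seq (c₁ := 1) (c₂ := ∑ i ∈ Finset.range len, (c i + 3) + 1)
    (Q₁ := fun s' => s' = s.setReg x 0) (Spec.eval rfl le_rfl rfl) ?_ (by omega)
  rintro _ - rfl
  have hx0 : (s.setReg x 0).reg x = 0 := by simp [Store.setReg]
  have hy0 : (s.setReg x 0).reg y = len := by simp [Store.setReg, Ne.symm hxy, hlen]
  refine Spec.whileUp (len := len) I c hx hy hxy (by omega) h0 ?_ ?_ le_rfl
  · intro i hi s' hf h1 h2 h3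
    simp only [hx0, Nat.zero_add] at h1 h2 ⊢
    exact hs i hi s' (hfr s' hf) h1 h2 h3
  · exact fun s' hf h => hQ s' (hfr s' hf) h

theorem Spec.forUp {x y : ℕ} {body : Prog} {s : Store} {len cost : ℕ} {Q : Store → Prop}
    (I : ℕ → Store → Prop) (c : ℕ)
    (hx : body.writesReg x = false) (hy : body.writesReg y = false) (hxy : x ≠ y)
    (hlen : s.reg y = len) (h0 : I 0 (s.setReg x 0))
    (hs : ∀ i < len, ∀ s', Frame (.forUp x y body) s s' →
      s'.reg x = i → s'.reg y = len → I i s' →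
      Spec body s' c fun s'' => I (i + 1) (s''.setReg x (i + 1)))
    (hQ : ∀ s', Frame (.forUp x y body) s s' → I len s' → Q s')
    (hc : len * (c + 3) + 3 ≤ cost) :
    Spec (.forUp x y body) s cost Q :=
  Spec.forUp_var I (fun _ => c) hx hy hxy hlen h0 hs hQ (by simpa using hc)

/-! ### Running times -/

theorem Exec.runtime_le {P : Prog} {s s' : Store} {t : ℕ} (h : Exec P s t s') (ω : ℕ → Bool) :
    runtime ω ([P], s) ≤ t := by
  have := h.run_eq ω ([P], s) 0 [] rfl
  rw [Nat.zero_add] at this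
  exact iInf₂_le t (by rw [this])

instance : IsProbabilityMeasure fairCoins := by
  unfold fairCoins; infer_instance

theorem Exec.expectedRuntime_le {P : Prog} {n k t : ℕ} {L : Fin n → List (Fin n)} {s' : Store}
    (h : Exec P (inputStore L k) t s') : expectedRuntime P L k ≤ t := by
  calc expectedRuntime P L k ≤ ∫⁻ _, (t : ℝ≥0∞) ∂fairCoins :=
        lintegral_mono fun ω => h.runtime_le ω
    _ = t := by simp

theorem Spec.graphExpectedRuntime_le {P : Prog} {n k c : ℕ} {G : SimpleGraph (Fin n)}
    (h : ∀ L, IsAdjacencyLists G L → ∃ Q, Spec P (inputStore L k) c Q) :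
    graphExpectedRuntime P G k ≤ c := by
  refine iSup₂_le fun L hL => ?_
  obtain ⟨Q, t, ht, s', he, -⟩ := h L hL
  exact he.expectedRuntime_le.trans (by exact_mod_cast ht)

/-- An execution without coins is the same for all bit sequences, so "almost surely" holds
everywhere. -/
theorem Spec.alwaysFinds {P : Prog} {n k : ℕ} {G : SimpleGraph (Fin n)}
    {Good : (Fin n → Bool) → Prop}
    (h : ∀ L, IsAdjacencyLists G L →
      ∃ c, Spec P (inputStore L k) c fun s => Good (outputColouring n s)) :
    AlwaysFinds P G k Good := by
  intro L hL
  obtain ⟨c, t, ht, s', he, hg⟩ := h L hL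
  refine Filter.Eventually.of_forall fun ω => ⟨t, ?_⟩
  have := he.run_eq ω (start P L k) 0 [] rfl
  rw [Nat.zero_add] at this
  rw [this]
  exact ⟨rfl, hg⟩

/-! ### The dynamics that the algorithm simulates -/

section Dynamics

variable {n : ℕ} (G : SimpleGraph (Fin n))

open Classical in
/-- The number of neighbours of `v` with the same label as `v`. -/
noncomputable def sameCount {α : Type*} (f : Fin n → α) (v : Fin n) : ℕ :=
  (Finset.univ.filter fun u => G.Adj v u ∧ f u = f v).card

open Classical in
/-- The number of neighbours of `v` whose label is not that of `v`. -/
noncomputable def diffCount {α : Type*} (f : Fin n → α) (v : Fin n) : ℕ :=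
  (Finset.univ.filter fun u => G.Adj v u ∧ f u ≠ f v).card

/-- The vertex `v` violates the internal (`e = true`) or external (`e = false`) condition. -/
def Unhappy (e : Bool) (c : Fin n → Bool) (v : Fin n) : Prop :=
  if e then sameCount G c v < diffCount G c v else diffCount G c v < sameCount G c v

open Classical in
/-- The round in which `v` may change its colour: its residue modulo `d`, if it has degree at most
`d` and no neighbour with the same residue; otherwise `d`, which stands for "never". -/
noncomputable def slot (d : ℕ) (v : Fin n) : ℕ :=
  if sameCount G (fun u : Fin n => (u : ℕ) % d) v = 0 ∧
    diffCount G (fun u : Fin n => (u : ℕ) % d) v ≤ d then (v : ℕ) % d else d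

open Classical in
/-- All unhappy vertices with slot `r` change their colour. -/
noncomputable def flipRound (e : Bool) (d r : ℕ) (c : Fin n → Bool) : Fin n → Bool :=
  fun v => if slot G d v = r ∧ Unhappy G e c v then !c v else c v

/-- The colouring after the rounds `0, …, r - 1`. -/
noncomputable def flipRounds (e : Bool) (d : ℕ) (c : Fin n → Bool) : ℕ → Fin n → Bool
  | 0 => c
  | r + 1 => flipRound G e d r (flipRounds e d c r)

/-- The colouring after `t` cycles of `d` rounds each. -/
noncomputable def flipCycles (e : Bool) (d : ℕ) (c : Fin n → Bool) : ℕ → Fin n → Bool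
  | 0 => c
  | t + 1 => flipRounds G e d (flipCycles e d c t) d

/-- The colouring in which the binary digits of `q` below the leading one are repeated
periodically. -/
def digitColouring (n q : ℕ) : Fin n → Bool :=
  fun v => q.testBit ((v : ℕ) % Nat.log 2 q)

end Dynamics

theorem toNat_eq_toNat_iff : ∀ a b : Bool, a.toNat = b.toNat ↔ a = b := by decide

theorem sameCount_toNat {n : ℕ} (G : SimpleGraph (Fin n)) (c : Fin n → Bool) (v : Fin n) :
    sameCount G (fun u => (c u).toNat) v = sameCount G c v := by
  unfold sameCount; congr 1; ext u; simp [toNat_eq_toNat_iff]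

theorem diffCount_toNat {n : ℕ} (G : SimpleGraph (Fin n)) (c : Fin n → Bool) (v : Fin n) :
    diffCount G (fun u => (c u).toNat) v = diffCount G c v := by
  unfold diffCount; congr 1; ext u; simp [toNat_eq_toNat_iff]

/-! ### Reading the adjacency lists -/

section Input

variable {n : ℕ} (L : Fin n → List (Fin n))

/-- The position at which the list of the vertex `i` begins. -/
def offset (i : ℕ) : ℕ := (((List.ofFn L).take i).map List.length).sum

/-- The total length of the lists. -/
def totalLength : ℕ := ∑ v, (L v).length

/-- The arrays `0` and `1` hold the lists `L`. -/
structure HoldsInput (s : Store) : Prop where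
  offset : ∀ i ≤ n, s.arr 0 i = offset L i
  entry : ∀ (v : Fin n) (j : ℕ) (h : j < (L v).length),
    s.arr 1 (AlmostBisection.offset L v + j) = (L v)[j]

variable {L}

theorem offset_succ (v : Fin n) : offset L (v + 1) = offset L v + (L v).length := by
  have hv : (v : ℕ) < (List.ofFn L).length := by simp
  rw [offset, List.take_add_one, List.map_append, List.sum_append]
  simp [offset]

theorem offset_eq_sum : ∀ i (hi : i ≤ n), offset L i = ∑ j : Fin i, (L (j.castLE hi)).length := by
  intro i
  induction i with
  | zero => intro _; simp [offset]
  | succ i ih =>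
    intro hi
    rw [Fin.sum_univ_castSucc, offset_succ (⟨i, hi⟩ : Fin n), ih (by omega)]
    rfl

theorem offset_last : offset L n = totalLength L := by
  rw [offset_eq_sum n le_rfl]; rfl

theorem flatten_getElem? (l : List (List (Fin n))) : ∀ (i : ℕ) (hi : i < l.length) (j : ℕ)
    (hj : j < l[i].length), l.flatten[((l.take i).map List.length).sum + j]? = some (l[i][j]) := by
  induction l with
  | nil => intro i hi; simp at hi
  | cons a l ih =>
    intro i hi j hj
    cases i with
    | zero => simp at hj ⊢; rw [List.getElem?_append_left hj]; simp
    | succ i =>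
      simp at hi hj ⊢
      rw [List.getElem?_append_right (by omega), Nat.add_assoc, Nat.add_sub_cancel_left]
      simpa using ih i hi j hj

theorem holdsInput_inputStore (k : ℕ) : HoldsInput L (inputStore L k) := by
  refine ⟨fun i hi => by simp [inputStore, hi, offset], fun v j h => ?_⟩
  have := flatten_getElem? (List.ofFn L) v (by simp) j (by simpa using h)
  simp only [inputStore, offset, one_ne_zero, if_false, if_true, this]
  simp

theorem HoldsInput.frame {P : Prog} {s s' : Store} (h : HoldsInput L s) (hf : Frame P s s')
    (h0 : P.writesArr 0 = false) (h1 : P.writesArr 1 = false) : HoldsInput L s' :=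
  ⟨by rw [hf.arr 0 h0]; exact h.offset, by rw [hf.arr 1 h1]; exact h.entry⟩

theorem HoldsInput.of_arr {s s' : Store} (h : HoldsInput L s) (h0 : s'.arr 0 = s.arr 0)
    (h1 : s'.arr 1 = s.arr 1) : HoldsInput L s' :=
  ⟨by rw [h0]; exact h.offset, by rw [h1]; exact h.entry⟩

end Input

/-! ### Memory updates and scanning a neighbourhood -/

theorem Store.reg_setReg (s : Store) (x m y : ℕ) :
    (s.setReg x m).reg y = if y = x then m else s.reg y := by
  simp [Store.setReg, Function.update_apply]

theorem Store.arr_setReg (s : Store) (x m : ℕ) : (s.setReg x m).arr = s.arr := rfl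

theorem Store.reg_setArr (s : Store) (a i m : ℕ) : (s.setArr a i m).reg = s.reg := rfl

theorem Store.arr_setArr (s : Store) (a i m b j : ℕ) :
    (s.setArr a i m).arr b j = if b = a ∧ j = i then m else s.arr b j := by
  by_cases h : b = a
  · subst h; simp [Store.setArr, Function.update_apply]
  · simp [Store.setArr, h]

/-- The array `a` holds the values of `f`. -/
def Holds {n : ℕ} (a : ℕ) (f : Fin n → ℕ) (s : Store) : Prop := ∀ v : Fin n, s.arr a v = f v

theorem Holds.of_arr {n a : ℕ} {f : Fin n → ℕ} {s s' : Store} (h : Holds a f s)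
    (h' : s'.arr a = s.arr a) : Holds a f s' := fun v => by rw [h', h v]

infixr:60 " ;; " => Prog.seq

/-- Compares the entries of the array `a` at the neighbours of the vertex `R 4` with the entry at
that vertex, which is put into `R 8`; counts the equal ones in `R 10`, the others in `R 11`. -/
def Prog.scan (a : ℕ) : Prog :=
  (.load 8 a 4 ;; .const 10 0 ;; .const 11 0 ;; .load 6 0 4 ;; .copy 7 4 ;; .succ 7 ;;
    .load 7 0 7) ;;
  .whileLt 6 7 ((.load 5 1 6 ;; .load 9 a 5 ;;
    .ifLt 8 9 (.succ 11) (.ifLt 9 8 (.succ 11) (.succ 10))) ;; .succ 6)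

theorem List.countP_eq_card {n : ℕ} {l : List (Fin n)} (hl : l.Nodup) (p q : Fin n → Prop)
    [DecidablePred p] [DecidablePred q] (h : ∀ u, u ∈ l ↔ q u) :
    l.countP p = (Finset.univ.filter fun u => q u ∧ p u).card := by
  rw [List.countP_eq_length_filter, ← List.toFinset_card_of_nodup (hl.filter _)]
  congr 1
  ext u
  simp [h]

/-- The counters run along the list of `v`, which contains exactly the neighbours and no
repetitions, so counting list entries is counting vertices. -/
theorem Spec.scan {n : ℕ} {G : SimpleGraph (Fin n)} {L : Fin n → List (Fin n)}
    (hL : IsAdjacencyLists G L) {a : ℕ} {f : Fin n → ℕ} {s : Store} (hi : HoldsInput L s)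
    (ha : Holds a f s) {v : Fin n} (hv : s.reg 4 = v) {c : ℕ}
    (hc : 14 * (L v).length + 15 ≤ c) :
    Spec (.scan a) s c fun s' => s'.reg 8 = f v ∧ s'.reg 10 = sameCount G f v ∧
      s'.reg 11 = diffCount G f v := by
  classical
  have o0 := hi.offset v v.2.le
  have o1 := hi.offset (v + 1) v.2
  rw [offset_succ] at o1
  refine Spec.seq (c₁ := 13) (c₂ := 14 * (L v).length + 1)
    (Q₁ := fun s₁ => s₁.arr = s.arr ∧ s₁.reg 8 = f v ∧ s₁.reg 10 = 0 ∧ s₁.reg 11 = 0 ∧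
      s₁.reg 6 = offset L v ∧ s₁.reg 7 = offset L v + (L v).length)
    (Spec.eval rfl (by simp [Prog.size]) ?_) ?_ (by omega)
  · simp [Prog.eval, Store.reg_setReg, Store.arr_setReg, hv, o0, o1, ha v]
  rintro s₁ - ⟨harr, h8, h10, h11, h6, h7⟩
  refine Spec.whileUp (len := (L v).length) (fun j s' => s'.reg 8 = f v ∧
    s'.reg 10 = ((L v).take j).countP (fun u => f u = f v) ∧
    s'.reg 11 = ((L v).take j).countP (fun u => f u ≠ f v)) (fun _ => 11) rfl rfl (by decide)
    (by omega) (by simp [h8, h10, h11]) ?_ ?_ ?_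
  · rintro j hj s' hf hr6 - ⟨h8', h10', h11'⟩
    refine Spec.eval rfl (by simp [Prog.size]) ?_
    have e1 : s'.arr = s.arr := by
      rw [← harr]; funext b; exact hf.arr b rfl
    have e2 : s'.arr 1 (s'.reg 6) = (L v)[j] := by
      rw [hr6, h6, e1]; exact hi.entry v j hj
    have e3 : s'.arr a ((L v)[j] : Fin n) = f ((L v)[j]) := by rw [e1]; exact ha _
    have e4 : (L v).take (j + 1) = (L v).take j ++ [(L v)[j]] := by
      rw [List.take_add_one]; simp [hj]
    rw [e4]
    simp only [List.countP_append, List.countP_singleton]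
    rcases lt_trichotomy (f v) (f ((L v)[j])) with hlt | heq | hgt
    · simp [Prog.eval, Store.reg_setReg, Store.arr_setReg, e2, e3, h8', hlt, h10', h11', hlt.ne']
    · simp [Prog.eval, Store.reg_setReg, Store.arr_setReg, e2, e3, h8', h10', h11', heq]
    · simp [Prog.eval, Store.reg_setReg, Store.arr_setReg, e2, e3, h8', hgt, h10', h11', hgt.ne,
        not_lt.2 hgt.le]
  · rintro s' hf ⟨h8', h10', h11'⟩
    rw [List.take_length] at h10' h11'
    refine ⟨h8', h10'.trans ?_, h11'.trans ?_⟩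
    · rw [List.countP_eq_card (hL v).1 _ _ (hL v).2]
      unfold sameCount; congr!
    · rw [List.countP_eq_card (hL v).1 _ _ (hL v).2]
      unfold diffCount; congr!
  · simp; omega

/-- A loop over all vertices, the time for each of which is linear in its degree. -/
theorem Spec.vertices {n : ℕ} (L : Fin n → List (Fin n)) {body : Prog} {s : Store} {cost : ℕ}
    {Q : Store → Prop} (I : ℕ → Store → Prop) (α β : ℕ)
    (hx : body.writesReg 4 = false) (hy : body.writesReg 0 = false) (hn : s.reg 0 = n)
    (h0 : I 0 (s.setReg 4 0))
    (hs : ∀ v : Fin n, ∀ s', Frame (.forUp 4 0 body) s s' → s'.reg 4 = v → s'.reg 0 = n →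
      I v s' → Spec body s' (α * (L v).length + β) fun s'' => I (v + 1) (s''.setReg 4 (v + 1)))
    (hQ : ∀ s', Frame (.forUp 4 0 body) s s' → I n s' → Q s')
    (hc : (α + β + 3) * (n + totalLength L + 1) ≤ cost) : Spec (.forUp 4 0 body) s cost Q := by
  refine Spec.forUp_var I (fun i => if h : i < n then α * (L ⟨i, h⟩).length + β else 0) hx hy
    (by decide) hn h0 (fun i hi s' hf h1 h2 h3 => ?_) hQ ?_
  · simp only [hi, dif_pos]
    exact hs ⟨i, hi⟩ s' hf h1 h2 h3
  · refine le_trans ?_ hc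
    rw [Finset.sum_range]
    simp only [Fin.is_lt, dif_pos, Fin.eta, Finset.sum_add_distrib, ← Finset.mul_sum]
    simp only [totalLength, Finset.sum_const, Finset.card_univ, Fintype.card_fin, smul_eq_mul]
    nlinarith [Nat.zero_le (α * n), Nat.zero_le (β * ∑ v, (L v).length), Nat.zero_le α,
      Nat.zero_le β, Nat.zero_le (∑ v, (L v).length)]

/-! ### The building blocks of the program

Registers: `0` is the number `n` of vertices, `1` the accuracy parameter `k`, `2` and `3` hold the
constants zero and one, `4` is the current vertex, `12` the number `q` of the current trial, `13`
the bound for it, `14` and `15` hold the numbers `d` of rounds in a cycle and `T` of cycles in a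
trial. Arrays: `2` is the output, `3` the current colouring, `4` holds the slots, `5` the residues
modulo `d`, `6` the binary digits of `q`. -/

/-- The facts about the memory that hold from the end of the initialisation on. -/
structure Env {n : ℕ} (L : Fin n → List (Fin n)) (k d T : ℕ) (s : Store) : Prop where
  input : HoldsInput L s
  n : s.reg 0 = n
  k : s.reg 1 = k
  zero : s.reg 2 = 0
  one : s.reg 3 = 1
  d : s.reg 14 = d
  T : s.reg 15 = T

/-- The program does not touch anything that `Env` speaks of. -/
def Prog.harmless (P : Prog) : Bool :=
  !(P.writesReg 0 || P.writesReg 1 || P.writesReg 2 || P.writesReg 3 || P.writesReg 14 ||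
    P.writesReg 15 || P.writesArr 0 || P.writesArr 1)

theorem Env.frame {n : ℕ} {L : Fin n → List (Fin n)} {k d T : ℕ} {P : Prog} {s s' : Store}
    (h : Env L k d T s) (hf : Frame P s s') (hP : P.harmless = true) : Env L k d T s' := by
  simp only [Prog.harmless, Bool.not_eq_true', Bool.or_eq_false_iff] at hP
  obtain ⟨⟨⟨⟨⟨⟨⟨h0, h1⟩, h2⟩, h3⟩, h14⟩, h15⟩, ha⟩, hb⟩ := hP
  exact ⟨h.input.frame hf ha hb, (hf.reg _ h0).trans h.n, (hf.reg _ h1).trans h.k,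
    (hf.reg _ h2).trans h.zero, (hf.reg _ h3).trans h.one, (hf.reg _ h14).trans h.d,
    (hf.reg _ h15).trans h.T⟩

theorem Holds.frame {n a : ℕ} {f : Fin n → ℕ} {P : Prog} {s s' : Store} (h : Holds a f s)
    (hf : Frame P s s') (hP : P.writesArr a = false) : Holds a f s' := h.of_arr (hf.arr a hP)

/-- `R dst := R x * R y` -/
def Prog.mul (dst x y : ℕ) : Prog :=
  .const dst 0 ;; .forUp 27 x (.forUp 28 y (.succ dst))

/-- Multiplication is repeated increment. The bounds by 27 keep the three registers clear of the
loop counters 27 and 28; the two factors may coincide, as they do when `d` is squared. -/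
theorem Spec.mul {dst x y a b : ℕ} {s : Store} (hx : s.reg x = a) (hy : s.reg y = b)
    (h1 : dst < 27) (h2 : x < 27) (h3 : y < 27) (h4 : dst ≠ x) (h5 : dst ≠ y) {c : ℕ}
    (hc : a * (4 * b + 6) + 5 ≤ c) :
    Spec (.mul dst x y) s c fun s' => s'.reg dst = a * b := by
  refine Spec.seq (c₁ := 1) (c₂ := a * (4 * b + 6) + 3) (Q₁ := fun s' => s' = s.setReg dst 0)
    (Spec.eval rfl le_rfl rfl) ?_ (by omega)
  rintro _ - rfl
  refine Spec.forUp (len := a) (fun i s' => s'.reg dst = i * b) (4 * b + 3) ?_ ?_ (by omega) ?_ ?_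
    ?_ (fun _ _ h => h) (by lia)
  · simp [Prog.forUp, Prog.writesReg]; omega
  · simp [Prog.forUp, Prog.writesReg]; omega
  · simp [Store.reg_setReg, h4.symm, hx]
  · have : dst ≠ 27 := by omega
    simp [Store.reg_setReg, this]
  · intro i hi s' hf h27 hx' hI
    refine Spec.forUp (len := b) (fun j s' => s'.reg dst = i * b + j) 1 ?_ ?_ (by omega) ?_ ?_ ?_
      ?_ (by omega)
    · simp [Prog.writesReg]; omega
    · simp [Prog.writesReg]; omega
    · rw [hf.reg y]
      · simp [Store.reg_setReg, h5.symm, hy]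
      · simp [Prog.forUp, Prog.writesReg]; omega
    · have : dst ≠ 28 := by omega
      simp [Store.reg_setReg, this, hI]
    · intro j hj s'' _ _ _ h
      have : dst ≠ 28 := by omega
      exact Spec.eval rfl le_rfl (by simp [Prog.eval, Store.reg_setReg, this, h]; omega)
    · intro s'' _ h
      have : dst ≠ 27 := by omega
      simp [Store.reg_setReg, this, h]; ring

/-- Runs `body` for all vertices, while `R 18` holds the residue of the vertex modulo `R m`. -/
def Prog.cyclic (m : ℕ) (body : Prog) : Prog :=
  .const 18 0 ;; .forUp 4 0 (body ;; (.succ 18 ;; .ifLt 18 m .skip (.const 18 0)))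

/-- The machine has no division; this lets the residue be maintained while the vertices are
traversed. -/
theorem succ_mod_eq (v : ℕ) {M : ℕ} (hM : 1 ≤ M) :
    (v + 1) % M = if v % M + 1 < M then v % M + 1 else 0 := by
  have h := Nat.mod_lt v hM
  have : (v + 1) % M = (v % M + 1) % M := by
    conv_lhs => rw [← Nat.div_add_mod v M, Nat.add_assoc, Nat.mul_add_mod]
  rw [this]
  split_ifs with h'
  · exact Nat.mod_eq_of_lt h'
  · rw [show v % M + 1 = M by omega, Nat.mod_self]

/-- The invariant sees only the arrays, so the updates of the residue in register 18 cannot disturb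
it. -/
theorem Spec.cyclic {n : ℕ} (L : Fin n → List (Fin n)) {m M : ℕ} {body : Prog} {s : Store}
    {cost : ℕ} {Q : Store → Prop} (I : ℕ → (ℕ → ℕ → ℕ) → Prop) (β : ℕ) (hn : s.reg 0 = n)
    (hm : s.reg m = M) (hM : 1 ≤ M) (hm4 : m ≠ 4) (hm18 : m ≠ 18)
    (hb0 : body.writesReg 0 = false) (hb4 : body.writesReg 4 = false)
    (hb18 : body.writesReg 18 = false) (hbm : body.writesReg m = false) (h0 : I 0 s.arr)
    (hs : ∀ v : Fin n, ∀ s', Frame (.cyclic m body) s s' → s'.reg 4 = v → s'.reg 18 = v % M →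
      I v s'.arr → Spec body s' β fun s'' => I (v + 1) s''.arr)
    (hQ : ∀ s', Frame (.cyclic m body) s s' → I n s'.arr → Q s')
    (hc : (β + 11) * (n + totalLength L + 1) ≤ cost) : Spec (.cyclic m body) s cost Q := by
  have hfr : ∀ s', Frame (.forUp 4 0 (body ;; (.succ 18 ;; .ifLt 18 m .skip (.const 18 0))))
      (s.setReg 18 0) s' → Frame (.cyclic m body) s s' := by
    intro s' h
    refine Frame.trans ((Exec.const 18 0 s).frame.mono ?_ ?_) (h.mono ?_ ?_) <;>
      intro z hz <;> simp_all [Prog.forUp, Prog.cyclic, Prog.writesReg, Prog.writesArr]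
  refine Spec.seq (c₁ := 1) (c₂ := (β + 9) * (n + totalLength L + 1))
    (Q₁ := fun s' => s' = s.setReg 18 0) (Spec.eval rfl le_rfl rfl) ?_ (by lia)
  rintro _ - rfl
  refine Spec.vertices L (fun v s' => I v s'.arr ∧ s'.reg 18 = v % M) 0 (β + 6) ?_ ?_ ?_ ?_ ?_ ?_
    (by lia)
  · simp [Prog.writesReg, hb4]
  · simp [Prog.writesReg, hb0]
  · simp [Store.reg_setReg, hn]
  · exact ⟨h0, by simp [Store.reg_setReg]⟩
  · rintro v s' hf h4 hn' ⟨hI, h18⟩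
    have hmM : s'.reg m = M := by
      rw [hf.reg m (by simp [Prog.forUp, Prog.writesReg, hbm, hm4.symm, hm18.symm])]
      simp [Store.reg_setReg, hm18, hm]
    refine Spec.seq (c₂ := 5) (hs v s' (hfr s' hf) h4 h18 hI) ?_ (by omega)
    intro s₁ hf₁ hI₁
    refine Spec.eval rfl (by simp [Prog.size]) ?_
    have e18 := (hf₁.reg 18 hb18).trans h18
    have em := (hf₁.reg m hbm).trans hmM
    rw [succ_mod_eq _ hM]
    by_cases h : (v : ℕ) % M + 1 < M
    · simp [Prog.eval, Store.reg_setReg, Store.arr_setReg, e18, em, hm18, h, hI₁]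
    · simp [Prog.eval, Store.reg_setReg, Store.arr_setReg, e18, em, hm18, h, hI₁]
  · rintro s' hf ⟨hI, -⟩
    exact hQ s' (hfr s' hf) hI

theorem holds_of_partial {n : ℕ} {arr : ℕ → ℕ → ℕ} {a : ℕ} {f : Fin n → ℕ} {v : Fin n} {x : ℕ}
    (h : ∀ u : Fin n, (u : ℕ) < v → arr a u = f u) (hx : x = f v)
    {arr' : ℕ → ℕ → ℕ} (h' : ∀ j, arr' a j = if j = v then x else arr a j) :
    ∀ u : Fin n, (u : ℕ) < v + 1 → arr' a u = f u := by
  intro u hu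
  rw [h']
  split_ifs with e
  · rw [hx, Fin.ext e]
  · exact h u (by omega)

/-- Stores the residues modulo `d`. -/
def Prog.residues : Prog := .cyclic 14 (.store 5 4 18)

section Blocks

variable {n : ℕ} {G : SimpleGraph (Fin n)} {L : Fin n → List (Fin n)} {k d T : ℕ} {s : Store}
  {c : ℕ} {e : Bool}

theorem Spec.residues (hE : Env L k d T s) (hd : 1 ≤ d)
    (hc : 12 * (n + totalLength L + 1) ≤ c) :
    Spec .residues s c fun s' => Holds (n := n) 5 (fun v => (v : ℕ) % d) s' := by
  refine Spec.cyclic L (fun v arr => ∀ u : Fin n, (u : ℕ) < v → arr 5 u = (u : ℕ) % d) 1 hE.n hE.d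
    hd (by decide) (by decide) rfl rfl rfl rfl (by simp) ?_ ?_ hc
  · intro v s' _ h4 h18 hI
    refine Spec.eval rfl le_rfl ?_
    exact holds_of_partial hI rfl fun j => by
      simp [Prog.eval, Store.arr_setArr, h4, h18]
  · exact fun s' _ h u => h u u.2

/-- Computes the slots of all vertices. -/
def Prog.slots : Prog :=
  .forUp 4 0 (.scan 5 ;; .ifLt 2 10 (.store 4 4 14) (.ifLt 14 11 (.store 4 4 14) (.store 4 4 8)))

theorem Spec.slots (hL : IsAdjacencyLists G L) (hE : Env L k d T s)
    (hr : Holds (n := n) 5 (fun v => (v : ℕ) % d) s) (hc : 40 * (n + totalLength L + 1) ≤ c) :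
    Spec .slots s c fun s' => Holds 4 (slot G d) s' := by
  refine Spec.vertices L (fun v s' => ∀ u : Fin n, (u : ℕ) < v → s'.arr 4 u = slot G d u) 14 22
    rfl rfl hE.n (by simp) ?_ (fun s' _ h u => h u u.2) (by lia)
  intro v s' hf h4 _ hI
  have hE' := hE.frame hf rfl
  have h5 := hr.frame hf rfl
  refine Spec.seq (c₂ := 5) (Spec.scan hL hE'.input h5 h4 le_rfl) ?_ (by omega)
  rintro s₁ hf₁ ⟨e8, e10, e11⟩
  have e2 := (hf₁.reg 2 rfl).trans hE'.zero
  have e14 := (hf₁.reg 14 rfl).trans hE'.d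
  have e4 := (hf₁.reg 4 rfl).trans h4
  refine Spec.eval rfl (by simp [Prog.size]) ?_
  refine holds_of_partial (arr := s₁.arr) (fun u hu => ?_) rfl fun j => ?_
  · rw [hf₁.arr 4 rfl]; exact hI u hu
  · simp only [Prog.eval, e2, e10, e14, e11, slot]
    by_cases a1 : sameCount G (fun u : Fin n => (u : ℕ) % d) v = 0
    · by_cases a2 : diffCount G (fun u : Fin n => (u : ℕ) % d) v ≤ d
      · simp [a1, a2, not_lt.2 a2, Store.arr_setArr, Store.arr_setReg, e4, e8]
      · simp [a1, a2, not_le.1 a2, Store.arr_setArr, Store.arr_setReg, e4]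
    · simp [a1, Nat.pos_of_ne_zero a1, Store.arr_setArr, Store.arr_setReg, e4]

theorem Spec.whileStep {x y c₁ c₂ : ℕ} {P : Prog} {Q₁ Q : Store → Prop}
    (h : s.reg x < s.reg y) (h₁ : Spec P s c₁ Q₁)
    (h₂ : ∀ s₁, Frame P s s₁ → Q₁ s₁ → Spec (.whileLt x y P) s₁ c₂ Q) (hc : c₁ + c₂ + 1 ≤ c) :
    Spec (.whileLt x y P) s c Q := by
  obtain ⟨t, ht, s', he, hq⟩ := h₁
  obtain ⟨t', ht', s'', he', hq'⟩ := h₂ s' he.frame hq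
  exact ⟨t + t' + 1, by omega, s'', he.whileStep h he', hq'⟩

theorem Spec.whileDone {x y : ℕ} {P : Prog} {Q : Store → Prop}
    (h : ¬ s.reg x < s.reg y) (hQ : Q s) (hc : 1 ≤ c) : Spec (.whileLt x y P) s c Q :=
  ⟨1, hc, s, .whileDone h, hQ⟩

/-- `R 24 := R 24 + R 23 / 2`, `R 23 := R 23 % 2` -/
def Prog.halve : Prog := .whileLt 3 23 (.pred 23 ;; .pred 23 ;; .succ 24)

theorem Spec.halve (x : ℕ) : ∀ {s : Store}, s.reg 3 = 1 → s.reg 23 = x →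
    Spec .halve s (3 * x + 1) fun s' =>
      s'.reg 23 = x % 2 ∧ s'.reg 24 = s.reg 24 + x / 2 := by
  induction x using Nat.strong_induction_on with
  | _ x ih =>
    intro s h3 hx
    by_cases hlt : 1 < x
    · refine Spec.whileStep (c₁ := 5) (c₂ := 3 * (x - 2) + 1)
        (Q₁ := fun s₁ => s₁.reg 3 = 1 ∧ s₁.reg 23 = x - 2 ∧ s₁.reg 24 = s.reg 24 + 1) (by omega)
        (Spec.eval rfl (by simp [Prog.size]) ?_) ?_ (by omega)
      · simp [Prog.eval, Store.reg_setReg, h3, hx]; omega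
      · rintro s₁ - ⟨a, b, c⟩
        exact (ih (x - 2) (by omega) a b).mono le_rfl fun s' _ h => by omega
    · exact Spec.whileDone (by omega) ⟨by omega, by omega⟩ (by omega)

/-- Writes the binary digits of `R 23` below the leading one, starting at position `R 22`. -/
def Prog.digitLoop : Prog :=
  .whileLt 3 23 (.const 24 0 ;; .halve ;; (.store 6 22 23 ;; .copy 23 24 ;; .succ 22))

/-- Halving `x` takes time about 3x, and the successive halves form a geometric series, so all
digits are found in linear time. The starting position `M` is general for the sake of the induction,
which shifts it by one. -/
theorem Spec.digitLoop (x : ℕ) : ∀ {s : Store} {M : ℕ}, s.reg 3 = 1 → s.reg 23 = x →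
    s.reg 22 = M → Spec .digitLoop s (20 * x + 1) fun s' =>
      s'.reg 22 = M + Nat.log 2 x ∧ (∀ i < M, s'.arr 6 i = s.arr 6 i) ∧
      ∀ j < Nat.log 2 x, s'.arr 6 (M + j) = (x.testBit j).toNat := by
  induction x using Nat.strong_induction_on with
  | _ x ih =>
    intro s M h3 hx hM
    by_cases hlt : 1 < x
    · have hlog : Nat.log 2 x = Nat.log 2 (x / 2) + 1 := Nat.log_of_one_lt_of_le (by omega) hlt
      refine Spec.whileStep (c₁ := 3 * x + 9) (c₂ := 20 * (x / 2) + 1)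
        (Q₁ := fun s₁ => s₁.reg 3 = 1 ∧ s₁.reg 23 = x / 2 ∧ s₁.reg 22 = M + 1 ∧
          s₁.arr 6 M = x % 2 ∧ ∀ i < M, s₁.arr 6 i = s.arr 6 i) (by omega) ?_ ?_ (by omega)
      · refine Spec.seq (c₁ := 1) (c₂ := 3 * x + 7) (Q₁ := fun s₁ => s₁ = s.setReg 24 0)
          (Spec.eval rfl le_rfl rfl) ?_ (by omega)
        rintro _ - rfl
        refine Spec.seq (c₂ := 5) (Spec.halve x (by simp [Store.reg_setReg, h3])
          (by simp [Store.reg_setReg, hx])) ?_ (by omega)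
        rintro s₁ hf ⟨a, b⟩
        have c3 := hf.reg 3 rfl
        have c22 := hf.reg 22 rfl
        have c6 := hf.arr 6 rfl
        simp only [Store.reg_setReg, Store.arr_setReg] at b c3 c22 c6
        simp at b c3 c22
        refine Spec.eval rfl (by simp [Prog.size]) ?_
        simp only [Prog.eval, Store.reg_setReg, Store.arr_setReg, Store.arr_setArr,
          Store.reg_setArr]
        simp [a, b, c3, c22, c6, h3, hM]
        intro i hi h; omega
      · rintro s₁ - ⟨a, b, c, e, f⟩
        refine (ih (x / 2) (by omega) a b c).mono le_rfl fun s' _ ⟨h1, h2, h3⟩ => ?_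
        refine ⟨by omega, fun i hi => by rw [h2 i (by omega), f i hi], fun j hj => ?_⟩
        cases j with
        | zero =>
          rw [Nat.add_zero, h2 M (by omega), e, Nat.testBit_zero]
          rcases Nat.mod_two_eq_zero_or_one x with h | h <;> simp [h]
        | succ j =>
          rw [show M + (j + 1) = M + 1 + j by omega, h3 j (by omega), Nat.testBit_succ]
    · have hlog : Nat.log 2 x = 0 := Nat.log_of_lt (by omega)
      exact Spec.whileDone (by omega) ⟨by omega, fun _ _ => rfl, by simp [hlog]⟩ (by omega)

/-- Installs the colouring that belongs to the number `q`. -/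
def Prog.initial : Prog :=
  (.copy 23 12 ;; .const 22 0) ;; .digitLoop ;; .cyclic 22 (.load 9 6 18 ;; .store 3 4 9)

theorem Spec.initial (hE : Env L k d T s) {q : ℕ} (hq : s.reg 12 = q) (h2 : 2 ≤ q) (hqn : q ≤ n)
    (hc : 40 * (n + totalLength L + 1) ≤ c) :
    Spec .initial s c fun s' => Holds 3 (fun v => (digitColouring n q v).toNat) s' := by
  refine Spec.seq (c₁ := 3) (c₂ := 20 * q + 2 + 14 * (n + totalLength L + 1))
    (Q₁ := fun s₁ => s₁.reg 23 = q ∧ s₁.reg 22 = 0)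
    (Spec.eval rfl (by simp [Prog.size]) ?_) ?_ (by lia)
  · simp [Prog.eval, Store.reg_setReg, hq]
  rintro s₁ hf₁ ⟨a, b⟩
  have hE₁ := hE.frame hf₁ rfl
  refine Spec.seq (c₂ := 14 * (n + totalLength L + 1)) (Spec.digitLoop q hE₁.one a b) ?_
    (by omega)
  rintro s₂ hf₂ ⟨a₂, -, b₂⟩
  have hE₂ := hE₁.frame hf₂ rfl
  have hM : 1 ≤ Nat.log 2 q := Nat.log_pos (by omega) h2
  simp only [Nat.zero_add] at a₂ b₂
  refine Spec.cyclic L (fun v arr => arr 6 = s₂.arr 6 ∧ ∀ u : Fin n, (u : ℕ) < v →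
    arr 3 u = (digitColouring n q u).toNat) 3 hE₂.n a₂
    hM (by decide) (by decide) rfl rfl rfl rfl (by simp) ?_ ?_ le_rfl
  · rintro v s' _ h4 h18 ⟨hI6, hI⟩
    refine Spec.eval rfl le_rfl ⟨?_, ?_⟩
    · funext j; simp [Prog.eval, Store.arr_setArr, Store.arr_setReg, hI6]
    refine holds_of_partial (arr := s'.arr) hI rfl fun j => ?_
    have := b₂ ((v : ℕ) % Nat.log 2 q) (Nat.mod_lt _ hM)
    simp [Prog.eval, Store.arr_setArr, Store.arr_setReg, Store.reg_setReg, h4, h18, hI6, this,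
      digitColouring]
  · exact fun s' _ h u => h.2 u u.2

end Blocks

/-! ### The rounds of the local search -/

section Flip

variable {n : ℕ} {G : SimpleGraph (Fin n)} {L : Fin n → List (Fin n)} {k d T : ℕ} {s : Store}
  {c : ℕ} {e : Bool}

/-- A vertex with a slot below `d` has no neighbour in its own residue class. So the vertices
allowed to move in one round form an independent set; `r < d` excludes the value that marks the
frozen vertices. -/
theorem slot_ne_of_adj {r : ℕ} {u v : Fin n} (hr : r < d) (h : slot G d v = r) (ha : G.Adj v u) :
    slot G d u ≠ r := by
  intro hu
  unfold slot at h hu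
  split_ifs at h hu with h1 h2 <;> try omega
  have h3 := h1.1
  rw [sameCount, Finset.card_eq_zero] at h3
  have hm : u ∈ (∅ : Finset (Fin n)) := by
    rw [← h3]
    simp only [Finset.mem_filter, Finset.mem_univ, true_and]
    exact ⟨ha, by omega⟩
  simp at hm

theorem sameCount_congr {α : Type*} {f g : Fin n → α} {v : Fin n} (hv : f v = g v)
    (h : ∀ u, G.Adj v u → f u = g u) : sameCount G f v = sameCount G g v := by
  unfold sameCount
  congr 1; ext u
  simp only [Finset.mem_filter, Finset.mem_univ, true_and]
  exact and_congr_right fun ha => by rw [hv, h u ha]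

theorem diffCount_congr {α : Type*} {f g : Fin n → α} {v : Fin n} (hv : f v = g v)
    (h : ∀ u, G.Adj v u → f u = g u) : diffCount G f v = diffCount G g v := by
  unfold diffCount
  congr 1; ext u
  simp only [Finset.mem_filter, Finset.mem_univ, true_and]
  exact and_congr_right fun ha => by rw [hv, h u ha]

theorem unhappy_congr {f g : Fin n → Bool} {v : Fin n} (hv : f v = g v)
    (h : ∀ u, G.Adj v u → f u = g u) : Unhappy G e f v ↔ Unhappy G e g v := by
  rw [Unhappy, Unhappy, sameCount_congr hv h, diffCount_congr hv h]

/-- Runs `P` if the vertex that has just been scanned is unhappy. -/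
def Prog.ifUnhappy (e : Bool) (P : Prog) : Prog :=
  .ifLt (if e then 10 else 11) (if e then 11 else 10) P .skip

theorem unhappy_iff_reg {f : Fin n → Bool} {v : Fin n} (h10 : s.reg 10 = sameCount G f v)
    (h11 : s.reg 11 = diffCount G f v) :
    s.reg (if e then 10 else 11) < s.reg (if e then 11 else 10) ↔ Unhappy G e f v := by
  cases e <;> simp [Unhappy, h10, h11]

/-- The round `R 17`. -/
def Prog.round (e : Bool) : Prog :=
  .forUp 4 0 (.load 18 4 4 ;; .ifLt 18 17 .skip (.ifLt 17 18 .skip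
    (.scan 3 ;; .ifUnhappy e (.ifLt 2 8 (.store 3 4 2) (.store 3 4 3)))))

/-- The program recolours in place, whereas `flipRound` is simultaneous. This makes no difference:
when `v` is scanned the smaller vertices have been updated, but no neighbour of `v` moves in the
round of `v`, so the mixed colouring `w` agrees with `f` around `v`. -/
theorem Spec.round (hL : IsAdjacencyLists G L) (hE : Env L k d T s) (h4 : Holds 4 (slot G d) s)
    {f : Fin n → Bool} (h3 : Holds 3 (fun v => (f v).toNat) s) {r : ℕ} (h17 : s.reg 17 = r)
    (hr : r < d) (hc : 42 * (n + totalLength L + 1) ≤ c) :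
    Spec (.round e) s c fun s' => Holds 3 (fun v => (flipRound G e d r f v).toNat) s' := by
  classical
  set g := flipRound G e d r f with hg
  refine Spec.vertices L (fun v s' => Holds 3 (fun u : Fin n =>
    (if (u : ℕ) < v then g u else f u).toNat) s') 14 25
    (by cases e <;> rfl) (by cases e <;> rfl) hE.n
    (fun u => by simpa [Store.arr_setReg] using h3 u) ?_ ?_ (by lia)
  · intro v s' hf hv _ hI
    have hE' := hE.frame hf (by cases e <;> rfl)
    have h4' := h4.frame hf (by cases e <;> rfl)
    have h17' := (hf.reg 17 (by cases e <;> rfl)).trans h17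
    have e18 : s'.arr 4 (s'.reg 4) = slot G d v := by rw [hv]; exact h4' v
    refine Spec.seq (c₁ := 1) (c₂ := 14 * (L v).length + 23)
      (Q₁ := fun s₁ => s₁ = s'.setReg 18 (slot G d v))
      (Spec.eval rfl le_rfl (by simp [Prog.eval, e18])) ?_ (by omega)
    rintro s₁ - hs₁
    have r18 : s₁.reg 18 = slot G d v := by simp [hs₁, Store.reg_setReg]
    have r17 : s₁.reg 17 = r := by simp [hs₁, Store.reg_setReg, h17']
    have r4 : s₁.reg 4 = v := by simp [hs₁, Store.reg_setReg, hv]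
    have r2 : s₁.reg 2 = 0 := by simp [hs₁, Store.reg_setReg, hE'.zero]
    have r3 : s₁.reg 3 = 1 := by simp [hs₁, Store.reg_setReg, hE'.one]
    have harr : s₁.arr = s'.arr := by rw [hs₁]; rfl
    have keep : g v = f v → ∀ s₂ : Store, s₂.arr 3 = s'.arr 3 →
        Holds 3 (fun u : Fin n => (if (u : ℕ) < v + 1 then g u else f u).toNat)
          (s₂.setReg 4 (v + 1)) := by
      intro hgv s₂ hs₂ u
      rw [Store.arr_setReg, hs₂, hI u]
      rcases lt_trichotomy (u : ℕ) v with h | h | h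
      · simp [h, Nat.lt_succ_of_lt h]
      · simp [Fin.ext h, hgv]
      · simp [h.le.not_gt, show ¬ (u : ℕ) < v + 1 by omega]
    have hgv : slot G d v ≠ r → g v = f v := fun h => by simp [hg, flipRound, h]
    refine Spec.ifLt (c := 14 * (L v).length + 22)
      (fun h => Spec.eval rfl (by simp [Prog.size]) (keep (hgv (by omega)) _ (by rw [← harr]; rfl)))
      (fun h => ?_) (by omega)
    refine Spec.ifLt (c := 14 * (L v).length + 21)
      (fun h => Spec.eval rfl (by simp [Prog.size]) (keep (hgv (by omega)) _ (by rw [← harr]; rfl)))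
      (fun h' => ?_) (by omega)
    have hslot : slot G d v = r := by omega
    refine Spec.seq (c₂ := 5) (Spec.scan hL (hE'.input.of_arr (by rw [harr]) (by rw [harr]))
      (hI.of_arr (by rw [harr])) r4 le_rfl) ?_ (by omega)
    rintro s₂ hf₂ ⟨e8, e10, e11⟩
    rw [sameCount_toNat] at e10
    rw [diffCount_toNat] at e11
    set w : Fin n → Bool := fun u => if (u : ℕ) < v then g u else f u with hw
    have hwv : w v = f v := by simp [hw]
    have hU : Unhappy G e w v ↔ Unhappy G e f v := by
      refine unhappy_congr hwv fun u hu => ?_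
      simp only [hw]
      split_ifs
      · simp [hg, flipRound, slot_ne_of_adj hr hslot hu]
      · rfl
    have harr₂ : s₂.arr 3 = s'.arr 3 := by rw [hf₂.arr 3 rfl, harr]
    have q4 : s₂.reg 4 = v := (hf₂.reg 4 rfl).trans r4
    have q2 : s₂.reg 2 = 0 := (hf₂.reg 2 rfl).trans r2
    have q3 : s₂.reg 3 = 1 := (hf₂.reg 3 rfl).trans r3
    refine Spec.ifLt (c := 3) (fun hlt => ?_) (fun hlt => ?_) (by omega)
    · have hun := hU.1 ((unhappy_iff_reg e10 e11).1 hlt)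
      have hgv' : g v = !f v := by simp [hg, flipRound, hslot, hun]
      refine Spec.eval rfl (by simp [Prog.size]) ?_
      intro u
      have : ((Prog.ifLt 2 8 (.store 3 4 2) (.store 3 4 3)).eval s₂).arr 3 u =
          if (u : ℕ) = v then (!f v).toNat else s₂.arr 3 u := by
        simp only [Prog.eval, q2, e8]
        cases f v <;> simp [Store.arr_setArr, q4, q3]
      rw [Store.arr_setReg, this, harr₂, hI u]
      rcases lt_trichotomy (u : ℕ) v with h | h | h
      · simp [h, Nat.lt_succ_of_lt h, h.ne]
      · simp [Fin.ext h, hgv']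
      · simp [h.le.not_gt, show ¬ (u : ℕ) < v + 1 by omega, h.ne']
    · have hun : ¬ Unhappy G e f v := fun h => hlt ((unhappy_iff_reg e10 e11).2 (hU.2 h))
      refine Spec.eval rfl (by simp [Prog.size]) (keep (by simp [hg, flipRound, hun]) _ ?_)
      rw [← harr₂]; rfl
  · intro s' _ h u
    rw [h u]; simp

/-- One cycle of rounds. -/
def Prog.cycle (e : Bool) : Prog := .forUp 17 14 (.round e)

theorem Spec.cycle (hL : IsAdjacencyLists G L) (hE : Env L k d T s) (h4 : Holds 4 (slot G d) s)
    {f : Fin n → Bool} (h3 : Holds 3 (fun v => (f v).toNat) s)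
    (hc : (45 * d + 3) * (n + totalLength L + 1) ≤ c) :
    Spec (.cycle e) s c fun s' => Holds 3 (fun v => (flipRounds G e d f d v).toNat) s' := by
  refine Spec.forUp (len := d) (fun r s' => Holds 3 (fun v => (flipRounds G e d f r v).toNat) s')
    (42 * (n + totalLength L + 1)) (by cases e <;> rfl) (by cases e <;> rfl) (by decide) hE.d h3 ?_
    (fun _ _ h => h) ?_
  · intro r hr s' hf h17 _ hI
    exact Spec.round hL (hE.frame hf (by cases e <;> rfl)) (h4.frame hf (by cases e <;> rfl)) hI h17
      hr le_rfl
  · refine le_trans ?_ hc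
    nlinarith [Nat.zero_le (d * (n + totalLength L)), Nat.zero_le (totalLength L)]

end Flip

/-! ### Rebalancing and testing a colouring -/

section Test

variable {n : ℕ} {G : SimpleGraph (Fin n)} {L : Fin n → List (Fin n)} {k d T : ℕ} {s : Store}
  {c : ℕ} {e : Bool}

/-- The number of red vertices minus the number of blue ones. -/
def imbalance (f : Fin n → Bool) : ℤ := ∑ v, if f v then 1 else -1

theorem isBisection_of_imbalance {f : Fin n → Bool} (h : |imbalance f| ≤ 1) : IsBisection f := by
  classical
  have : imbalance f = ((Finset.univ.filter fun v => f v = true).card : ℤ) -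
      (Finset.univ.filter fun v => f v = false).card := by
    rw [imbalance, Finset.sum_ite]
    simp [sub_eq_add_neg]
  rw [this, abs_le] at h
  unfold IsBisection
  constructor
  · convert (by omega : (Finset.univ.filter fun v => f v = true).card ≤
      (Finset.univ.filter fun v => f v = false).card + 1)
  · convert (by omega : (Finset.univ.filter fun v => f v = false).card ≤
      (Finset.univ.filter fun v => f v = true).card + 1)

theorem imbalance_update_not (f : Fin n → Bool) (v : Fin n) :
    imbalance (Function.update f v (!f v)) = imbalance f - if f v then 2 else -2 := by
  have h : ∀ g : Fin n → Bool, imbalance g = (if g v then 1 else -1) +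
      ∑ u ∈ Finset.univ.erase v, if g u then 1 else -1 := fun g => by
    exact (Finset.add_sum_erase _ (fun u => if g u then (1 : ℤ) else -1) (Finset.mem_univ v)).symm
  rw [h, h f]
  have : ∀ u ∈ Finset.univ.erase v, (if Function.update f v (!f v) u then (1 : ℤ) else -1) =
      if f u then 1 else -1 := fun u hu => by
    rw [Function.update_of_ne (Finset.ne_of_mem_erase hu)]
  rw [Finset.sum_congr rfl this]
  cases hv : f v <;> simp [hv] <;> ring

/-- The colouring `g` arises from `f` by treating the vertices below `i` as follows: those with a
slot change their colour if it is the colour of a majority that is too large. -/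
structure Rebalanced (G : SimpleGraph (Fin n)) (d : ℕ) (f g : Fin n → Bool) (i : ℕ) : Prop where
  movable : ∀ u, g u ≠ f u → slot G d u < d
  card : 2 * ((Finset.univ.filter fun u => g u ≠ f u).card : ℤ) + |imbalance g| ≤ |imbalance f|
  red : 2 ≤ imbalance g → ∀ u : Fin n, (u : ℕ) < i → slot G d u < d → g u = false
  blue : imbalance g ≤ -2 → ∀ u : Fin n, (u : ℕ) < i → slot G d u < d → g u = true

theorem Rebalanced.refl (f : Fin n → Bool) : Rebalanced G d f f 0 :=
  ⟨by simp, by simp, by simp, by simp⟩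

theorem Rebalanced.keep {f g : Fin n → Bool} {v : Fin n} (h : Rebalanced G d f g v)
    (hr : 2 ≤ imbalance g → slot G d v < d → g v = false)
    (hb : imbalance g ≤ -2 → slot G d v < d → g v = true) : Rebalanced G d f g (v + 1) := by
  refine ⟨h.movable, h.card, fun hi u hu hs => ?_, fun hi u hu hs => ?_⟩
  · rcases (Nat.lt_succ_iff_lt_or_eq.1 hu) with hu | hu
    · exact h.red hi u hu hs
    · obtain rfl := Fin.ext hu; exact hr hi hs
  · rcases (Nat.lt_succ_iff_lt_or_eq.1 hu) with hu | hu
    · exact h.blue hi u hu hs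
    · obtain rfl := Fin.ext hu; exact hb hi hs

/-- A vertex of the larger class moves only while the imbalance is at least 2 in absolute value, so
the move lowers this value by exactly 2 without overshooting. This pays for the changed vertex in
`card`. If the new imbalance still has absolute value at least 2, the old one had the same sign, and
the earlier vertices inherit their colours from the old invariant. -/
theorem Rebalanced.flip {f g : Fin n → Bool} {v : Fin n} (h : Rebalanced G d f g v)
    (hs : slot G d v < d)
    (hv : if g v then 2 ≤ imbalance g else imbalance g ≤ -2) :
    Rebalanced G d f (Function.update g v (!g v)) (v + 1) := by
  have himb := imbalance_update_not g v
  set g' := Function.update g v (!g v) with hg'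
  have hne : ∀ u, u ≠ v → g' u = g u := fun u hu => Function.update_of_ne hu _ _
  have hgv : g' v = !g v := Function.update_self _ _ _
  have hcard : (Finset.univ.filter fun u => g' u ≠ f u).card ≤
      (Finset.univ.filter fun u => g u ≠ f u).card + 1 := by
    refine (Finset.card_le_card (t := insert v (Finset.univ.filter fun u => g u ≠ f u)) ?_).trans
      (Finset.card_insert_le _ _)
    intro u hu
    simp only [Finset.mem_filter, Finset.mem_univ, true_and, Finset.mem_insert] at hu ⊢
    by_cases huv : u = v
    · exact Or.inl huv
    · rw [hne u huv] at hu; exact Or.inr hu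
  have hc := h.card
  refine ⟨fun u hu => ?_, ?_, fun hi u hu hsu => ?_, fun hi u hu hsu => ?_⟩
  · by_cases huv : u = v
    · rw [huv]; exact hs
    · rw [hne u huv] at hu; exact h.movable u hu
  · have : |imbalance g'| + 2 ≤ |imbalance g| := by
      cases hb : g v
      · simp only [hb] at hv himb
        simp at hv himb
        rw [himb, abs_of_nonpos (by omega), abs_of_nonpos (by omega : imbalance g ≤ 0)]; omega
      · simp only [hb] at hv himb
        simp at hv himb
        rw [himb, abs_of_nonneg (by omega), abs_of_nonneg (by omega : 0 ≤ imbalance g)]; omega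
    have hcard' : ((Finset.univ.filter fun u => g' u ≠ f u).card : ℤ) ≤
      (Finset.univ.filter fun u => g u ≠ f u).card + 1 := by exact_mod_cast hcard
    linarith
  · cases hb : g v
    · simp only [hb] at hv himb
      simp at hv himb
      omega
    · simp only [hb] at hv himb
      simp at hv himb
      by_cases huv : u = v
      · rw [huv, hgv, hb]; rfl
      · rw [hne u huv]
        have : (u : ℕ) ≠ v := fun h => huv (Fin.ext h)
        exact h.red (by omega) u (by omega) hsu
  · cases hb : g v
    · simp only [hb] at hv himb
      simp at hv himb
      by_cases huv : u = v
      · rw [huv, hgv, hb]; rfl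
      · rw [hne u huv]
        have : (u : ℕ) ≠ v := fun h => huv (Fin.ext h)
        exact h.blue (by omega) u (by omega) hsu
    · simp only [hb] at hv himb
      simp at hv himb
      omega

open Classical in
/-- The number of unhappy vertices. -/
noncomputable def unhappyCount (G : SimpleGraph (Fin n)) (e : Bool) (f : Fin n → Bool) : ℕ :=
  ∑ v, if Unhappy G e f v then 1 else 0

/-- The colouring is a bisection with at most `n / k` unhappy vertices. -/
def Passes (G : SimpleGraph (Fin n)) (e : Bool) (k : ℕ) (f : Fin n → Bool) : Prop :=
  |imbalance f| ≤ 1 ∧ k * unhappyCount G e f ≤ n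

theorem sum_lt_succ {M : Type*} [AddCommMonoid M] (F : Fin n → M) (v : Fin n) :
    (∑ u : Fin n, if (u : ℕ) < v + 1 then F u else 0) =
      (∑ u : Fin n, if (u : ℕ) < v then F u else 0) + F v := by
  have : ∀ u : Fin n, (if (u : ℕ) < v + 1 then F u else 0) =
      (if (u : ℕ) < v then F u else 0) + if u = v then F u else 0 := by
    intro u
    rcases lt_trichotomy (u : ℕ) v with h | h | h
    · simp [h, Nat.lt_succ_of_lt h, (Fin.ne_of_lt h)]
    · simp [Fin.ext h]
    · simp [h.le.not_gt, show ¬ (u : ℕ) < v + 1 by omega, (Fin.ne_of_gt h)]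
  rw [Finset.sum_congr rfl fun u _ => this u, Finset.sum_add_distrib]
  simp

/-- Copies the colouring to the output and counts the colours. -/
def Prog.copyOut : Prog :=
  (.const 19 0 ;; .const 20 0) ;;
    .forUp 4 0 (.load 9 3 4 ;; .store 2 4 9 ;; .ifLt 2 9 (.succ 19) (.succ 20))

theorem Spec.copyOut (hE : Env L k d T s) {f : Fin n → Bool}
    (h3 : Holds 3 (fun v => (f v).toNat) s) (hc : 14 * (n + totalLength L + 1) ≤ c) :
    Spec .copyOut s c fun s' => Holds 2 (fun v => (f v).toNat) s' ∧
      (s'.reg 19 : ℤ) - s'.reg 20 = imbalance f := by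
  refine Spec.seq (c₁ := 3) (c₂ := 10 * (n + totalLength L + 1))
    (Q₁ := fun s₁ => s₁.reg 19 = 0 ∧ s₁.reg 20 = 0)
    (Spec.eval rfl le_rfl ?_) ?_ (by lia)
  · simp [Prog.eval, Store.reg_setReg]
  rintro s₁ hf₁ ⟨a, b⟩
  have hE₁ := hE.frame hf₁ rfl
  have h3₁ := h3.frame hf₁ rfl
  refine Spec.vertices L (fun v s' => (∀ u : Fin n, (u : ℕ) < v → s'.arr 2 u = (f u).toNat) ∧
    (s'.reg 19 : ℤ) - s'.reg 20 =
      ∑ u : Fin n, if (u : ℕ) < v then (if f u then 1 else -1) else 0) 0 7 rfl rfl hE₁.n ?_ ?_ ?_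
      (by lia)
  · simp [Store.reg_setReg, a, b]
  · rintro v s' hf h4 _ ⟨hI, hI'⟩
    have z := (hf.reg 2 rfl).trans hE₁.zero
    have e := (h3₁.frame hf rfl) v
    refine Spec.eval rfl (by simp [Prog.size]) ⟨?_, ?_⟩
    · refine holds_of_partial (arr := s'.arr) hI rfl fun j => ?_
      cases hv : f v <;>
        simp [Prog.eval, Store.reg_setReg, Store.arr_setReg, Store.arr_setArr, Store.reg_setArr, h4,
          z, e, hv]
    · rw [sum_lt_succ, ← hI']
      cases hv : f v <;>
        simp [Prog.eval, Store.reg_setReg, Store.reg_setArr, h4, z, e, hv] <;>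
        ring
  · rintro s' _ ⟨h, h'⟩
    refine ⟨fun u => h u u.2, h'.trans ?_⟩
    simp [imbalance]

/-- Rebalances the output. -/
def Prog.balance : Prog :=
  .forUp 4 0 (.load 18 4 4 ;; .ifLt 18 14 (.load 9 2 4 ;; .ifLt 2 9
    (.copy 23 20 ;; .succ 23 ;; .ifLt 23 19 (.store 2 4 2 ;; .pred 19 ;; .succ 20) .skip)
    (.copy 23 19 ;; .succ 23 ;; .ifLt 23 20 (.store 2 4 3 ;; .pred 20 ;; .succ 19) .skip)) .skip)

theorem Spec.balance (hE : Env L k d T s) (h4 : Holds 4 (slot G d) s) {f : Fin n → Bool}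
    (h2 : Holds 2 (fun v => (f v).toNat) s) (hi : (s.reg 19 : ℤ) - s.reg 20 = imbalance f)
    (hc : 40 * (n + totalLength L + 1) ≤ c) :
    Spec .balance s c fun s' => ∃ g, Holds 2 (fun v => (g v).toNat) s' ∧
      (s'.reg 19 : ℤ) - s'.reg 20 = imbalance g ∧ Rebalanced G d f g n := by
  refine Spec.vertices L (fun v s' => ∃ g, Holds 2 (fun v => (g v).toNat) s' ∧
      (s'.reg 19 : ℤ) - s'.reg 20 = imbalance g ∧ Rebalanced G d f g v) 0 37 rfl rfl hE.n
      ⟨f, ?_, ?_, .refl f⟩ ?_ (fun s' _ h => h) (by lia)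
  · intro u; simpa [Store.arr_setReg] using h2 u
  · simpa [Store.reg_setReg] using hi
  · rintro v s' hf hv _ ⟨g, hg, hgi, hR⟩
    have hE' := hE.frame hf rfl
    have hz := hE'.zero
    have ho := hE'.one
    have hd := hE'.d
    have hs := (h4.frame hf rfl) v
    have hgv : s'.arr 2 v = (g v).toNat := hg v
    refine Spec.eval rfl (by simp [Prog.size]) ?_
    have keep : (2 ≤ imbalance g → slot G d v < d → g v = false) →
        (imbalance g ≤ -2 → slot G d v < d → g v = true) → ∀ s₂ : Store, s₂.arr 2 = s'.arr 2 →
        s₂.reg 19 = s'.reg 19 → s₂.reg 20 = s'.reg 20 →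
        ∃ g, Holds 2 (fun v => (g v).toNat) (s₂.setReg 4 (v + 1)) ∧
          ((s₂.setReg 4 (v + 1)).reg 19 : ℤ) - (s₂.setReg 4 (v + 1)).reg 20 = imbalance g ∧
          Rebalanced G d f g (v + 1) := by
      intro a b s₂ c1 c2 c3
      refine ⟨g, fun u => ?_, ?_, hR.keep a b⟩
      · rw [Store.arr_setReg, c1]; exact hg u
      · simp [Store.reg_setReg, c2, c3, hgi]
    by_cases hslot : slot G d v < d
    · cases hb : g v
      · rw [hb] at hgv
        -- This is the condition that the imbalance is at most -2; the red case below is symmetric.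
        by_cases hlt : s'.reg 19 + 1 < s'.reg 20
        · refine ⟨Function.update g v (!g v), fun u => ?_, ?_, hR.flip hslot ?_⟩
          · by_cases huv : u = v
            · subst huv
              simp [Prog.eval, Store.reg_setReg, Store.arr_setReg, Store.arr_setArr,
                Store.reg_setArr, hv, hz, hs, hd, hslot, hgv, hlt, hb, ho]
            · have huv' : (u : ℕ) ≠ v := fun h => huv (Fin.ext h)
              have hgu : s'.arr 2 u = (g u).toNat := hg u
              beta_reduce
              rw [Function.update_of_ne huv, ← hgu]
              simp [Prog.eval, Store.reg_setReg, Store.arr_setReg, Store.arr_setArr,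
                Store.reg_setArr, hv, hz, hs, hd, hslot, hgv, hlt, huv']
          · rw [imbalance_update_not, ← hgi, hb]
            simp [Prog.eval, Store.reg_setReg, Store.arr_setReg, 
                Store.reg_setArr, hv, hz, hs, hd, hslot, hgv, hlt]
            omega
          · rw [hb]; simp; omega
        · refine keep (fun _ _ => hb) (fun _ _ => by omega) _ ?_ ?_ ?_ <;>
          simp [Prog.eval, Store.reg_setReg, Store.arr_setReg,
                hv, hz, hs, hd, hslot, hgv, hlt]
      · rw [hb] at hgv
        by_cases hlt : s'.reg 20 + 1 < s'.reg 19
        · refine ⟨Function.update g v (!g v), fun u => ?_, ?_, hR.flip hslot ?_⟩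
          · by_cases huv : u = v
            · subst huv
              simp [Prog.eval, Store.reg_setReg, Store.arr_setReg, Store.arr_setArr,
                Store.reg_setArr, hv, hz, hs, hd, hslot, hgv, hlt, hb]
            · have huv' : (u : ℕ) ≠ v := fun h => huv (Fin.ext h)
              have hgu : s'.arr 2 u = (g u).toNat := hg u
              beta_reduce
              rw [Function.update_of_ne huv, ← hgu]
              simp [Prog.eval, Store.reg_setReg, Store.arr_setReg, Store.arr_setArr,
                Store.reg_setArr, hv, hz, hs, hd, hslot, hgv, hlt, huv']
          · rw [imbalance_update_not, ← hgi, hb]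
            simp [Prog.eval, Store.reg_setReg, Store.arr_setReg,
                Store.reg_setArr, hv, hz, hs, hd, hslot, hgv, hlt]
            omega
          · rw [hb]; simp; omega
        · refine keep (fun _ _ => by omega) (fun _ _ => hb) _ ?_ ?_ ?_ <;>
          simp [Prog.eval, Store.reg_setReg, Store.arr_setReg,
                hv, hz, hs, hd, hslot, hgv, hlt]
    · refine keep (fun _ h => absurd h hslot) (fun _ h => absurd h hslot) _ ?_ ?_ ?_ <;>
      simp [Prog.eval, Store.reg_setReg, Store.arr_setReg, hv, hs, hd, hslot]

/-- Counts the unhappy vertices of the output. -/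
def Prog.countUnhappy (e : Bool) : Prog :=
  .const 21 0 ;; .forUp 4 0 (.scan 2 ;; .ifUnhappy e (.succ 21))

theorem Spec.countUnhappy (hL : IsAdjacencyLists G L) (hE : Env L k d T s) {g : Fin n → Bool}
    (h2 : Holds 2 (fun v => (g v).toNat) s) (hc : 40 * (n + totalLength L + 1) ≤ c) :
    Spec (.countUnhappy e) s c fun s' => s'.reg 21 = unhappyCount G e g := by
  classical
  refine Spec.seq (c₁ := 1) (c₂ := 38 * (n + totalLength L + 1))
    (Q₁ := fun s₁ => s₁.reg 21 = 0) (Spec.eval rfl le_rfl ?_) ?_ (by lia)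
  · simp [Prog.eval, Store.reg_setReg]
  intro s₁ hf₁ h0
  have hE₁ := hE.frame hf₁ rfl
  have h2₁ := h2.frame hf₁ rfl
  refine Spec.vertices L (fun v s' => s'.reg 21 =
    ∑ u : Fin n, if (u : ℕ) < v then (if Unhappy G e g u then 1 else 0) else 0) 14 19
    (by cases e <;> rfl) (by cases e <;> rfl) hE₁.n ?_ ?_ ?_ (by lia)
  · simp [Store.reg_setReg, h0]
  · intro v s' hf hv _ hI
    refine Spec.seq (c₂ := 3) (Spec.scan hL (hE₁.frame hf (by cases e <;> rfl)).input
      (h2₁.frame hf (by cases e <;> rfl)) hv le_rfl) ?_ (by omega)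
    rintro s₂ hf₂ ⟨-, e10, e11⟩
    rw [sameCount_toNat] at e10
    rw [diffCount_toNat] at e11
    have e21 := hf₂.reg 21 rfl
    rw [sum_lt_succ, ← hI]
    refine Spec.eval rfl (by simp [Prog.size, Prog.ifUnhappy]) ?_
    simp only [Prog.ifUnhappy, Prog.eval, unhappy_iff_reg (e := e) e10 e11]
    split_ifs <;> simp [Store.reg_setReg, e21]
  · intro s' _ h
    rw [h]
    simp only [Fin.is_lt, if_true, unhappyCount]

/-- Rebalances the current colouring, and sets `R 13` to zero if the result is good enough. -/
def Prog.test (e : Bool) : Prog :=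
  .copyOut ;; .balance ;; .countUnhappy e ;; .mul 24 1 21 ;;
    (.copy 23 20 ;; .succ 23 ;; .ifLt 23 19 .skip (.copy 23 19 ;; .succ 23 ;; .ifLt 23 20 .skip
      (.ifLt 0 24 .skip (.const 13 0))))

theorem unhappyCount_le (g : Fin n → Bool) : unhappyCount G e g ≤ n := by
  classical
  unfold unhappyCount
  calc _ ≤ ∑ _v : Fin n, 1 := Finset.sum_le_sum fun v _ => by split_ifs <;> simp
    _ = n := by simp

/-- In the unsuccessful case the rebalancing that the program found is itself the witness which
`Fails` requires. No uniqueness of rebalancings is needed: when a trial does not fail, there is a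
time at which all of them pass. -/
theorem Spec.test (hL : IsAdjacencyLists G L) (hE : Env L k d T s) (h4 : Holds 4 (slot G d) s)
    {f : Fin n → Bool} (h3 : Holds 3 (fun v => (f v).toNat) s)
    (hc : (10 * k + 130) * (n + totalLength L + 1) ≤ c) :
    Spec (.test e) s c fun s' =>
      (s'.reg 13 = 0 ∧ ∃ g, Holds 2 (fun v => (g v).toNat) s' ∧ Passes G e k g) ∨
      (s'.reg 13 = s.reg 13 ∧ ∃ g, Rebalanced G d f g n ∧ ¬ Passes G e k g) := by
  set N := n + totalLength L + 1 with hN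
  have hkN : k * (4 * n + 6) ≤ 6 * (k * N) := by
    rw [hN]; nlinarith [Nat.zero_le (k * n), Nat.zero_le (k * totalLength L)]
  refine Spec.seq (c₂ := 6 * (k * N) + 107 * N) (Spec.copyOut hE h3 le_rfl) ?_ (by lia)
  rintro s₁ hf₁ ⟨a2, ai⟩
  have hE₁ := hE.frame hf₁ rfl
  refine Spec.seq (c₂ := 6 * (k * N) + 66 * N) (Spec.balance hE₁ (h4.frame hf₁ rfl) a2 ai le_rfl)
    ?_ (by lia)
  rintro s₂ hf₂ ⟨g, b2, bi, hR⟩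
  have hE₂ := hE₁.frame hf₂ rfl
  refine Spec.seq (c₂ := 6 * (k * N) + 25 * N) (Spec.countUnhappy hL hE₂ b2 le_rfl) ?_ (by lia)
  intro s₃ hf₃ h21
  have hE₃ := hE₂.frame hf₃ (by cases e <;> rfl)
  have hU : unhappyCount G e g ≤ n := unhappyCount_le g
  refine Spec.seq (c₂ := 15) (Spec.mul hE₃.k h21 (by decide) (by decide) (by decide) (by decide)
    (by decide) le_rfl) ?_ ?_
  swap
  · have : k * (4 * unhappyCount G e g + 6) ≤ k * (4 * n + 6) := by gcongr
    lia
  intro s₄ hf₄ h24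
  have hE₄ := hE₃.frame hf₄ rfl
  have hn := hE₄.n
  have h19 : s₄.reg 19 = s₂.reg 19 := by
    rw [hf₄.reg 19 rfl, hf₃.reg 19 (by cases e <;> rfl)]
  have h20 : s₄.reg 20 = s₂.reg 20 := by
    rw [hf₄.reg 20 rfl, hf₃.reg 20 (by cases e <;> rfl)]
  have h2 : Holds 2 (fun v => (g v).toNat) s₄ :=
    (b2.frame hf₃ (by cases e <;> rfl)).frame hf₄ rfl
  have h13 : s₄.reg 13 = s.reg 13 := by
    rw [hf₄.reg 13 rfl, hf₃.reg 13 (by cases e <;> rfl), hf₂.reg 13 rfl, hf₁.reg 13 rfl]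
  refine Spec.eval rfl (by simp [Prog.size]) ?_
  simp only [Prog.eval, Store.reg_setReg]
  by_cases c1 : s₄.reg 20 + 1 < s₄.reg 19
  · right
    refine ⟨by simp [c1, h13, Store.reg_setReg], g, hR, fun hp => ?_⟩
    have := abs_le.1 hp.1
    omega
  by_cases c2 : s₄.reg 19 + 1 < s₄.reg 20
  · right
    refine ⟨by simp [c1, c2, h13, Store.reg_setReg], g, hR, fun hp => ?_⟩
    have := abs_le.1 hp.1
    omega
  by_cases c3 : n < k * unhappyCount G e g
  · right
    refine ⟨by simp [c1, c2, c3, h13, h24, hn, Store.reg_setReg], g, hR, fun hp => ?_⟩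
    exact absurd hp.2 (by omega)
  · left
    refine ⟨by simp [c1, c2, c3, h24, hn, Store.reg_setReg], g, fun u => ?_, ?_, by omega⟩
    · rw [← h2 u]
      simp [c1, c2, c3, h24, hn, Store.arr_setReg]
    · rw [abs_le]; omega

end Test

/-! ### Trials, the search and its running time -/

section Main

variable {n : ℕ} {G : SimpleGraph (Fin n)} {L : Fin n → List (Fin n)} {k d T : ℕ} {s : Store}
  {c : ℕ} {e : Bool}

/-- The trial `q` may fail: each of its `T` colourings has a bad rebalancing. -/
def Fails (G : SimpleGraph (Fin n)) (e : Bool) (k d T q : ℕ) : Prop :=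
  ∀ t < T, ∃ g, Rebalanced G d (flipCycles G e d (digitColouring n q) t) g n ∧ ¬ Passes G e k g

/-- The search is over, and the output is good. -/
def Found (G : SimpleGraph (Fin n)) (e : Bool) (k : ℕ) (s : Store) : Prop :=
  s.reg 13 = 0 ∧ ∃ g : Fin n → Bool, Holds 2 (fun v => (g v).toNat) s ∧ Passes G e k g

/-- The trial `R 12`. -/
def Prog.trial (e : Bool) : Prog :=
  .initial ;; .forUp 16 15 (.ifLt 12 13 (.test e ;; .cycle e) .skip)

/-- Register 13 serves both as the bound for `q` and as the flag of success: once it is zero, the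
test `R 12 < R 13` fails, which skips the remaining cycles and later ends the search. -/
theorem Spec.trial (hL : IsAdjacencyLists G L) (hE : Env L k d T s) (h4 : Holds 4 (slot G d) s)
    {q : ℕ} (h12 : s.reg 12 = q) (h13 : s.reg 13 = n) (h2q : 2 ≤ q) (hqn : q < n)
    (hc : (T * (10 * k + 45 * d + 140) + 50) * (n + totalLength L + 1) ≤ c) :
    Spec (.trial e) s c fun s' => Found G e k s' ∨ s'.reg 13 = n ∧ Fails G e k d T q := by
  set N := n + totalLength L + 1 with hN
  have hN1 : 1 ≤ N := by omega
  have hTN : T ≤ T * N := Nat.le_mul_of_pos_right _ hN1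
  refine Spec.seq (c₁ := 40 * N) (c₂ := T * ((10 * k + 45 * d + 135) * N + 3) + 3)
    (Spec.initial hE h12 h2q hqn.le le_rfl) ?_ (by lia)
  intro s₁ hf₁ h3
  have hE₁ := hE.frame hf₁ rfl
  have h4₁ := h4.frame hf₁ rfl
  have h13₁ := (hf₁.reg 13 rfl).trans h13
  have h12₁ := (hf₁.reg 12 rfl).trans h12
  refine Spec.forUp (len := T) (fun t s' => Found G e k s' ∨ s'.reg 13 = n ∧
    Holds 3 (fun v => (flipCycles G e d (digitColouring n q) t v).toNat) s' ∧
    Fails G e k d t q) ((10 * k + 45 * d + 135) * N) (by cases e <;> rfl) (by cases e <;> rfl)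
    (by decide) hE₁.T ?_ ?_ ?_ le_rfl
  · exact Or.inr ⟨by simpa [Store.reg_setReg] using h13₁, fun u => h3 u, fun t ht => by omega⟩
  · intro t ht s' hf h16 _ hI
    have hE' := hE₁.frame hf (by cases e <;> rfl)
    have h4' := h4₁.frame hf (by cases e <;> rfl)
    have h12' := (hf.reg 12 (by cases e <;> rfl)).trans h12₁
    rcases hI with hI | ⟨h13', h3', hfail⟩
    · refine Spec.ifLt (c := 1) (fun h => absurd h (by rw [hI.1]; omega)) (fun _ => ?_) (by lia)
      refine Spec.eval rfl le_rfl (Or.inl ⟨?_, ?_⟩)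
      · simpa [Prog.eval, Store.reg_setReg] using hI.1
      · obtain ⟨g, hg, hp⟩ := hI.2
        exact ⟨g, fun u => hg u, hp⟩
    · refine Spec.ifLt (c := (10 * k + 45 * d + 134) * N) (fun _ => ?_)
        (fun h => absurd h (by omega))
        (by lia)
      refine Spec.seq (Spec.test hL hE' h4' h3' le_rfl)
        (c₂ := (45 * d + 3) * N) (fun s₂ hf₂ h₂ => ?_) (by lia)
      refine (Spec.cycle (e := e) hL (hE'.frame hf₂ (by cases e <;> rfl))
        (h4'.frame hf₂ (by cases e <;> rfl)) (h3'.frame hf₂ (by cases e <;> rfl))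
        le_rfl).mono le_rfl ?_
      intro s₃ hf₃ h₃
      have e13 := hf₃.reg 13 (by cases e <;> rfl)
      rcases h₂ with ⟨a, g, hg, hp⟩ | ⟨a, g, hg, hp⟩
      · refine Or.inl ⟨?_, g, fun u => ?_, hp⟩
        · simp [Store.reg_setReg, e13, a]
        · rw [Store.arr_setReg]; exact hg.frame hf₃ (by cases e <;> rfl) u
      · refine Or.inr ⟨?_, fun u => h₃ u, fun t' ht' => ?_⟩
        · simp [Store.reg_setReg, e13, a, h13']
        · rcases Nat.lt_succ_iff_lt_or_eq.1 ht' with h | rfl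
          · exact hfail t' h
          · exact ⟨g, hg, hp⟩
  · rintro s' _ (h | ⟨h, -, h'⟩)
    · exact Or.inl h
    · exact Or.inr ⟨h, h'⟩

/-- Trials, until one is successful or the number of the trial reaches `n`. -/
def Prog.search (e : Bool) : Prog := .whileLt 12 13 (.trial e ;; .succ 12)

/-- `B` is a number at which the search has certainly stopped: either the trial `B - 1` cannot fail,
or `B = n` is the bound set in the program. The first alternative gives linear time on regular
graphs, the second a quadratic bound on all graphs. -/
theorem Spec.search (hL : IsAdjacencyLists G L) {κ : ℕ}
    (hκ : κ = (T * (10 * k + 45 * d + 140) + 50) * (n + totalLength L + 1)) {B : ℕ} (hB : B ≤ n)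
    (hF : B < n → ¬ Fails G e k d T (B - 1)) (r : ℕ) :
    ∀ {q : ℕ} {s : Store}, Env L k d T s → Holds 4 (slot G d) s → s.reg 12 = q → 2 ≤ q →
      q + r = B → (Found G e k s ∨ s.reg 13 = n ∧ (q = B → B = n)) →
      Spec (.search e) s (r * (κ + 3) + 1) fun s' => B < n → Found G e k s' := by
  induction r with
  | zero =>
    intro q s hE h4 h12 h2q hq hs
    rcases hs with hs | ⟨h13, hs⟩
    · exact Spec.whileDone (by rw [hs.1]; omega) (fun _ => hs) (by omega)
    · have := hs (by omega)
      exact Spec.whileDone (by omega) (fun h => by omega) (by omega)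
  | succ r ih =>
    intro q s hE h4 h12 h2q hq hs
    rcases hs with hs | ⟨h13, hs⟩
    · exact Spec.whileDone (by rw [hs.1]; omega) (fun _ => hs) (by omega)
    · refine Spec.whileStep (c₁ := κ + 2) (c₂ := r * (κ + 3) + 1)
        (Q₁ := fun s₁ => s₁.reg 12 = q + 1 ∧ (Found G e k s₁ ∨ s₁.reg 13 = n ∧ Fails G e k d T q))
        (by omega) ?_ ?_ (by lia)
      · refine Spec.seq (c₂ := 1) (Spec.trial hL hE h4 h12 h13 h2q (by omega) hκ.ge) ?_ (by omega)
        intro s₁ hf₁ h₁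
        have e12 := (hf₁.reg 12 (by cases e <;> rfl)).trans h12
        refine Spec.eval rfl le_rfl ⟨by simp [Prog.eval, Store.reg_setReg, e12], ?_⟩
        rcases h₁ with ⟨a, g, hg, hp⟩ | ⟨a, b⟩
        · exact Or.inl ⟨by simp [Prog.eval, Store.reg_setReg, a], g, fun u => hg u, hp⟩
        · exact Or.inr ⟨by simp [Prog.eval, Store.reg_setReg, a], b⟩
      · rintro s₁ hf₁ ⟨a, b⟩
        refine ih (hE.frame hf₁ (by cases e <;> rfl)) (h4.frame hf₁ (by cases e <;> rfl)) a
          (by omega) (by omega) ?_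
        rcases b with b | ⟨b, b'⟩
        · exact Or.inl b
        · refine Or.inr ⟨b, fun hqB => ?_⟩
          by_contra hne
          refine hF (by omega) ?_
          rwa [← hqB, Nat.add_sub_cancel]

/-- Computes `C n`, the number of entries of the lists, `d = A k` and `T = d ^ 2`. -/
def Prog.setup (A C : ℕ) : Prog :=
  (.const 3 1 ;; .const 25 C ;; .const 23 A ;; .load 29 0 0) ;; .mul 26 25 0 ;; .mul 14 23 1 ;;
    .mul 15 14 14

theorem Spec.setup {A C : ℕ} (hd : d = A * k)
    (hc : C * (4 * n + 6) + A * (4 * k + 6) + d * (4 * d + 6) + 25 ≤ c) :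
    Spec (.setup A C) (inputStore L k) c fun s' => Env L k d (d * d) s' ∧
      s'.reg 26 = C * n ∧ s'.reg 29 = totalLength L := by
  have hin : HoldsInput L (inputStore L k) := holdsInput_inputStore k
  -- `load 29 0 0` reads the cell `A 0 [n]`, since register 0 holds `n`; this is the end of the last
  -- list.
  have h0 : (inputStore L k).arr 0 n = totalLength L := by
    rw [hin.offset n le_rfl, offset_last]
  refine Spec.seq (c₁ := 7) (c₂ := C * (4 * n + 6) + A * (4 * k + 6) + d * (4 * d + 6) + 17)
    (Q₁ := fun s₁ => s₁.arr = (inputStore L k).arr ∧ s₁.reg 0 = n ∧ s₁.reg 1 = k ∧ s₁.reg 2 = 0 ∧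
      s₁.reg 3 = 1 ∧ s₁.reg 25 = C ∧ s₁.reg 23 = A ∧ s₁.reg 29 = totalLength L)
    (Spec.eval rfl (by simp [Prog.size]) ?_) ?_ (by omega)
  · have e0 : (inputStore L k).reg 0 = n := rfl
    have e1 : (inputStore L k).reg 1 = k := rfl
    have e2 : (inputStore L k).reg 2 = 0 := rfl
    simp [Prog.eval, Store.reg_setReg, Store.arr_setReg, e0, e1, e2, h0]
  rintro s₁ - ⟨ha, a0, a1, a2, a3, a25, a23, a29⟩
  refine Spec.seq (c₂ := A * (4 * k + 6) + d * (4 * d + 6) + 11)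
    (Spec.mul a25 a0 (by decide) (by decide) (by decide) (by decide) (by decide) le_rfl) ?_
    (by omega)
  intro s₂ hf₂ h26
  refine Spec.seq (c₂ := d * (4 * d + 6) + 5)
    (Spec.mul ((hf₂.reg 23 rfl).trans a23) ((hf₂.reg 1 rfl).trans a1) (by decide) (by decide)
      (by decide) (by decide) (by decide) le_rfl) ?_ (by omega)
  intro s₃ hf₃ h14
  refine (Spec.mul h14 h14 (by decide) (by decide) (by decide) (by decide) (by decide)
    (by rw [← hd])).mono le_rfl ?_
  intro s₄ hf₄ h15
  have hr : ∀ x, (Prog.mul 26 25 0).writesReg x = false → (Prog.mul 14 23 1).writesReg x = false →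
      (Prog.mul 15 14 14).writesReg x = false → s₄.reg x = s₁.reg x := fun x x1 x2 x3 => by
    rw [hf₄.reg x x3, hf₃.reg x x2, hf₂.reg x x1]
  have harr : s₄.arr = (inputStore L k).arr := by
    funext a
    rw [hf₄.arr a rfl, hf₃.arr a rfl, hf₂.arr a rfl, ha]
  refine ⟨⟨hin.of_arr (by rw [harr]) (by rw [harr]), ?_, ?_, ?_, ?_, ?_, ?_⟩, ?_, ?_⟩
  · rw [hr 0 rfl rfl rfl, a0]
  · rw [hr 1 rfl rfl rfl, a1]
  · rw [hr 2 rfl rfl rfl, a2]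
  · rw [hr 3 rfl rfl rfl, a3]
  · rw [hf₄.reg 14 rfl, h14, hd]
  · rw [h15, hd]
  · rw [hf₄.reg 26 rfl, hf₃.reg 26 rfl, h26]
  · rw [hr 29 rfl rfl rfl, a29]

/-- The algorithm. Graphs with more than `C n / 2` edges are rejected. -/
def Prog.algorithm (e : Bool) (A C : ℕ) : Prog :=
  .setup A C ;; .ifLt 26 29 .skip
    (.residues ;; .slots ;; (.const 12 2 ;; .copy 13 0) ;; .search e)

/-- A factor in the bound for the running time of the algorithm. -/
def timeFactor (A C k : ℕ) : ℕ :=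
  ((A * k) * (A * k) * (10 * k + 45 * (A * k) + 140) + 120) * (C + 1) + 6 * C + A * (4 * k + 6) +
    A * k * (4 * (A * k) + 6) + 30

/-- At most `B - 2` trials, each linear in `n + m + 1`, where `m ≤ C * n`. The letter `K` stands for
the part of the cost of a trial that depends on `d` and `k`. -/
theorem search_cost_le {K C m B : ℕ} (hm : m ≤ C * n) (hB : 3 ≤ B) (hBn : B ≤ n) :
    52 * (n + m + 1) + (B - 2) * ((K + 50) * (n + m + 1) + 3) + 20 ≤
      (K + 120) * (C + 1) * (B * n) := by
  obtain ⟨b, rfl⟩ : ∃ b, B = b + 2 := ⟨B - 2, by omega⟩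
  rw [Nat.add_sub_cancel]
  have hN : n + m + 1 ≤ (C + 1) * n + 1 := by rw [Nat.add_mul]; omega
  have hX : n ≤ (C + 1) * n := Nat.le_mul_of_pos_left _ (Nat.succ_pos C)
  have h1 : b * ((K + 50) * (n + m + 1) + 3) ≤ b * ((K + 50) * ((C + 1) * n + 1) + 3) := by gcongr
  have h9 : (K + 120) * (C + 1) * ((b + 2) * n) = K * (b * ((C + 1) * n)) +
    2 * (K * ((C + 1) * n)) + 120 * (b * ((C + 1) * n)) + 240 * ((C + 1) * n) := by ring
  rw [h9]
  generalize (C + 1) * n = X at *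
  have h8 : b * ((K + 50) * (X + 1) + 3) = K * (b * X) + 50 * (b * X) + K * b + 53 * b := by ring
  have h10 : K * b ≤ K * X := Nat.mul_le_mul_left _ (by omega)
  have h11 : b ≤ b * X := Nat.le_mul_of_pos_right _ (by omega)
  omega

theorem total_cost_le {K C S B : ℕ} (hB : 3 ≤ B) (hBn : B ≤ n) :
    C * (4 * n + 6) + S + 25 + (K + 120) * (C + 1) * (B * n) + 1 ≤
      ((K + 120) * (C + 1) + 6 * C + S + 30) * (B * n) := by
  have h1 : n ≤ B * n := Nat.le_mul_of_pos_left _ (by omega)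
  have h2 : C * (4 * n + 6) ≤ C * (6 * (B * n)) := Nat.mul_le_mul_left _ (by nlinarith)
  have h3 : S ≤ S * (B * n) := Nat.le_mul_of_pos_right _ (by omega)
  have h4 : ((K + 120) * (C + 1) + 6 * C + S + 30) * (B * n) = (K + 120) * (C + 1) * (B * n) +
    C * (6 * (B * n)) + S * (B * n) + 30 * (B * n) := by ring
  omega

theorem Spec.algorithm (hL : IsAdjacencyLists G L) {A C : ℕ} (hA : 1 ≤ A) (hk : 1 ≤ k) {B : ℕ}
    (h3B : 3 ≤ B) (hB : B ≤ n)
    (hF : B < n → ¬ Fails G e k (A * k) (A * k * (A * k)) (B - 1)) :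
    Spec (.algorithm e A C) (inputStore L k) (timeFactor A C k * (B * n)) fun s' =>
      totalLength L ≤ C * n → B < n →
        ∃ g : Fin n → Bool, Holds 2 (fun v => (g v).toNat) s' ∧ Passes G e k g := by
  obtain ⟨d, hd⟩ : ∃ d, d = A * k := ⟨_, rfl⟩
  have hd1 : 1 ≤ d := hd ▸ Nat.mul_pos hA hk
  rw [← hd] at hF
  have htot := total_cost_le (n := n) (K := d * d * (10 * k + 45 * d + 140)) (C := C)
    (S := A * (4 * k + 6) + d * (4 * d + 6)) h3B hB
  refine Spec.seq (c₁ := C * (4 * n + 6) + (A * (4 * k + 6) + d * (4 * d + 6)) + 25)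
    (c₂ := (d * d * (10 * k + 45 * d + 140) + 120) * (C + 1) * (B * n))
    (Spec.setup hd (by omega)) ?_ ?_
  swap
  · refine htot.trans (le_of_eq ?_)
    rw [timeFactor, ← hd]; ring
  clear htot
  rintro s₁ - ⟨hE, h26, h29⟩
  have hpos : 7 ≤ (d * d * (10 * k + 45 * d + 140) + 120) * (C + 1) * (B * n) := by
    have := search_cost_le (n := n) (K := d * d * (10 * k + 45 * d + 140)) (m := 0)
      (Nat.zero_le (C * n)) h3B hB
    omega
  refine Spec.ifLt (c := (d * d * (10 * k + 45 * d + 140) + 120) * (C + 1) * (B * n) - 1)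
    (fun h => ?_) (fun h => ?_) (by omega)
  -- A rejected graph violates the premise on `totalLength`, so nothing is promised about the
  -- output.
  · exact Spec.eval rfl (by simp only [Prog.size]; omega) fun h' => by omega
  have hm : totalLength L ≤ C * n := by omega
  have hcost := search_cost_le (K := d * d * (10 * k + 45 * d + 140)) hm h3B hB
  refine Spec.mono (c := 52 * (n + totalLength L + 1) +
    (B - 2) * ((d * d * (10 * k + 45 * d + 140) + 50) * (n + totalLength L + 1) + 3) + 19)
    (Q := fun s' => B < n → Found G e k s') ?_ (by omega) (fun s' _ h _ hBn => (h hBn).2)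
  clear hcost hpos
  refine Spec.seq (Spec.residues hE hd1 le_rfl) (c₂ := 40 * (n + totalLength L + 1) +
    (B - 2) * ((d * d * (10 * k + 45 * d + 140) + 50) * (n + totalLength L + 1) + 3) + 10)
    ?_ (by omega)
  intro s₂ hf₂ h5
  have hE₂ := hE.frame hf₂ rfl
  refine Spec.seq (Spec.slots hL hE₂ h5 le_rfl) (c₂ :=
    (B - 2) * ((d * d * (10 * k + 45 * d + 140) + 50) * (n + totalLength L + 1) + 3) + 8)
    ?_ (by omega)
  intro s₃ hf₃ h4
  have hE₃ := hE₂.frame hf₃ rfl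
  refine Spec.seq (c₁ := 3) (c₂ :=
    (B - 2) * ((d * d * (10 * k + 45 * d + 140) + 50) * (n + totalLength L + 1) + 3) + 1)
    (Q₁ := fun s₄ => s₄.reg 12 = 2 ∧ s₄.reg 13 = n) (Spec.eval rfl le_rfl ?_) ?_ (by omega)
  · simp [Prog.eval, Store.reg_setReg, hE₃.n]
  rintro s₄ hf₄ ⟨h12, h13⟩
  exact Spec.search (e := e) hL rfl hB hF (B - 2) (hE₃.frame hf₄ rfl) (h4.frame hf₄ rfl) h12
    le_rfl (by omega) (Or.inr ⟨h13, fun h => by omega⟩)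

end Main

/-! ### The score as a potential function -/

section Energy

variable {n : ℕ} {G : SimpleGraph (Fin n)} {d : ℕ} {e : Bool}

open Classical in
/-- The number of ordered pairs of adjacent vertices with the property `Q`. -/
noncomputable def arcCount (G : SimpleGraph (Fin n)) (Q : Fin n → Fin n → Prop) : ℕ :=
  ∑ u, ∑ v, if G.Adj u v ∧ Q u v then 1 else 0

open Classical in
/-- The number of neighbours. -/
noncomputable def nbrCount (G : SimpleGraph (Fin n)) (v : Fin n) : ℕ :=
  (Finset.univ.filter fun u => G.Adj v u).card

theorem sameCount_add_diffCount {α : Type*} (f : Fin n → α) (v : Fin n) :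
    sameCount G f v + diffCount G f v = nbrCount G v := by
  classical
  unfold sameCount diffCount nbrCount
  rw [← Finset.filter_filter, ← Finset.filter_filter]
  convert Finset.card_filter_add_card_filter_not (s := Finset.univ.filter fun u => G.Adj v u)
    (fun u => f u = f v)

theorem arcCount_row (P : Fin n → Prop) [DecidablePred P] :
    arcCount G (fun u _ => P u) = ∑ u, if P u then nbrCount G u else 0 := by
  classical
  unfold arcCount nbrCount
  refine Finset.sum_congr rfl fun u _ => ?_
  by_cases h : P u <;> simp [h]

theorem nbrCount_le_of_slot {v : Fin n} (h : slot G d v < d) : nbrCount G v ≤ d := by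
  unfold slot at h
  split_ifs at h with h'
  · rw [← sameCount_add_diffCount (fun u : Fin n => (u : ℕ) % d)]; omega
  · exact absurd h (lt_irrefl _)

/-- The colours as signs. -/
def sign (c : Fin n → Bool) (v : Fin n) : ℤ := if c v then 1 else -1

theorem imbalance_eq (c : Fin n → Bool) : imbalance c = ∑ v, sign c v := rfl

open Classical in
/-- The adjacency matrix. -/
noncomputable def adj (G : SimpleGraph (Fin n)) (u v : Fin n) : ℤ := if G.Adj u v then 1 else 0

/-- The number of neighbours of the same colour minus the number of the others. -/
noncomputable def field (G : SimpleGraph (Fin n)) (c : Fin n → Bool) (v : Fin n) : ℤ :=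
  ∑ u, adj G v u * (sign c v * sign c u)

/-- The number of arcs inside the colour classes minus the number of arcs between them. -/
noncomputable def score (G : SimpleGraph (Fin n)) (c : Fin n → Bool) : ℤ := ∑ v, field G c v

/-- The sign in front of the score: it is maximised in the internal case, minimised in the external
one. -/
def aim (e : Bool) : ℤ := if e then 1 else -1

theorem sign_mul_sign (c : Fin n → Bool) (u v : Fin n) :
    sign c v * sign c u = if c u = c v then 1 else -1 := by
  unfold sign; cases c u <;> cases c v <;> simp

theorem field_eq (c : Fin n → Bool) (v : Fin n) :
    field G c v = sameCount G c v - diffCount G c v := by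
  classical
  unfold field sameCount diffCount adj
  rw [Finset.card_filter, Finset.card_filter, Nat.cast_sum, Nat.cast_sum, ← Finset.sum_sub_distrib]
  refine Finset.sum_congr rfl fun u _ => ?_
  rw [sign_mul_sign]
  by_cases h : G.Adj v u <;> by_cases h' : c u = c v <;> simp [h, h']

theorem unhappy_iff_field (c : Fin n → Bool) (v : Fin n) :
    Unhappy G e c v ↔ aim e * field G c v < 0 := by
  rw [field_eq]
  cases e <;> simp [Unhappy, aim]

theorem abs_score_le (c : Fin n → Bool) : |score G c| ≤ arcCount G fun _ _ => True := by
  classical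
  rw [arcCount_row, score, Nat.cast_sum]
  refine (Finset.abs_sum_le_sum_abs _ _).trans (Finset.sum_le_sum fun v _ => ?_)
  rw [field_eq, abs_le, if_pos trivial, ← sameCount_add_diffCount c]
  push_cast
  constructor <;> linarith [Int.natCast_nonneg (sameCount G c v),
    Int.natCast_nonneg (diffCount G c v)]

open Classical in
/-- The vertices that change their colour in the round `r`. -/
noncomputable def flipSet (G : SimpleGraph (Fin n)) (e : Bool) (d r : ℕ) (c : Fin n → Bool) :
    Finset (Fin n) := Finset.univ.filter fun v => slot G d v = r ∧ Unhappy G e c v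

theorem mem_flipSet {r : ℕ} {c : Fin n → Bool} {v : Fin n} :
    v ∈ flipSet G e d r c ↔ slot G d v = r ∧ Unhappy G e c v := by simp [flipSet]

theorem flipRound_apply (r : ℕ) (c : Fin n → Bool) (v : Fin n) :
    flipRound G e d r c v = if v ∈ flipSet G e d r c then !c v else c v := by
  by_cases h : slot G d v = r ∧ Unhappy G e c v
  · simp only [flipRound, if_pos h, if_pos (mem_flipSet.2 h)]
  · simp only [flipRound, if_neg h, if_neg (mt mem_flipSet.1 h)]

/-- Changing the signs on an independent set `F` negates exactly the terms of the arcs with one end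
in `F`. Each such edge occurs in both orders, so the score changes by -4 times the sum of the field
over `F`. Unhappiness makes `aim e` times the field a negative integer, hence at most -1. -/
theorem score_flipRound {r : ℕ} (hr : r < d) (c : Fin n → Bool) :
    aim e * score G c + 4 * (flipSet G e d r c).card ≤ aim e * score G (flipRound G e d r c) := by
  set F := flipSet G e d r c with hF
  set x : Fin n → ℤ := fun v => if v ∈ F then 1 else 0 with hx
  have hsign : ∀ v, sign (flipRound G e d r c) v = sign c v * (1 - 2 * x v) := fun v => by
    simp only [sign, flipRound_apply, ← hF, hx]
    by_cases h : v ∈ F <;> cases c v <;> simp [h]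
  have hind : ∀ u v, adj G v u * (x v * x u) = 0 := fun u v => by
    simp only [adj, hx]
    by_cases ha : G.Adj v u
    · by_cases hv : v ∈ F
      · have := slot_ne_of_adj hr (mem_flipSet.1 hv).1 ha
        have hu : u ∉ F := fun h => this (mem_flipSet.1 h).1
        simp [hu]
      · simp [hv]
    · simp [ha]
  have hterm : ∀ v u, adj G v u * (sign (flipRound G e d r c) v * sign (flipRound G e d r c) u) =
      adj G v u * (sign c v * sign c u) - 2 * (x v * (adj G v u * (sign c v * sign c u))) -
        2 * (x u * (adj G v u * (sign c v * sign c u))) := fun v u => by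
    rw [hsign, hsign]
    linear_combination 4 * sign c v * sign c u * hind u v
  have hsymm : ∑ v, ∑ u, x u * (adj G v u * (sign c v * sign c u)) = ∑ v, x v * field G c v := by
    rw [Finset.sum_comm]
    refine Finset.sum_congr rfl fun u _ => ?_
    rw [field, Finset.mul_sum]
    refine Finset.sum_congr rfl fun v _ => ?_
    have : adj G v u = adj G u v := by
      by_cases h : G.Adj v u
      · simp [adj, h, h.symm]
      · have h' : ¬ G.Adj u v := fun h' => h h'.symm
        simp [adj, h, h']
    rw [this]; ring
  have hsum : score G (flipRound G e d r c) = score G c - 4 * ∑ v, x v * field G c v := by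
    have h1 : ∑ v, ∑ u, x v * (adj G v u * (sign c v * sign c u)) = ∑ v, x v * field G c v :=
      Finset.sum_congr rfl fun v _ => by rw [field, Finset.mul_sum]
    simp only [score]
    unfold field at hsymm h1 ⊢
    simp only [hterm, Finset.sum_sub_distrib, ← Finset.mul_sum]
    simp only [← Finset.mul_sum] at hsymm h1
    rw [hsymm]; ring
  have hF' : ∑ v, x v * (aim e * field G c v) ≤ -(F.card : ℤ) := by
    have : -(F.card : ℤ) = ∑ v, x v * (-1) := by
      simp [hx]
    rw [this]
    refine Finset.sum_le_sum fun v _ => ?_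
    simp only [hx]
    by_cases h : v ∈ F
    · have := (unhappy_iff_field c v).1 (mem_flipSet.1 h).2
      simp only [h, if_true]; linarith
    · simp [h]
  have : aim e * ∑ v, x v * field G c v = ∑ v, x v * (aim e * field G c v) := by
    rw [Finset.mul_sum]; exact Finset.sum_congr rfl fun v _ => by ring
  rw [hsum, mul_sub]
  linarith

/-- The number of colour changes in one cycle. -/
noncomputable def flipCount (G : SimpleGraph (Fin n)) (e : Bool) (d : ℕ) (c : Fin n → Bool) : ℕ :=
  ∑ r ∈ Finset.range d, (flipSet G e d r (flipRounds G e d c r)).card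

theorem score_flipRounds (c : Fin n → Bool) :
    aim e * score G c + 4 * flipCount G e d c ≤ aim e * score G (flipRounds G e d c d) := by
  have : ∀ r ≤ d, aim e * score G c +
      4 * ((∑ i ∈ Finset.range r, (flipSet G e d i (flipRounds G e d c i)).card : ℕ) : ℤ) ≤
      aim e * score G (flipRounds G e d c r) := by
    intro r
    induction r with
    | zero => intro _; simp [flipRounds]
    | succ r ih =>
      intro hr
      have h1 := ih (by omega)
      have h2 := score_flipRound (G := G) (e := e) (d := d) (r := r) (by omega)
        (flipRounds G e d c r)
      rw [Finset.sum_range_succ]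
      push_cast at h1 ⊢
      rw [flipRounds]
      linarith
  exact this d le_rfl

/-- Every change gains at least 4, and the score can vary by at most twice the number of arcs. -/
theorem sum_flipCount_le (c : Fin n → Bool) (T : ℕ) :
    2 * ∑ t ∈ Finset.range T, flipCount G e d (flipCycles G e d c t) ≤
      arcCount G fun _ _ => True := by
  have : ∀ t, aim e * score G c +
      4 * ((∑ i ∈ Finset.range t, flipCount G e d (flipCycles G e d c i) : ℕ) : ℤ) ≤
      aim e * score G (flipCycles G e d c t) := by
    intro t
    induction t with
    | zero => simp [flipCycles]
    | succ t ih =>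
      have h2 := score_flipRounds (G := G) (e := e) (d := d) (flipCycles G e d c t)
      rw [Finset.sum_range_succ]
      push_cast at ih ⊢
      rw [flipCycles]
      linarith
  have h := this T
  have h1 := abs_le.1 (abs_score_le (G := G) c)
  have h2 := abs_le.1 (abs_score_le (G := G) (flipCycles G e d c T))
  have : ((2 * ∑ t ∈ Finset.range T, flipCount G e d (flipCycles G e d c t) : ℕ) : ℤ) ≤
      (arcCount G fun _ _ => True : ℕ) := by
    push_cast at h ⊢
    cases e <;> simp only [aim] at h <;> norm_num at h <;> linarith
  exact_mod_cast this

open Classical in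
/-- The number of unhappy vertices that may change their colour in some round. -/
noncomputable def movableUnhappy (G : SimpleGraph (Fin n)) (e : Bool) (d : ℕ) (c : Fin n → Bool) :
    Finset (Fin n) := Finset.univ.filter fun v => slot G d v < d ∧ Unhappy G e c v

open Classical in
/-- The closed neighbourhood of a set of vertices. -/
noncomputable def closedNbhd (G : SimpleGraph (Fin n)) (F : Finset (Fin n)) : Finset (Fin n) :=
  F.biUnion fun w => insert w (Finset.univ.filter fun u => G.Adj w u)

theorem card_closedNbhd_le {F : Finset (Fin n)} (hF : ∀ w ∈ F, slot G d w < d) :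
    (closedNbhd G F).card ≤ (d + 1) * F.card := by
  classical
  refine Finset.card_biUnion_le.trans ?_
  rw [mul_comm, ← smul_eq_mul]
  refine Finset.sum_le_card_nsmul _ _ _ fun w hw => (Finset.card_insert_le _ _).trans ?_
  have := nbrCount_le_of_slot (hF w hw)
  simpa [nbrCount] using this

theorem mem_closedNbhd {F : Finset (Fin n)} {v : Fin n} :
    v ∈ closedNbhd G F ↔ ∃ w ∈ F, v = w ∨ G.Adj w v := by
  simp [closedNbhd]

theorem unhappy_of_notMem_closedNbhd {F : Finset (Fin n)} {f g : Fin n → Bool} {v : Fin n}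
    (hF : ∀ u, g u ≠ f u → u ∈ F) (hv : v ∉ closedNbhd G F) :
    Unhappy G e g v ↔ Unhappy G e f v := by
  rw [mem_closedNbhd] at hv
  push Not at hv
  refine unhappy_congr ?_ fun u hu => ?_
  · by_contra h
    exact (hv v (hF v h)).1 rfl
  · by_contra h
    exact (hv u (hF u h)).2 hu.symm

/-- Suppose that no vertex in the closed neighbourhood of `v` changes during the cycle. Then an
unhappy `v` is still unhappy when its round comes, and changes its colour: a contradiction. So `v`
is within distance one of a change, and the changing vertices have degree at most `d`. -/
theorem card_movableUnhappy_le (c : Fin n → Bool) :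
    (movableUnhappy G e d c).card ≤ (d + 1) * flipCount G e d c := by
  classical
  set F : Finset (Fin n) := (Finset.range d).biUnion fun r =>
    flipSet G e d r (flipRounds G e d c r) with hF
  have hslot : ∀ w ∈ F, slot G d w < d := by
    intro w hw
    simp only [hF, Finset.mem_biUnion, Finset.mem_range, mem_flipSet] at hw
    obtain ⟨r, hr, h, -⟩ := hw
    omega
  have hcard : F.card ≤ flipCount G e d c := Finset.card_biUnion_le
  refine (Finset.card_le_card (t := closedNbhd G F) fun v hv => ?_).trans
    ((card_closedNbhd_le hslot).trans (Nat.mul_le_mul_left _ hcard))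
  simp only [movableUnhappy, Finset.mem_filter, Finset.mem_univ, true_and] at hv
  by_contra hvF
  have hchange : ∀ r ≤ d, ∀ u, flipRounds G e d c r u ≠ c u → u ∈ F := by
    intro r
    induction r with
    | zero => intro _ u h; exact absurd rfl h
    | succ r ih =>
      intro hr u h
      rw [flipRounds, flipRound_apply] at h
      split_ifs at h with h'
      · exact Finset.mem_biUnion.2 ⟨r, Finset.mem_range.2 hr, h'⟩
      · exact ih (by omega) u h
  have hun := (unhappy_of_notMem_closedNbhd (e := e) (hchange (slot G d v) hv.1.le) hvF).2 hv.2
  refine hvF (mem_closedNbhd.2 ⟨v, ?_, Or.inl rfl⟩)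
  exact Finset.mem_biUnion.2 ⟨slot G d v, Finset.mem_range.2 hv.1, mem_flipSet.2 ⟨rfl, hun⟩⟩

open Classical in
/-- The vertices that never change their colour. -/
noncomputable def frozen (G : SimpleGraph (Fin n)) (d : ℕ) : Finset (Fin n) :=
  Finset.univ.filter fun v => ¬ slot G d v < d

/-- A frozen vertex has more than `d` neighbours or at least one neighbour in its residue class;
either way it contributes at least `d` to the right-hand side. -/
theorem card_frozen_le (hd : 1 ≤ d) : d * (frozen G d).card ≤
    (arcCount G fun _ _ => True) + d * arcCount G fun u v => (u : ℕ) % d = (v : ℕ) % d := by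
  classical
  have h : ∀ v ∈ frozen G d, d ≤ nbrCount G v +
      d * ∑ u, if G.Adj v u ∧ (v : ℕ) % d = (u : ℕ) % d then 1 else 0 := by
    intro v hv
    simp only [frozen, Finset.mem_filter, Finset.mem_univ, true_and] at hv
    unfold slot at hv
    split_ifs at hv with h'
    · exact absurd (Nat.mod_lt _ hd) hv
    · rw [not_and_or] at h'
      rcases h' with h' | h'
      · refine le_add_left (Nat.le_mul_of_pos_right _ (Nat.pos_of_ne_zero fun h0 => h' ?_))
        rw [← h0, sameCount, Finset.card_filter]
        exact Finset.sum_congr rfl fun u _ => by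
          simp only [eq_comm (a := (u : ℕ) % d)]
      · rw [← sameCount_add_diffCount (fun u : Fin n => (u : ℕ) % d)]
        omega
  calc d * (frozen G d).card = ∑ v ∈ frozen G d, d := by simp [mul_comm]
    _ ≤ ∑ v ∈ frozen G d, (nbrCount G v +
        d * ∑ u, if G.Adj v u ∧ (v : ℕ) % d = (u : ℕ) % d then 1 else 0) := Finset.sum_le_sum h
    _ ≤ ∑ v, (nbrCount G v +
        d * ∑ u, if G.Adj v u ∧ (v : ℕ) % d = (u : ℕ) % d then 1 else 0) :=
      Finset.sum_le_sum_of_subset (Finset.subset_univ _)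
    _ = _ := by
      rw [Finset.sum_add_distrib, ← Finset.mul_sum, arcCount_row, arcCount]
      simp only [if_true]
      congr!

end Energy

/-! ### The second moment of a sum of odd local functions of random signs -/

/-- Negating the bits in `S` is an involution that changes the sign of `f` and leaves `g` alone. -/
theorem sum_mul_eq_zero_of_disjoint {ι : Type*} [Fintype ι] [DecidableEq ι]
    {f g : (ι → Bool) → ℤ} {S S' : Finset ι}
    (hf : ∀ b b', (∀ i ∈ S, b i = b' i) → f b = f b')
    (hg : ∀ b b', (∀ i ∈ S', b i = b' i) → g b = g b')
    (hodd : ∀ b, f (fun i => !b i) = -f b) (hd : Disjoint S S') : ∑ b, f b * g b = 0 := by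
  classical
  let φ : (ι → Bool) → ι → Bool := fun b i => if i ∈ S then !b i else b i
  have hφ : Function.Involutive φ := fun b => by
    funext i
    by_cases h : i ∈ S <;> simp [φ, h]
  have h1 : ∀ b, f (φ b) * g (φ b) = -(f b * g b) := fun b => by
    rw [hf (φ b) (fun i => !b i) fun i hi => by simp [φ, hi], hodd,
      hg (φ b) b fun i hi => by simp [φ, Finset.disjoint_right.1 hd hi], neg_mul]
  have h2 : ∑ b, f (φ b) * g (φ b) = ∑ b, f b * g b :=
    (Equiv.sum_comp (hφ.toPerm) fun b => f b * g b)
  simp only [h1, Finset.sum_neg_distrib] at h2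
  linarith

/-- Expand the square. Pairs with disjoint supports contribute zero; any other pair contributes at
most 1 on average, hence at most the number of common coordinates. Summing this number over all
pairs and exchanging the sums gives the squares on the right. -/
theorem sum_sq_le_of_local {ι V : Type*} [Fintype ι] [DecidableEq ι] [Fintype V]
    (f : V → (ι → Bool) → ℤ) (S : V → Finset ι)
    (hf : ∀ v b b', (∀ i ∈ S v, b i = b' i) → f v b = f v b')
    (hodd : ∀ v b, f v (fun i => !b i) = -f v b) (hle : ∀ v b, |f v b| ≤ 1) :
    ∑ b, (∑ v, f v b) ^ 2 ≤
      2 ^ Fintype.card ι * ∑ i, ((Finset.univ.filter fun v => i ∈ S v).card : ℤ) ^ 2 := by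
  have key : ∀ v w, ∑ b, f v b * f w b ≤ 2 ^ Fintype.card ι *
      ∑ i, (if i ∈ S v then (1 : ℤ) else 0) * if i ∈ S w then 1 else 0 := by
    intro v w
    have hnn : ∀ i ∈ Finset.univ,
        0 ≤ (if i ∈ S v then (1 : ℤ) else 0) * if i ∈ S w then 1 else 0 := fun i _ => by
      split_ifs <;> simp
    by_cases hd : Disjoint (S v) (S w)
    · rw [sum_mul_eq_zero_of_disjoint (hf v) (hf w) (hodd v) hd]
      exact mul_nonneg (by positivity) (Finset.sum_nonneg hnn)
    · obtain ⟨i, hi, hi'⟩ := Finset.not_disjoint_iff.1 hd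
      have h1 : (1 : ℤ) ≤ ∑ i, (if i ∈ S v then (1 : ℤ) else 0) * if i ∈ S w then 1 else 0 := by
        refine le_trans ?_ (Finset.single_le_sum hnn (Finset.mem_univ i))
        simp [hi, hi']
      calc ∑ b, f v b * f w b ≤ ∑ _b : ι → Bool, (1 : ℤ) := by
            refine Finset.sum_le_sum fun b _ => (le_abs_self _).trans ?_
            rw [abs_mul]
            exact mul_le_one₀ (hle v b) (abs_nonneg _) (hle w b)
        _ = 2 ^ Fintype.card ι * 1 := by simp
        _ ≤ _ := mul_le_mul_of_nonneg_left h1 (by positivity)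
  calc ∑ b, (∑ v, f v b) ^ 2 = ∑ v, ∑ w, ∑ b, f v b * f w b := by
        simp_rw [sq, Finset.sum_mul_sum]
        rw [Finset.sum_comm]
        exact Finset.sum_congr rfl fun v _ => Finset.sum_comm
    _ ≤ ∑ v, ∑ w, 2 ^ Fintype.card ι *
        ∑ i, (if i ∈ S v then (1 : ℤ) else 0) * if i ∈ S w then 1 else 0 :=
      Finset.sum_le_sum fun v _ => Finset.sum_le_sum fun w _ => key v w
    _ = _ := by
      simp_rw [← Finset.mul_sum]
      congr 1
      simp_rw [Finset.card_filter, Nat.cast_sum, sq, Finset.sum_mul_sum]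
      rw [Finset.sum_comm' (t' := Finset.univ) (s' := fun _ => Finset.univ) (by simp)]
      rw [Finset.sum_comm]
      have : ∀ v, ∑ w, ∑ i, ((if i ∈ S v then (1 : ℤ) else 0) * if i ∈ S w then 1 else 0) =
          ∑ i, ∑ w, ((if i ∈ S v then (1 : ℤ) else 0) * if i ∈ S w then 1 else 0) :=
        fun v => Finset.sum_comm
      simp_rw [this]
      rw [Finset.sum_comm]
      push_cast
      rfl

/-! ### Locality of the dynamics -/

section Locality

variable {n : ℕ} {G : SimpleGraph (Fin n)} {d : ℕ} {e : Bool}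

open Classical in
/-- The vertices on whose initial colour the colour of `v` after `j` rounds can depend. -/
noncomputable def dependence (G : SimpleGraph (Fin n)) (d : ℕ) : ℕ → Fin n → Finset (Fin n)
  | 0, v => {v}
  | j + 1, v => if slot G d v < d then dependence G d j v ∪
      (Finset.univ.filter fun u => G.Adj v u).biUnion (dependence G d j) else dependence G d j v

theorem dependence_subset (j : ℕ) (v : Fin n) : dependence G d j v ⊆ dependence G d (j + 1) v := by
  rw [dependence]
  split_ifs
  · exact Finset.subset_union_left
  · exact Finset.Subset.refl _

/-- The colour of each vertex `v` under `F c` depends on `c` only through `dependence G d j v`, and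
`F` is compatible with swapping the colours. -/
structure OddLocal (G : SimpleGraph (Fin n)) (d j : ℕ) (F : (Fin n → Bool) → Fin n → Bool) :
    Prop where
  loc : ∀ v c c', (∀ u ∈ dependence G d j v, c u = c' u) → F c v = F c' v
  odd : ∀ c v, F (fun u => !c u) v = !F c v

theorem unhappy_not (c : Fin n → Bool) (v : Fin n) :
    Unhappy G e (fun u => !c u) v ↔ Unhappy G e c v := by
  have h1 : sameCount G (fun u => !c u) v = sameCount G c v := by
    unfold sameCount; congr 1; ext u; simp
  have h2 : diffCount G (fun u => !c u) v = diffCount G c v := by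
    unfold diffCount; congr 1; ext u; simp
  rw [Unhappy, Unhappy, h1, h2]

/-- A moving vertex reads only its own colour and those of its neighbours, and unhappiness is
invariant under swapping the two colours. -/
theorem OddLocal.flipRound {j r : ℕ} (hr : r < d) {F : (Fin n → Bool) → Fin n → Bool}
    (h : OddLocal G d j F) : OddLocal G d (j + 1) fun c => flipRound G e d r (F c) := by
  refine ⟨fun v c c' hc => ?_, fun c v => ?_⟩
  · have hv : F c v = F c' v := h.loc v c c' fun u hu => hc u (dependence_subset j v hu)
    by_cases hs : slot G d v = r
    · have hU : Unhappy G e (F c) v ↔ Unhappy G e (F c') v := by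
        refine unhappy_congr hv fun u hu => h.loc u c c' fun w hw => hc w ?_
        rw [dependence, if_pos (by omega)]
        refine Finset.mem_union_right _ (Finset.mem_biUnion.2 ⟨u, ?_, hw⟩)
        simpa using hu
      have hm : v ∈ flipSet G e d r (F c) ↔ v ∈ flipSet G e d r (F c') := by
        rw [mem_flipSet, mem_flipSet, hU]
      by_cases hv' : v ∈ flipSet G e d r (F c)
      · simp only [flipRound_apply, if_pos hv', if_pos (hm.1 hv'), hv]
      · simp only [flipRound_apply, if_neg hv', if_neg (mt hm.2 hv'), hv]
    · have hn : ∀ f, v ∉ flipSet G e d r f := fun f h' => hs (mem_flipSet.1 h').1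
      simp only [flipRound_apply, if_neg (hn _), hv]
  · have hF : F (fun u => !c u) = fun u => !F c u := funext fun u => h.odd c u
    have hm : v ∈ flipSet G e d r (fun u => !F c u) ↔ v ∈ flipSet G e d r (F c) := by
      rw [mem_flipSet, mem_flipSet, unhappy_not]
    simp only [hF]
    by_cases hv' : v ∈ flipSet G e d r (F c)
    · simp only [flipRound_apply, if_pos hv', if_pos (hm.2 hv')]
    · simp only [flipRound_apply, if_neg hv', if_neg (mt hm.1 hv')]

theorem OddLocal.flipRounds {j : ℕ} {F : (Fin n → Bool) → Fin n → Bool} (h : OddLocal G d j F) :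
    ∀ r ≤ d, OddLocal G d (j + r) fun c => flipRounds G e d (F c) r := by
  intro r
  induction r with
  | zero => exact fun _ => h
  | succ r ih => exact fun hr => (ih (by omega)).flipRound (by omega)

theorem oddLocal_flipCycles (t : ℕ) : OddLocal G d (t * d) fun c => flipCycles G e d c t := by
  induction t with
  | zero =>
    rw [Nat.zero_mul]
    exact ⟨fun v c c' h => h v (by simp [dependence]), fun _ _ => rfl⟩
  | succ t ih => rw [Nat.succ_mul]; exact ih.flipRounds d le_rfl

open Classical in
/-- The vertices whose colour after `j` rounds can depend on the initial colour of `u`. -/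
noncomputable def influence (G : SimpleGraph (Fin n)) (d j : ℕ) (u : Fin n) : Finset (Fin n) :=
  Finset.univ.filter fun v => u ∈ dependence G d j v

theorem mem_influence {j : ℕ} {u v : Fin n} :
    v ∈ influence G d j u ↔ u ∈ dependence G d j v := by simp [influence]

theorem slot_lt_of_mem_influence {u : Fin n} (j : ℕ) {v : Fin n} (h : v ∈ influence G d j u)
    (hne : v ≠ u) : slot G d v < d := by
  induction j with
  | zero => simp [mem_influence, dependence] at h; exact absurd h.symm hne
  | succ j ih =>
    by_contra hs
    rw [mem_influence, dependence, if_neg hs, ← mem_influence] at h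
    exact hs (ih h)

/-- In one round influence spreads from its present members to their neighbours. All members except
possibly `u` itself are unfrozen, because a frozen vertex depends only on its own initial colour, so
they have degree at most `d`. Only the degree of `u` is unbounded, and it enters as a factor once.
-/
theorem card_influence_le (j : ℕ) (u : Fin n) :
    (influence G d j u).card ≤ (nbrCount G u + 1) * (d + 2) ^ j := by
  classical
  induction j with
  | zero =>
    have : influence G d 0 u = {u} := by
      ext v; simp [mem_influence, dependence, eq_comm]
    rw [this]; simp
  | succ j ih =>
    set I := influence G d j u with hI
    have hsub : influence G d (j + 1) u ⊆ I ∪ (I.erase u).biUnion (fun w =>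
        Finset.univ.filter fun v => G.Adj w v) ∪ Finset.univ.filter fun v => G.Adj u v := by
      intro v hv
      rw [mem_influence, dependence] at hv
      by_cases hs : slot G d v < d
      · rw [if_pos hs, Finset.mem_union, Finset.mem_biUnion] at hv
        rcases hv with hv | ⟨w, hw, hv⟩
        · exact Finset.mem_union_left _ (Finset.mem_union_left _ (mem_influence.2 hv))
        · simp only [Finset.mem_filter, Finset.mem_univ, true_and] at hw
          by_cases hwu : w = u
          · subst hwu
            exact Finset.mem_union_right _ (by simp [hw.symm])
          · refine Finset.mem_union_left _ (Finset.mem_union_right _ (Finset.mem_biUnion.2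
              ⟨w, Finset.mem_erase.2 ⟨hwu, mem_influence.2 hv⟩, by simp [hw.symm]⟩))
      · rw [if_neg hs] at hv
        exact Finset.mem_union_left _ (Finset.mem_union_left _ (mem_influence.2 hv))
    have h1 : ((I.erase u).biUnion fun w => Finset.univ.filter fun v => G.Adj w v).card ≤
        d * I.card := by
      refine (Finset.card_biUnion_le.trans (Finset.sum_le_card_nsmul _ _ d fun w hw => ?_)).trans ?_
      · have hw' := Finset.mem_erase.1 hw
        exact nbrCount_le_of_slot (slot_lt_of_mem_influence j hw'.2 hw'.1)
      · rw [smul_eq_mul, mul_comm]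
        exact Nat.mul_le_mul_left _ (Finset.card_le_card (Finset.erase_subset _ _))
    have h2 := (Finset.card_le_card hsub).trans (Finset.card_union_le _ _)
    have h3 := Finset.card_union_le I ((I.erase u).biUnion fun w =>
      Finset.univ.filter fun v => G.Adj w v)
    have h4 : (Finset.univ.filter fun v => G.Adj u v).card = nbrCount G u := rfl
    have h5 : nbrCount G u ≤ (nbrCount G u + 1) * (d + 2) ^ j :=
      (Nat.le_succ _).trans (Nat.le_mul_of_pos_right _ (by positivity))
    have h6 : (nbrCount G u + 1) * (d + 2) ^ (j + 1) = d * ((nbrCount G u + 1) * (d + 2) ^ j) +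
      2 * ((nbrCount G u + 1) * (d + 2) ^ j) := by ring
    have h7 : d * I.card ≤ d * ((nbrCount G u + 1) * (d + 2) ^ j) := Nat.mul_le_mul_left _ ih
    omega

theorem card_residue_le {M : ℕ} (i : ℕ) :
    M * (Finset.univ.filter fun u : Fin n => (u : ℕ) % M = i).card ≤ n + M := by
  have h : (Finset.univ.filter fun u : Fin n => (u : ℕ) % M = i).card ≤
      (Finset.range (n / M + 1)).card := by
    refine Finset.card_le_card_of_injOn (fun u => (u : ℕ) / M) (fun u _ => ?_) fun u hu w hw h => ?_
    · simpa using Nat.lt_succ_of_le (Nat.div_le_div_right u.2.le)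
    · simp only [Finset.coe_filter, Finset.mem_univ, true_and, Set.mem_ofPred_eq] at hu hw h
      apply Fin.ext
      rw [← Nat.div_add_mod (u : ℕ) M, ← Nat.div_add_mod (w : ℕ) M, hu, hw, h]
  rw [Finset.card_range] at h
  refine (Nat.mul_le_mul_left M h).trans ?_
  rw [Nat.mul_add, Nat.mul_one]
  exact Nat.add_le_add_right (Nat.mul_div_le n M) M

end Locality

/-! ### Existence of a good starting pattern -/

section Existence

variable {n : ℕ} {G : SimpleGraph (Fin n)} {d : ℕ} {e : Bool}

/-- The pattern `b`, repeated periodically. -/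
def patternColouring (n : ℕ) {M : ℕ} (hM : 0 < M) (b : Fin M → Bool) : Fin n → Bool :=
  fun v => b ⟨(v : ℕ) % M, Nat.mod_lt _ hM⟩

/-- Sum the bound on the influence over the residue class of `i`. Its degrees add up to at most Cn/M
by assumption, and it has at most (n + M)/M ≤ 2n/M vertices, whence the factor `C + 2`. -/
theorem card_dependent_le {C M T t : ℕ} (hMn : M ≤ n) (ht : t < T) {i : ℕ}
    (hG : M * arcCount G (fun u _ => (u : ℕ) % M = i) ≤ C * n) {W : Finset (Fin n)}
    (hW : ∀ v ∈ W, ∃ u ∈ dependence G d (t * d) v, (u : ℕ) % M = i) :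
    M * W.card ≤ (d + 2) ^ (T * d) * (C + 2) * n := by
  classical
  set R : Finset (Fin n) := Finset.univ.filter fun u : Fin n => (u : ℕ) % M = i with hR
  have hsub : W ⊆ R.biUnion fun u => influence G d (t * d) u := by
    intro v hv
    obtain ⟨u, hu, hi⟩ := hW v hv
    exact Finset.mem_biUnion.2 ⟨u, by simp [hR, hi], mem_influence.2 hu⟩
  have h1 : W.card ≤ (∑ u ∈ R, (nbrCount G u + 1)) * (d + 2) ^ (t * d) := by
    rw [Finset.sum_mul]
    exact (Finset.card_le_card hsub).trans
      (Finset.card_biUnion_le.trans (Finset.sum_le_sum fun u _ => card_influence_le _ u))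
  have h2 : M * ∑ u ∈ R, (nbrCount G u + 1) ≤ (C + 2) * n := by
    have h3 : M * R.card ≤ n + M := card_residue_le i
    have h4 : ∑ u ∈ R, nbrCount G u = arcCount G (fun u _ => (u : ℕ) % M = i) := by
      rw [arcCount_row, hR, Finset.sum_filter]
    rw [Finset.sum_add_distrib, h4, Finset.sum_const, smul_eq_mul, mul_one, Nat.mul_add]
    nlinarith
  have h5 : (d + 2) ^ (t * d) ≤ (d + 2) ^ (T * d) :=
    Nat.pow_le_pow_right (by omega) (Nat.mul_le_mul_right _ ht.le)
  calc M * W.card ≤ M * ((∑ u ∈ R, (nbrCount G u + 1)) * (d + 2) ^ (t * d)) :=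
        Nat.mul_le_mul_left _ h1
    _ = (M * ∑ u ∈ R, (nbrCount G u + 1)) * (d + 2) ^ (t * d) := by ring
    _ ≤ ((C + 2) * n) * (d + 2) ^ (T * d) := Nat.mul_le_mul h2 h5
    _ = _ := by ring

/-- With K = (d + 2)^(Td) (C + 2), each of the M bits affects at most Kn/M vertices, so the mean
square of the imbalance is at most M (Kn/M)² = K²n²/M. -/
theorem sum_imbalance_sq_le {C M T t : ℕ} (hM : 0 < M) (hMn : M ≤ n) (ht : t < T)
    (hG : ∀ i < M, M * arcCount G (fun u _ => (u : ℕ) % M = i) ≤ C * n) :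
    (M : ℤ) * ∑ b : Fin M → Bool, imbalance (flipCycles G e d (patternColouring n hM b) t) ^ 2 ≤
      2 ^ M * (((d + 2) ^ (T * d) * (C + 2) * n : ℕ) : ℤ) ^ 2 := by
  classical
  have hol := oddLocal_flipCycles (G := G) (e := e) (d := d) t
  let S : Fin n → Finset (Fin M) := fun v =>
    Finset.univ.filter fun i => ∃ u ∈ dependence G d (t * d) v, (u : ℕ) % M = i
  have h1 := sum_sq_le_of_local
    (fun v b => sign (flipCycles G e d (patternColouring n hM b) t) v) S
    (fun v b b' hb => ?_) (fun v b => ?_) (fun v b => ?_)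
  · rw [Fintype.card_fin] at h1
    have h2 : (M : ℤ) ^ 2 * ∑ i, ((Finset.univ.filter fun v => i ∈ S v).card : ℤ) ^ 2 ≤
        M * (((d + 2) ^ (T * d) * (C + 2) * n : ℕ) : ℤ) ^ 2 := by
      rw [Finset.mul_sum]
      refine (Finset.sum_le_card_nsmul _ _
        ((((d + 2) ^ (T * d) * (C + 2) * n : ℕ) : ℤ) ^ 2) fun i _ => ?_).trans_eq (by simp)
      rw [← mul_pow]
      refine pow_le_pow_left₀ (by positivity) ?_ 2
      have := card_dependent_le (W := Finset.univ.filter fun v => i ∈ S v) hMn ht (hG i i.2)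
        (fun v hv => by simpa [S] using hv)
      exact_mod_cast this
    have hM' : (0 : ℤ) < M := by exact_mod_cast hM
    have h3 : (M : ℤ) * ∑ i, ((Finset.univ.filter fun v => i ∈ S v).card : ℤ) ^ 2 ≤
        (((d + 2) ^ (T * d) * (C + 2) * n : ℕ) : ℤ) ^ 2 := by
      refine le_of_mul_le_mul_left ?_ hM'
      rw [← mul_assoc, ← sq]; exact h2
    calc _ ≤ (M : ℤ) * (2 ^ M * ∑ i, ((Finset.univ.filter fun v => i ∈ S v).card : ℤ) ^ 2) :=
          mul_le_mul_of_nonneg_left h1 hM'.le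
      _ = 2 ^ M * (M * ∑ i, ((Finset.univ.filter fun v => i ∈ S v).card : ℤ) ^ 2) := by ring
      _ ≤ _ := mul_le_mul_of_nonneg_left h3 (by positivity)
  · have := hol.loc v (patternColouring n hM b) (patternColouring n hM b') fun u hu => ?_
    · simp only [sign, this]
    · refine hb _ ?_
      simp only [S, Finset.mem_filter, Finset.mem_univ, true_and]
      exact ⟨u, hu, rfl⟩
  · have := hol.odd (patternColouring n hM b) v
    have h' : patternColouring n hM (fun i => !b i) = fun u => !patternColouring n hM b u := rfl
    simp only [sign, h', this]
    cases flipCycles G e d (patternColouring n hM b) t v <;> simp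
  · simp only [sign]; split_ifs <;> simp

theorem exists_pattern {C P T : ℕ} (d : ℕ) : ∃ M, 1 ≤ M ∧ ∃ hM : 0 < M,
    ∀ (e : Bool) (n : ℕ) (G : SimpleGraph (Fin n)), M ≤ n →
      (∀ i < M, M * arcCount G (fun u _ => (u : ℕ) % M = i) ≤ C * n) →
      ∃ b, ∀ t < T, P * |imbalance (flipCycles G e d (patternColouring n hM b) t)| ≤ n := by
  set K := (d + 2) ^ (T * d) * (C + 2) with hK
  -- If every pattern had a bad time, the sum over the times of the squared imbalances would always
  -- be at least n²/P², while its mean is at most TK²n²/M. This forces M ≤ P²TK².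
  refine ⟨P ^ 2 * T * K ^ 2 + 1, by omega, by omega, fun e n G hMn hG => ?_⟩
  set M := P ^ 2 * T * K ^ 2 + 1 with hM
  have hM0 : 0 < M := by omega
  by_contra hcon
  push Not at hcon
  set F : (Fin M → Bool) → ℕ → ℤ := fun b t =>
    imbalance (flipCycles G e d (patternColouring n hM0 b) t) with hF
  have h1 : ∀ b, (n : ℤ) ^ 2 ≤ P ^ 2 * ∑ t ∈ Finset.range T, F b t ^ 2 := by
    intro b
    obtain ⟨t, ht, hlt⟩ := hcon b
    calc (n : ℤ) ^ 2 ≤ (P * |F b t|) ^ 2 := pow_le_pow_left₀ (by positivity) hlt.le 2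
      _ = P ^ 2 * F b t ^ 2 := by rw [mul_pow, sq_abs]
      _ ≤ _ := mul_le_mul_of_nonneg_left (Finset.single_le_sum
        (f := fun t => F b t ^ 2) (fun _ _ => sq_nonneg _) (Finset.mem_range.2 ht)) (by positivity)
  have h2 : ∀ t ∈ Finset.range T, (M : ℤ) * ∑ b, F b t ^ 2 ≤ 2 ^ M * ((K * n : ℕ) : ℤ) ^ 2 :=
    fun t ht => sum_imbalance_sq_le hM0 hMn (Finset.mem_range.1 ht) hG
  have h3 : (2 : ℤ) ^ M * n ^ 2 ≤ P ^ 2 * ∑ t ∈ Finset.range T, ∑ b, F b t ^ 2 := by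
    rw [Finset.sum_comm, Finset.mul_sum]
    calc (2 : ℤ) ^ M * n ^ 2 = ∑ _b : Fin M → Bool, (n : ℤ) ^ 2 := by simp
      _ ≤ _ := Finset.sum_le_sum fun b _ => h1 b
  have h4 : (M : ℤ) * ∑ t ∈ Finset.range T, ∑ b, F b t ^ 2 ≤
      T * (2 ^ M * ((K * n : ℕ) : ℤ) ^ 2) := by
    rw [Finset.mul_sum]
    exact (Finset.sum_le_card_nsmul _ _ _ h2).trans_eq (by simp)
  have h5 : (2 : ℤ) ^ M * (M * n ^ 2) ≤ 2 ^ M * (P ^ 2 * T * K ^ 2 * n ^ 2) := by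
    calc (2 : ℤ) ^ M * (M * n ^ 2) = M * (2 ^ M * n ^ 2) := by ring
      _ ≤ M * (P ^ 2 * ∑ t ∈ Finset.range T, ∑ b, F b t ^ 2) :=
        mul_le_mul_of_nonneg_left h3 (by positivity)
      _ = P ^ 2 * (M * ∑ t ∈ Finset.range T, ∑ b, F b t ^ 2) := by ring
      _ ≤ P ^ 2 * (T * (2 ^ M * ((K * n : ℕ) : ℤ) ^ 2)) :=
        mul_le_mul_of_nonneg_left h4 (by positivity)
      _ = _ := by push_cast; ring
  have h6 := le_of_mul_le_mul_left h5 (by positivity)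
  have hn : (0 : ℤ) < (n : ℤ) ^ 2 := by
    have : 0 < n := by omega
    positivity
  have h7 : (M : ℤ) = P ^ 2 * T * K ^ 2 + 1 := by rw [hM]; push_cast; ring
  rw [h7] at h6
  linarith

/-- Put a leading one in position `M` in front of the bits of `b`; then `Nat.log 2 q` recovers the
period. -/
theorem exists_digitColouring (n : ℕ) {M : ℕ} (hM : 0 < M) (b : Fin M → Bool) :
    ∃ q, 2 ≤ q ∧ q < 2 ^ (M + 1) ∧ digitColouring n q = patternColouring n hM b := by
  have hlt : Nat.ofBits b < 2 ^ M := Nat.ofBits_lt_two_pow b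
  have h2 : 2 ≤ 2 ^ M := by
    calc 2 = 2 ^ 1 := rfl
      _ ≤ 2 ^ M := Nat.pow_le_pow_right (by omega) hM
  refine ⟨2 ^ M + Nat.ofBits b, by omega, by rw [pow_succ]; omega, ?_⟩
  have hlog : Nat.log 2 (2 ^ M + Nat.ofBits b) = M :=
    Nat.log_eq_of_pow_le_of_lt_pow (by omega) (by rw [pow_succ]; omega)
  funext v
  have hv := Nat.mod_lt (v : ℕ) hM
  simp only [digitColouring, patternColouring, hlog]
  rw [Nat.testBit_two_pow_add_gt hv, Nat.testBit_ofBits_lt b _ hv]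

/-- If all unfrozen vertices have one colour, they outvote the frozen ones, which are at most a
quarter. So a rebalancing cannot end with the opposite colour in excess. -/
theorem imbalance_lt_of_blue {g : Fin n → Bool} {b : Bool} (h4 : 4 * (frozen G d).card ≤ n)
    (hn : 0 < n) (h : ∀ u, slot G d u < d → g u = b) :
    (if b then 1 else -1) * imbalance g > 0 := by
  classical
  have h1 : ∀ u, (if b then 1 else -1) * sign g u ≥ 1 - 2 * if u ∈ frozen G d then 1 else 0 := by
    intro u
    by_cases hu : slot G d u < d
    · have : u ∉ frozen G d := by simp [frozen, hu]
      rw [sign, h u hu]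
      cases b <;> simp [this]
    · have : u ∈ frozen G d := by simp only [frozen, Finset.mem_filter, Finset.mem_univ, true_and, hu,
          not_false_eq_true]
      simp only [this, if_true, sign]
      cases b <;> cases g u <;> simp
  have h2 : (if b then 1 else -1) * imbalance g ≥
      ∑ u : Fin n, ((1 : ℤ) - 2 * if u ∈ frozen G d then 1 else 0) := by
    rw [imbalance_eq, Finset.mul_sum]
    exact Finset.sum_le_sum fun u _ => h1 u
  have h3 : ∑ u : Fin n, ((1 : ℤ) - 2 * if u ∈ frozen G d then 1 else 0) =
      n - 2 * (frozen G d).card := by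
    rw [Finset.sum_sub_distrib, ← Finset.mul_sum]; simp
  rw [h3] at h2
  have : 4 * ((frozen G d).card : ℤ) ≤ n := by exact_mod_cast h4
  have hn' : (0 : ℤ) < n := by exact_mod_cast hn
  linarith

/-- A vertex unhappy after the rebalancing is frozen, was unhappy before, or lies in the closed
neighbourhood of one of the changed vertices, which are unfrozen. -/
theorem unhappyCount_le_of_rebalanced {f g : Fin n → Bool} (h : Rebalanced G d f g n) :
    unhappyCount G e g ≤ (frozen G d).card + (movableUnhappy G e d f).card +
      (d + 1) * (Finset.univ.filter fun u => g u ≠ f u).card := by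
  classical
  set F : Finset (Fin n) := Finset.univ.filter fun u => g u ≠ f u with hF
  have hsub : (Finset.univ.filter fun v => Unhappy G e g v) ⊆
      (frozen G d ∪ movableUnhappy G e d f) ∪ closedNbhd G F := by
    intro v hv
    rw [Finset.mem_filter] at hv
    by_contra hn
    rw [Finset.mem_union, not_or, Finset.mem_union, not_or] at hn
    have hun := (unhappy_of_notMem_closedNbhd (e := e) (f := f) (g := g)
      (fun u hu => by simp [hF, hu]) hn.2).1 hv.2
    by_cases hs : slot G d v < d
    · exact hn.1.2 (by simp [movableUnhappy, hs, hun])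
    · refine hn.1.1 ?_
      simp only [frozen, Finset.mem_filter, Finset.mem_univ, true_and, hs, not_false_eq_true]
  have h1 : unhappyCount G e g = (Finset.univ.filter fun v => Unhappy G e g v).card := by
    rw [unhappyCount, Finset.card_filter]
  have h2 : (closedNbhd G F).card ≤ (d + 1) * F.card :=
    card_closedNbhd_le fun w hw => h.movable w (by simpa [hF] using hw)
  rw [h1]
  have := (Finset.card_le_card hsub).trans (Finset.card_union_le _ _)
  have := Finset.card_union_le (frozen G d) (movableUnhappy G e d f)
  omega

/-- The properties of a graph that guarantee the success of the algorithm: it is sparse, it has few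
edges within the residue classes modulo `d`, and the degrees are evenly distributed over the residue
classes modulo `M`. -/
structure Regular (G : SimpleGraph (Fin n)) (C d M : ℕ) : Prop where
  sparse : arcCount G (fun _ _ => True) ≤ C * n
  within : d * arcCount G (fun u v => (u : ℕ) % d = (v : ℕ) % d) ≤ C * n
  even : ∀ i < M, M * arcCount G (fun u _ => (u : ℕ) % M = i) ≤ C * n

/-- The choice of `d` leaves at most n/(4k) frozen vertices, at most n/(8k) unhappy unfrozen ones
before the rebalancing, and at most n/(2k) disturbed by it; together fewer than n/k. -/
theorem exists_not_fails {C k : ℕ} (hC : 1 ≤ C) (hk : 1 ≤ k) (hd : d = 8 * C * k) :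
    ∃ M, 1 ≤ M ∧ ∀ (e : Bool) (n : ℕ) (G : SimpleGraph (Fin n)), M ≤ n → Regular G C d M →
      ∃ q, 2 ≤ q ∧ q < 2 ^ (M + 1) ∧ ¬ Fails G e k d (d * d) q := by
  -- The factor `k * (d + 1)` is what the rebalancing costs: at most half the imbalance in changes,
  -- each disturbing at most `d + 1` vertices.
  obtain ⟨M, hM1, hM, hpat⟩ := exists_pattern (C := C) (P := k * (d + 1)) (T := d * d) d
  refine ⟨M, hM1, fun e n G hMn hG => ?_⟩
  obtain ⟨b, hb⟩ := hpat e n G hMn hG.even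
  obtain ⟨q, h2q, hqM, hq⟩ := exists_digitColouring n hM b
  refine ⟨q, h2q, hqM, fun hfail => ?_⟩
  rw [Fails, hq] at hfail
  set x := flipCycles G e d (patternColouring n hM b) with hx
  have hCk : 1 ≤ C * k := Nat.mul_pos hC hk
  have hd1 : 1 ≤ d := by rw [hd, mul_assoc]; omega
  have hn : 0 < n := by omega
  -- Averaging: all cycles together make at most Cn/2 changes, and there are d² of them.
  obtain ⟨t, ht, hflip⟩ : ∃ t < d * d, 2 * (d * d) * flipCount G e d (x t) ≤ C * n := by
    by_contra hcon
    push Not at hcon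
    have h1 := (sum_flipCount_le (G := G) (e := e) (d := d) (patternColouring n hM b)
      (d * d)).trans hG.sparse
    have h2 : ∑ t ∈ Finset.range (d * d), C * n <
        ∑ t ∈ Finset.range (d * d), 2 * (d * d) * flipCount G e d (x t) :=
      Finset.sum_lt_sum_of_nonempty (by simp; omega) fun t ht => hcon t (Finset.mem_range.1 ht)
    rw [Finset.sum_const, Finset.card_range, smul_eq_mul, ← Finset.mul_sum] at h2
    have h3 : d * d * (2 * ∑ t ∈ Finset.range (d * d), flipCount G e d (x t)) ≤ d * d * (C * n) :=
      Nat.mul_le_mul_left _ h1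
    nlinarith
  obtain ⟨g, hg, hnp⟩ := hfail t ht
  refine hnp ?_
  have himb := hb t ht
  have hfz : 4 * (k * (frozen G d).card) ≤ n := by
    have h1 := card_frozen_le (G := G) hd1
    have h2 := hG.sparse
    have h3 := hG.within
    have h4 : (2 * C) * (4 * (k * (frozen G d).card)) ≤ (2 * C) * n := by
      calc (2 * C) * (4 * (k * (frozen G d).card)) = d * (frozen G d).card := by rw [hd]; ring
        _ ≤ (2 * C) * n := by linarith
    exact Nat.le_of_mul_le_mul_left h4 (by omega)
  have hfl : 16 * (k * (d * flipCount G e d (x t))) ≤ n := by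
    have h4 : C * (16 * (k * (d * flipCount G e d (x t)))) ≤ C * n := by
      calc C * (16 * (k * (d * flipCount G e d (x t)))) =
          2 * ((8 * C * k) * d) * flipCount G e d (x t) := by ring
        _ ≤ C * n := by rw [← hd]; exact hflip
    exact Nat.le_of_mul_le_mul_left h4 (by omega)
  have hmv : 8 * (k * (movableUnhappy G e d (x t)).card) ≤ n := by
    have h1 := card_movableUnhappy_le (G := G) (e := e) (d := d) (x t)
    have h2 : (d + 1) * flipCount G e d (x t) ≤ 2 * (d * flipCount G e d (x t)) := by nlinarith
    have h3 : k * (movableUnhappy G e d (x t)).card ≤ k * (2 * (d * flipCount G e d (x t))) :=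
      Nat.mul_le_mul_left _ (h1.trans h2)
    have h4 : k * (2 * (d * flipCount G e d (x t))) = 2 * (k * (d * flipCount G e d (x t))) := by
      ring
    omega
  have hch : 2 * (k * ((d + 1) * (Finset.univ.filter fun u => g u ≠ x t u).card)) ≤ n := by
    have h1 := hg.card
    have h2 := abs_nonneg (imbalance g)
    have h3 : ((k * (d + 1) : ℕ) : ℤ) * (2 * ((Finset.univ.filter fun u => g u ≠ x t u).card : ℤ)) ≤
        ((k * (d + 1) : ℕ) : ℤ) * |imbalance (x t)| :=
      mul_le_mul_of_nonneg_left (by linarith) (by positivity)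
    have h4 : ((2 * (k * ((d + 1) * (Finset.univ.filter fun u => g u ≠ x t u).card)) : ℕ) : ℤ) ≤
        n := by
      refine le_trans (le_of_eq ?_) (h3.trans himb)
      push_cast; ring
    exact_mod_cast h4
  have hfz' : 4 * (frozen G d).card ≤ n := by nlinarith
  constructor
  · rw [abs_le]
    constructor
    -- An imbalance of at most -2 would mean that all unfrozen vertices have become red.
    · by_contra hlt
      have := imbalance_lt_of_blue (b := true) hfz' hn fun u => hg.blue (by omega) u u.2
      simp at this
      omega
    · by_contra hlt
      have := imbalance_lt_of_blue (b := false) hfz' hn fun u => hg.red (by omega) u u.2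
      simp at this
      omega
  · have h1 := Nat.mul_le_mul_left k (unhappyCount_le_of_rebalanced (e := e) hg)
    rw [Nat.mul_add, Nat.mul_add] at h1
    omega

end Existence

/-! ### Concentration of the number of arcs -/

section Probability

open ProbabilityTheory unitInterval

variable {n : ℕ} (p : unitInterval)

/-- The law of the presence of a potential edge in the binomial random graph. -/
noncomputable abbrev edgeLaw (a : Sym2 (Fin n)) : Measure Prop :=
  toNNReal p • Measure.dirac (¬ a.IsDiag) + toNNReal (σ p) • Measure.dirac False

theorem memLp_edgeLaw (a : Sym2 (Fin n)) (f : Prop → ℝ) : MemLp f 2 (edgeLaw p a) :=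
  MemLp.of_bound (measurable_of_countable f).aestronglyMeasurable (max |f True| |f False|)
    (Eventually.of_forall fun P => by
      by_cases h : P <;> simp [h])

theorem integral_edgeLaw (a : Sym2 (Fin n)) (f : Prop → ℝ) :
    ∫ P, f P ∂edgeLaw p a = p * f (¬ a.IsDiag) + (1 - p) * f False := by
  rw [integral_add_measure, integral_smul_nnreal_measure, integral_smul_nnreal_measure,
    integral_dirac, integral_dirac]
  · simp [NNReal.smul_def]
  · exact (integrable_dirac (by simp [enorm_lt_top])).smul_measure_nnreal
  · exact (integrable_dirac (by simp [enorm_lt_top])).smul_measure_nnreal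

open Classical in
/-- The number of pairs `(u, v)` with the property `Q` that are joined by the potential edge `a`. -/
noncomputable def edgeWeight (Q : Fin n → Fin n → Prop) (a : Sym2 (Fin n)) : ℕ :=
  ∑ u, ∑ v, if s(u, v) = a ∧ Q u v then 1 else 0

theorem edgeWeight_le_two (Q : Fin n → Fin n → Prop) (a : Sym2 (Fin n)) : edgeWeight Q a ≤ 2 := by
  classical
  induction a using Sym2.ind with
  | _ x y =>
    unfold edgeWeight
    rw [← Finset.sum_product', ← Finset.card_filter]
    refine (Finset.card_le_card (t := {(x, y), (y, x)}) fun q hq => ?_).trans Finset.card_le_two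
    simp only [Finset.mem_filter, Sym2.eq_iff] at hq
    simp only [Finset.mem_insert, Finset.mem_singleton, Prod.ext_iff]
    exact hq.2.1

-- This writes the number of arcs as a sum of independent variables, one for each potential edge, so
-- that variances add up.
open Classical in
theorem arcCount_eq_sum (G : SimpleGraph (Fin n)) (Q : Fin n → Fin n → Prop) :
    arcCount G Q = ∑ a, if a ∈ G.edgeSet then edgeWeight Q a else 0 := by
  have h : ∀ a, (if a ∈ G.edgeSet then edgeWeight Q a else 0) =
      ∑ u, ∑ v, if s(u, v) = a then (if G.Adj u v ∧ Q u v then 1 else 0) else 0 := by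
    intro a
    unfold edgeWeight
    by_cases ha : a ∈ G.edgeSet
    · rw [if_pos ha]
      refine Finset.sum_congr rfl fun u _ => Finset.sum_congr rfl fun v _ => ?_
      by_cases huv : s(u, v) = a
      · have : G.Adj u v := by rw [← SimpleGraph.mem_edgeSet, huv]; exact ha
        simp [huv, this]
      · simp [huv]
    · rw [if_neg ha]
      symm
      refine Finset.sum_eq_zero fun u _ => Finset.sum_eq_zero fun v _ => ?_
      by_cases huv : s(u, v) = a
      · have : ¬ G.Adj u v := by rw [← SimpleGraph.mem_edgeSet, huv]; exact ha
        simp [this]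
      · simp [huv]
  simp only [h]
  unfold arcCount
  symm
  rw [Finset.sum_comm]
  refine Finset.sum_congr rfl fun u _ => ?_
  rw [Finset.sum_comm]
  refine Finset.sum_congr rfl fun v _ => ?_
  rw [Finset.sum_ite_eq, if_pos (Finset.mem_univ _)]

open Classical in
/-- The number of pairs with the property `Q`. -/
noncomputable def pairCount (Q : Fin n → Fin n → Prop) : ℕ := ∑ u, ∑ v, if Q u v then 1 else 0

theorem sum_edgeWeight (Q : Fin n → Fin n → Prop) : ∑ a, edgeWeight Q a = pairCount Q := by
  classical
  unfold edgeWeight pairCount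
  rw [Finset.sum_comm]
  refine Finset.sum_congr rfl fun u _ => ?_
  rw [Finset.sum_comm]
  refine Finset.sum_congr rfl fun v _ => ?_
  by_cases h : Q u v <;> simp [h]

-- Chebyshev's inequality. The mean is at most `p * pairCount Q`, and the weights are at most 2, so
-- the variance is at most twice that.
open Classical in
theorem measure_arcCount_gt_le (Q : Fin n → Fin n → Prop) {δ x : ℝ} (hδ : 0 < δ)
    (hx : (p : ℝ) * pairCount Q + δ ≤ x) :
    SimpleGraph.binomialRandom (Fin n) p {G | x < arcCount G Q} ≤
      ENNReal.ofReal (2 * (p : ℝ) * pairCount Q / δ ^ 2) := by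
  have hp0 : (0 : ℝ) ≤ p := p.2.1
  have hp1 : (p : ℝ) ≤ 1 := p.2.2
  set X : Sym2 (Fin n) → Prop → ℝ := fun a P => if P then (edgeWeight Q a : ℝ) else 0 with hX
  set Y : (Sym2 (Fin n) → Prop) → ℝ := ∑ a, fun ω => X a (ω a) with hY
  set μ : Measure (Sym2 (Fin n) → Prop) := Measure.pi fun a => edgeLaw p a with hμ
  have hmem : ∀ a, MemLp (X a) 2 (edgeLaw p a) := fun a => memLp_edgeLaw p a _
  have hmem' : ∀ a, MemLp (fun ω : Sym2 (Fin n) → Prop => X a (ω a)) 2 μ := fun a =>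
    (hmem a).comp_measurePreserving (measurePreserving_eval _ a)
  have hYmem : MemLp Y 2 μ := by
    rw [hY]; exact memLp_finsetSum' _ fun a _ => hmem' a
  have hwsum : ∑ a, (edgeWeight Q a : ℝ) = pairCount Q := by exact_mod_cast sum_edgeWeight Q
  have hmean : ∫ ω, Y ω ∂μ ≤ p * pairCount Q := by
    have h1 : ∫ ω, Y ω ∂μ = ∑ a, ∫ P, X a P ∂edgeLaw p a := by
      simp only [hY, Finset.sum_apply]
      rw [integral_finsetSum _ fun a _ => (hmem' a).integrable (by norm_num)]
      exact Finset.sum_congr rfl fun a _ =>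
        integral_comp_eval (hmem a).aestronglyMeasurable
    rw [h1, ← hwsum, Finset.mul_sum]
    refine Finset.sum_le_sum fun a _ => ?_
    rw [integral_edgeLaw]
    simp only [hX, if_false, mul_zero, add_zero]
    refine mul_le_mul_of_nonneg_left ?_ hp0
    split_ifs <;> simp
  have hvar : Var[Y; μ] ≤ 2 * p * pairCount Q := by
    rw [hY, hμ, variance_sum_pi hmem, ← hwsum, Finset.mul_sum]
    refine Finset.sum_le_sum fun a _ => ?_
    refine (variance_le_expectation_sq (hmem a).aestronglyMeasurable).trans ?_
    simp only [Pi.pow_apply]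
    rw [integral_edgeLaw p a (fun P => X a P ^ 2)]
    have hw : (edgeWeight Q a : ℝ) ≤ 2 := by exact_mod_cast edgeWeight_le_two Q a
    have hw0 : (0 : ℝ) ≤ edgeWeight Q a := Nat.cast_nonneg _
    have : X a (¬ a.IsDiag) ^ 2 ≤ 2 * edgeWeight Q a := by
      simp only [hX]
      split_ifs
      all_goals nlinarith
    have h0 : X a False = 0 := by simp [hX]
    rw [h0]
    nlinarith
  rw [SimpleGraph.binomialRandom_apply, Measure.infinitePi_eq_pi]
  refine (measure_mono (t := {ω | δ ≤ |Y ω - ∫ ω', Y ω' ∂μ|}) ?_).trans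
    ((meas_ge_le_variance_div_sq hYmem hδ).trans (ENNReal.ofReal_le_ofReal (by gcongr)))
  rintro _ ⟨G, hG, rfl⟩
  have hYG : Y (fun a => a ∈ G.edgeSet) = arcCount G Q := by
    rw [arcCount_eq_sum]
    simp only [hY, hX, Finset.sum_apply]
    push_cast
    exact Finset.sum_congr rfl fun a _ => by congr
  have hG' : x < arcCount G Q := hG
  change δ ≤ |Y (fun a => a ∈ G.edgeSet) - _|
  rw [hYG]
  refine le_trans ?_ (le_abs_self _)
  linarith

/-- The mean is at most 2cn/m; a deviation of cn/m is allowed on top, which explains `3 * c`.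
Chebyshev's bound is then at most 4m/(cn). -/
theorem measure_arcCount_gt_le_div (hn : 0 < n) (Q : Fin n → Fin n → Prop) {m C c : ℕ}
    (hm : 0 < m) (hc : 0 < c) (hC : 3 * c ≤ C) (hp : n * (p : ℝ) ≤ c)
    (hQ : m * pairCount Q ≤ 2 * n * n) :
    SimpleGraph.binomialRandom (Fin n) p {G | ¬ m * arcCount G Q ≤ C * n} ≤
      ENNReal.ofReal (4 * m / n) := by
  have hm' : (0 : ℝ) < m := by exact_mod_cast hm
  have hn' : (0 : ℝ) < n := by exact_mod_cast hn
  have hc' : (1 : ℝ) ≤ c := by exact_mod_cast hc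
  have hC' : 3 * (c : ℝ) ≤ C := by exact_mod_cast hC
  have hQ' : (m : ℝ) * pairCount Q ≤ 2 * n * n := by exact_mod_cast hQ
  have hp0 : (0 : ℝ) ≤ p := p.2.1
  have hpQ : (p : ℝ) * pairCount Q ≤ 2 * c * n / m := by
    rw [le_div_iff₀ hm']
    calc (p : ℝ) * pairCount Q * m = p * (m * pairCount Q) := by ring
      _ ≤ p * (2 * n * n) := by gcongr
      _ = 2 * (n * p) * n := by ring
      _ ≤ 2 * c * n := by gcongr
  have hmain := measure_arcCount_gt_le p Q (δ := c * n / m) (x := C * n / m) (by positivity) (by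
    calc (p : ℝ) * pairCount Q + c * n / m ≤ 2 * c * n / m + c * n / m := by gcongr
      _ = 3 * c * n / m := by ring
      _ ≤ C * n / m := by gcongr)
  refine le_trans (measure_mono fun G hG => ?_) (hmain.trans (ENNReal.ofReal_le_ofReal ?_))
  · have h : ¬ m * arcCount G Q ≤ C * n := hG
    have h' : (C : ℝ) * n < m * arcCount G Q := by exact_mod_cast not_le.1 h
    change (C : ℝ) * n / m < arcCount G Q
    rw [div_lt_iff₀ hm']
    linarith
  · calc 2 * (p : ℝ) * pairCount Q / (c * n / m) ^ 2
        ≤ 2 * (2 * c * n / m) / (c * n / m) ^ 2 := by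
          rw [mul_assoc]; gcongr
      _ = 4 * m / ((c : ℝ) * n) := by field_simp; ring
      _ ≤ 4 * m / ((1 : ℝ) * n) := by gcongr
      _ = 4 * m / n := by rw [one_mul]

theorem mul_pairCount_residue_le {M : ℕ} (hM : M ≤ n) (i : ℕ) :
    M * pairCount (fun u _ : Fin n => (u : ℕ) % M = i) ≤ 2 * n * n := by
  classical
  have h : pairCount (fun u _ : Fin n => (u : ℕ) % M = i) =
      (Finset.univ.filter fun u : Fin n => (u : ℕ) % M = i).card * n := by
    unfold pairCount
    rw [Finset.card_filter, Finset.sum_mul]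
    refine Finset.sum_congr rfl fun u _ => ?_
    by_cases h : (u : ℕ) % M = i <;> simp [h]
  rw [h, ← mul_assoc]
  refine Nat.mul_le_mul_right n ((card_residue_le i).trans ?_)
  omega

theorem mul_pairCount_within_le {d : ℕ} (hd : d ≤ n) :
    d * pairCount (fun u v : Fin n => (u : ℕ) % d = (v : ℕ) % d) ≤ 2 * n * n := by
  classical
  unfold pairCount
  rw [Finset.mul_sum]
  refine (Finset.sum_le_card_nsmul _ _ (2 * n) fun u _ => ?_).trans_eq (by simp [mul_comm])
  beta_reduce
  have := card_residue_le (n := n) (M := d) ((u : ℕ) % d)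
  calc d * _ = d * (Finset.univ.filter fun v : Fin n => (v : ℕ) % d = (u : ℕ) % d).card := by
        rw [Finset.card_filter]
        congr! 3
        exact eq_comm
    _ ≤ 2 * n := by omega

/-- A union bound over the whole graph, the arcs within classes modulo `d`, and the `M` classes
modulo `M`; each of the latter costs 4M/n, whence the term `M * M`. -/
theorem measure_not_regular_le {C c d M : ℕ} (hn : 0 < n) (hd : 0 < d) (hM : 0 < M) (hdn : d ≤ n)
    (hMn : M ≤ n) (hc : 0 < c) (hC : 3 * c ≤ C) (hp : n * (p : ℝ) ≤ c) :
    SimpleGraph.binomialRandom (Fin n) p {G | ¬ Regular G C d M} ≤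
      ENNReal.ofReal (4 * (1 + d + M * M) / n) := by
  set μ := SimpleGraph.binomialRandom (Fin n) p
  have h1 : μ {G | ¬ 1 * arcCount G (fun _ _ => True) ≤ C * n} ≤
      ENNReal.ofReal (4 * (1 : ℕ) / n) :=
    measure_arcCount_gt_le_div p hn _ one_pos hc hC hp (by
      simp only [pairCount, if_true, Finset.sum_const, Finset.card_univ, Fintype.card_fin,
        smul_eq_mul]
      nlinarith)
  have h2 := measure_arcCount_gt_le_div p hn _ hd hc hC hp (mul_pairCount_within_le hdn)
  have h3 : ∀ i, _ := fun i =>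
    measure_arcCount_gt_le_div p hn _ hM hc hC hp (mul_pairCount_residue_le hMn i)
  have hsub : {G : SimpleGraph (Fin n) | ¬ Regular G C d M} ⊆
      ({G | ¬ 1 * arcCount G (fun _ _ => True) ≤ C * n} ∪
        {G | ¬ d * arcCount G (fun u v => (u : ℕ) % d = (v : ℕ) % d) ≤ C * n}) ∪
      ⋃ i ∈ Finset.range M, {G | ¬ M * arcCount G (fun u _ => (u : ℕ) % M = i) ≤ C * n} := by
    intro G hG
    by_contra h
    simp only [Set.mem_union, Set.mem_iUnion, Finset.mem_range, not_or, not_exists] at h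
    refine hG ⟨?_, not_not.1 h.1.2, fun i hi => not_not.1 (h.2 i hi)⟩
    have := not_not.1 h.1.1
    rwa [one_mul] at this
  refine (measure_mono hsub).trans ((measure_union_le _ _).trans ?_)
  refine (add_le_add ((measure_union_le _ _).trans (add_le_add h1 h2))
    ((measure_biUnion_finset_le _ _).trans (Finset.sum_le_sum fun i _ => h3 i))).trans ?_
  rw [Finset.sum_const, Finset.card_range, nsmul_eq_mul, ← ENNReal.ofReal_natCast,
    ← ENNReal.ofReal_mul (by positivity), ← ENNReal.ofReal_add (by positivity) (by positivity),
    ← ENNReal.ofReal_add (by positivity) (by positivity)]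
  refine ENNReal.ofReal_le_ofReal (le_of_eq ?_)
  push_cast
  ring

end Probability

/-! ### The theorem -/

section Good

variable {n : ℕ} {G : SimpleGraph (Fin n)}

theorem totalLength_eq_arcCount {L : Fin n → List (Fin n)} (hL : IsAdjacencyLists G L) :
    totalLength L = arcCount G fun _ _ => True := by
  classical
  have h : (arcCount G fun _ _ => True) = ∑ u, nbrCount G u := by
    rw [arcCount_row (fun _ => True)]; simp
  rw [h, totalLength]
  refine Finset.sum_congr rfl fun v _ => ?_
  rw [← List.toFinset_card_of_nodup (hL v).1, nbrCount]
  congr 1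
  ext u
  simp [(hL v).2 u]

theorem exists_isAdjacencyLists (G : SimpleGraph (Fin n)) : ∃ L, IsAdjacencyLists G L := by
  classical
  exact ⟨fun v => (Finset.univ.filter fun u => G.Adj v u).toList,
    fun v => ⟨Finset.nodup_toList _, fun u => by simp⟩⟩

theorem isInternalAt_iff (c : Fin n → Bool) (v : Fin n) :
    IsInternalAt G c v ↔ ¬ Unhappy G true c v := by
  have h := sameCount_add_diffCount (G := G) c v
  have h' : IsInternalAt G c v ↔ nbrCount G v ≤ 2 * sameCount G c v := by
    unfold IsInternalAt nbrCount sameCount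
    congr!
  rw [h', Unhappy]
  simp only [if_true]
  omega

theorem isExternalAt_iff (c : Fin n → Bool) (v : Fin n) :
    IsExternalAt G c v ↔ ¬ Unhappy G false c v := by
  have h := sameCount_add_diffCount (G := G) c v
  have h' : IsExternalAt G c v ↔ nbrCount G v ≤ 2 * diffCount G c v := by
    unfold IsExternalAt nbrCount diffCount
    congr!
  rw [h', Unhappy]
  simp only [Bool.false_eq_true, if_false]
  omega

theorem Passes.unhappyCount_le {e : Bool} {k : ℕ} (hk : 1 ≤ k) {c : Fin n → Bool}
    (h : Passes G e k c) : (unhappyCount G e c : ℝ) ≤ 1 / (k : ℝ) * Fintype.card (Fin n) := by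
  have hk' : (0 : ℝ) < k := by exact_mod_cast hk
  have h2 : (k : ℝ) * unhappyCount G e c ≤ n := by exact_mod_cast h.2
  rw [Fintype.card_fin, one_div, ← div_eq_inv_mul, le_div_iff₀ hk']
  linarith

theorem Passes.isAlmostInternalBisection {k : ℕ} (hk : 1 ≤ k) {c : Fin n → Bool}
    (h : Passes G true k c) : IsAlmostInternalBisection (1 / (k : ℝ)) G c := by
  refine ⟨isBisection_of_imbalance h.1, le_trans (le_of_eq ?_) (h.unhappyCount_le hk)⟩
  rw [unhappyCount, ← Finset.card_filter]
  congr! 4 with v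
  rw [isInternalAt_iff, not_not]

theorem Passes.isAlmostExternalBisection {k : ℕ} (hk : 1 ≤ k) {c : Fin n → Bool}
    (h : Passes G false k c) : IsAlmostExternalBisection (1 / (k : ℝ)) G c := by
  refine ⟨isBisection_of_imbalance h.1, le_trans (le_of_eq ?_) (h.unhappyCount_le hk)⟩
  rw [unhappyCount, ← Finset.card_filter]
  congr! 4 with v
  rw [isExternalAt_iff, not_not]

theorem outputColouring_eq {g : Fin n → Bool} {s : Store}
    (h : Holds 2 (fun v => (g v).toNat) s) : outputColouring n s = g := by
  funext v
  rw [outputColouring, h v]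
  cases h : g v <;> simp [h]

/-- On a regular graph the algorithm finds a good colouring in linear time. -/
theorem Regular.spec {C k M : ℕ} (hC : 1 ≤ C) (hk : 1 ≤ k)
    (hM : ∀ e n (G : SimpleGraph (Fin n)), M ≤ n → Regular G C (8 * C * k) M →
      ∃ q, 2 ≤ q ∧ q < 2 ^ (M + 1) ∧ ¬ Fails G e k (8 * C * k) (8 * C * k * (8 * C * k)) q)
    (hn : 2 ^ (M + 1) < n) (hG : Regular G C (8 * C * k) M) (e : Bool)
    {L : Fin n → List (Fin n)} (hL : IsAdjacencyLists G L) :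
    Spec (.algorithm e (8 * C) C) (inputStore L k) (timeFactor (8 * C) C k * 2 ^ (M + 1) * n)
      fun s => ∃ g, outputColouring n s = g ∧ Passes G e k g := by
  have hMn : M ≤ n := by
    have := (M + 1).lt_two_pow_self
    omega
  obtain ⟨q, hq2, hq, hF⟩ := hM e n G hMn hG
  refine (Spec.algorithm (B := q + 1) hL (by omega) hk (by omega) (by omega)
    (fun _ => hF)).mono ?_ ?_
  · rw [mul_assoc]
    exact Nat.mul_le_mul_left _ (Nat.mul_le_mul_right _ hq)
  · rintro s - hs
    obtain ⟨g, hg, hp⟩ := hs (totalLength_eq_arcCount hL ▸ hG.sparse) (by omega)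
    exact ⟨g, outputColouring_eq hg, hp⟩

/-- Take `B = n` in `Spec.algorithm`: the hypothesis about failing becomes vacuous, so the bound
applies to every graph. -/
theorem graphExpectedRuntime_algorithm_le (G : SimpleGraph (Fin n)) {A C k : ℕ} (hA : 1 ≤ A)
    (hk : 1 ≤ k) (hn : 3 ≤ n) (e : Bool) :
    graphExpectedRuntime (.algorithm e A C) G k ≤ (timeFactor A C k * (n * n) : ℕ) :=
  Spec.graphExpectedRuntime_le fun _ hL =>
    ⟨_, Spec.algorithm hL hA hk hn le_rfl fun h => absurd h (lt_irrefl n)⟩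

end Good

/-! ### High probability, expected time and the diagonal argument -/

section Whp

variable {p : ℕ → unitInterval}

/-- Only subadditivity is used, so `E` need not be shown to be measurable. -/
theorem Whp.of_measure_le {E : ∀ n : ℕ, SimpleGraph (Fin n) → Prop} {κ : ℝ}
    (h : ∀ᶠ n : ℕ in atTop, SimpleGraph.binomialRandom (Fin n) (p n) {G | ¬ E n G} ≤
      ENNReal.ofReal (κ / n)) : Whp p E := by
  have hlim : Tendsto (fun n : ℕ => 1 - ENNReal.ofReal (κ / n)) atTop (𝓝 1) := by
    have h0 : Tendsto (fun n : ℕ => ENNReal.ofReal (κ / n)) atTop (𝓝 0) := by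
      have := ENNReal.tendsto_ofReal (tendsto_const_div_atTop_nhds_zero_nat κ)
      rwa [ENNReal.ofReal_zero] at this
    have := ENNReal.Tendsto.sub (tendsto_const_nhds (x := (1 : ℝ≥0∞)) (f := atTop)) h0
      (Or.inl ENNReal.one_ne_top)
    rwa [tsub_zero] at this
  refine tendsto_of_tendsto_of_tendsto_of_le_of_le' hlim tendsto_const_nhds ?_
    (Eventually.of_forall fun _ => prob_le_one)
  filter_upwards [h] with n hn
  refine tsub_le_iff_right.2 ?_
  calc (1 : ℝ≥0∞) = SimpleGraph.binomialRandom (Fin n) (p n) ({G | E n G} ∪ {G | ¬ E n G}) := by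
        rw [show {G : SimpleGraph (Fin n) | E n G} ∪ {G | ¬ E n G} = Set.univ from
          Set.eq_univ_of_forall fun G => em (E n G), measure_univ]
    _ ≤ _ := (measure_union_le _ _).trans (add_le_add le_rfl hn)

theorem Whp.mono {E E' : ∀ n : ℕ, SimpleGraph (Fin n) → Prop} (h : Whp p E)
    (h' : ∀ᶠ n in atTop, ∀ G, E n G → E' n G) : Whp p E' :=
  tendsto_of_tendsto_of_tendsto_of_le_of_le' h tendsto_const_nhds
    (h'.mono fun _ hn => measure_mono fun G hG => hn G hG)
    (Eventually.of_forall fun _ => prob_le_one)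

/-- A property that holds whp for every value of a parameter also holds whp for a parameter that
tends to infinity with the number of vertices. -/
theorem Whp.exists_diagonal {E : ℕ → ∀ n : ℕ, SimpleGraph (Fin n) → Prop}
    (h : ∀ k, Whp p (E k)) : ∃ K : ℕ → ℕ, Tendsto K atTop atTop ∧ Whp p fun n => E (K n) n := by
  have h1 : ∀ k : ℕ, ∃ N : ℕ, ∀ n ≥ N, 1 - ((k : ℝ≥0∞) + 1)⁻¹ <
      SimpleGraph.binomialRandom (Fin n) (p n) {G | E k n G} := fun k =>
    eventually_atTop.1 ((h k).eventually_const_lt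
      (ENNReal.sub_lt_self ENNReal.one_ne_top one_ne_zero (by simp)))
  choose N hN using h1
  -- K(n) is the largest k ≤ n whose threshold `N k` has been reached. It tends to infinity because
  -- each fixed k is eventually admissible.
  have hK : Tendsto (fun n => Nat.findGreatest (fun k => N k ≤ n) n) atTop atTop :=
    tendsto_atTop.2 fun k => by
      filter_upwards [eventually_ge_atTop k, eventually_ge_atTop (N k)] with n h2 h3
      exact Nat.le_findGreatest h2 h3
  refine ⟨_, hK, ?_⟩
  have hlim : Tendsto (fun k : ℕ => 1 - ((k : ℝ≥0∞) + 1)⁻¹) atTop (𝓝 1) := by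
    have h0 : Tendsto (fun k : ℕ => ((k : ℝ≥0∞) + 1)⁻¹) atTop (𝓝 0) := by
      have := (tendsto_add_atTop_iff_nat 1).2 ENNReal.tendsto_inv_nat_nhds_zero
      simpa using this
    have := ENNReal.Tendsto.sub (tendsto_const_nhds (x := (1 : ℝ≥0∞)) (f := atTop)) h0
      (Or.inl ENNReal.one_ne_top)
    rwa [tsub_zero] at this
  refine tendsto_of_tendsto_of_tendsto_of_le_of_le' (hlim.comp hK) tendsto_const_nhds ?_
    (Eventually.of_forall fun _ => prob_le_one)
  -- From `N 0` on, k = 0 is admissible, so `Nat.findGreatest` returns an admissible value and not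
  -- merely its default 0.
  filter_upwards [eventually_ge_atTop (N 0)] with n hn
  exact (hN _ n (Nat.findGreatest_spec (P := fun k => N k ≤ n) (Nat.zero_le n) hn)).le

theorem exists_forall_eventually_le
    (hp : limsup (fun n : ℕ => (((n : ℝ) * (p n : ℝ) : ℝ) : EReal)) atTop < ⊤) :
    ∃ c : ℕ, 0 < c ∧ ∀ᶠ n : ℕ in atTop, (n : ℝ) * (p n : ℝ) ≤ c := by
  obtain ⟨r, hr, -⟩ := EReal.lt_iff_exists_real_btwn.1 hp
  refine ⟨⌈r⌉₊ + 1, Nat.succ_pos _, (eventually_lt_of_limsup_lt hr).mono fun n hn => ?_⟩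
  have h1 : (n : ℝ) * (p n : ℝ) < r := EReal.coe_lt_coe_iff.1 hn
  have h2 := Nat.le_ceil r
  push_cast
  linarith

theorem eventually_measure_not_regular_le {c : ℕ} (hc : 0 < c)
    (hp : ∀ᶠ n : ℕ in atTop, (n : ℝ) * (p n : ℝ) ≤ c) {d M : ℕ} (hd : 0 < d) (hM : 0 < M) :
    ∀ᶠ n : ℕ in atTop, SimpleGraph.binomialRandom (Fin n) (p n)
      {G | ¬ Regular G (3 * c) d M} ≤ ENNReal.ofReal (4 * (1 + d + M * M) / n) := by
  filter_upwards [hp, eventually_gt_atTop 0, eventually_ge_atTop d, eventually_ge_atTop M]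
    with n h1 h2 h3 h4
  exact measure_not_regular_le (p n) h2 hd hM h3 h4 hc le_rfl h1

theorem whp_exists_passes {c : ℕ} (hc : 0 < c)
    (hp : ∀ᶠ n : ℕ in atTop, (n : ℝ) * (p n : ℝ) ≤ c) (e : Bool) {k : ℕ} (hk : 1 ≤ k) :
    Whp p fun _ G => ∃ g, Passes G e k g := by
  obtain ⟨M, hM1, hM⟩ := exists_not_fails (C := 3 * c) (k := k) (by omega) hk rfl
  have hd : 0 < 8 * (3 * c) * k := by positivity
  refine (Whp.of_measure_le (eventually_measure_not_regular_le hc hp hd hM1)).mono ?_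
  filter_upwards [eventually_gt_atTop (2 ^ (M + 1))] with n hn G hG
  -- Existence is read off from the output of the algorithm on arbitrary adjacency lists.
  obtain ⟨L, hL⟩ := exists_isAdjacencyLists G
  obtain ⟨t, -, s, -, g, -, hg⟩ := hG.spec (by omega) hk hM hn e hL
  exact ⟨g, hg⟩

/-- A regular graph costs at most T 2^(M+1) n steps. Any other costs at most T n², but these have
probability at most 4(1 + d + M²)/n, so they add only a linear term to the expectation; the constant
is the sum of the two. -/
theorem algorithm_findsInExpectedLinearTime {c : ℕ} (hc : 0 < c)
    (hp : ∀ᶠ n : ℕ in atTop, (n : ℝ) * (p n : ℝ) ≤ c) (e : Bool)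
    {Good : ℕ → ∀ n : ℕ, SimpleGraph (Fin n) → (Fin n → Bool) → Prop}
    (hGood : ∀ k n G g, 1 ≤ k → Passes G e k g → Good k n G g) :
    FindsInExpectedLinearTime p (.algorithm e (8 * (3 * c)) (3 * c)) Good := by
  intro k hk
  obtain ⟨M, hM1, hM⟩ := exists_not_fails (C := 3 * c) (k := k) (by omega) hk rfl
  have hd : 0 < 8 * (3 * c) * k := by positivity
  set d := 8 * (3 * c) * k with hdef
  set T := timeFactor (8 * (3 * c)) (3 * c) k with hT
  have hreg := eventually_measure_not_regular_le hc hp hd hM1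
  have hspec : ∀ n : ℕ, 2 ^ (M + 1) < n → ∀ G : SimpleGraph (Fin n), Regular G (3 * c) d M →
      ∀ L, IsAdjacencyLists G L → Spec (.algorithm e (8 * (3 * c)) (3 * c)) (inputStore L k)
        (T * 2 ^ (M + 1) * n) fun s => Good k n G (outputColouring n s) := by
    intro n hn G hG L hL
    refine (hG.spec (by omega) hk hM hn e hL).mono le_rfl ?_
    rintro s - ⟨g, hg, hgp⟩
    rw [hg]
    exact hGood k n G g hk hgp
  refine ⟨T * 2 ^ (M + 1) + T * (4 * (1 + d + M * M)), ?_, ?_⟩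
  · filter_upwards [hreg, eventually_gt_atTop (2 ^ (M + 1)), eventually_ge_atTop 3] with n h1 h2 h3
    set bad : Set (SimpleGraph (Fin n)) := {G | ¬ Regular G (3 * c) d M} with hbad
    have hle : ∀ G, graphExpectedRuntime (.algorithm e (8 * (3 * c)) (3 * c)) G k ≤
        (T * 2 ^ (M + 1) * n : ℕ) + bad.indicator (fun _ => ((T * (n * n) : ℕ) : ℝ≥0∞)) G := by
      intro G
      by_cases hG : G ∈ bad
      · rw [Set.indicator_of_mem hG]
        exact (graphExpectedRuntime_algorithm_le G (by omega) hk h3 e).trans le_add_self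
      · exact (Spec.graphExpectedRuntime_le fun L hL =>
          ⟨_, hspec n h2 G (not_not.1 hG) L hL⟩).trans le_self_add
    have hn' : (n : ℝ) ≠ 0 := by positivity
    have hbound : ((T * (n * n) : ℕ) : ℝ≥0∞) * ENNReal.ofReal (4 * (1 + d + M * M) / n) =
        ((T * (4 * (1 + d + M * M)) * n : ℕ) : ℝ≥0∞) := by
      rw [← ENNReal.ofReal_natCast, ← ENNReal.ofReal_natCast, ← ENNReal.ofReal_mul (by positivity)]
      congr 1
      push_cast
      field_simp
    calc ∫⁻ G, graphExpectedRuntime (.algorithm e (8 * (3 * c)) (3 * c)) G k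
          ∂(SimpleGraph.binomialRandom (Fin n) (p n))
        ≤ ∫⁻ G, ((T * 2 ^ (M + 1) * n : ℕ) : ℝ≥0∞) +
            bad.indicator (fun _ => ((T * (n * n) : ℕ) : ℝ≥0∞)) G
            ∂(SimpleGraph.binomialRandom (Fin n) (p n)) := lintegral_mono hle
      _ ≤ ((T * 2 ^ (M + 1) * n : ℕ) : ℝ≥0∞) + ((T * (n * n) : ℕ) : ℝ≥0∞) *
            SimpleGraph.binomialRandom (Fin n) (p n) bad := by
          rw [lintegral_add_left measurable_const, lintegral_const, measure_univ, mul_one]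
          exact add_le_add le_rfl (lintegral_indicator_const_le _ _)
      _ ≤ ((T * 2 ^ (M + 1) * n : ℕ) : ℝ≥0∞) + ((T * (n * n) : ℕ) : ℝ≥0∞) *
            ENNReal.ofReal (4 * (1 + d + M * M) / n) := by gcongr
      _ = _ := by
          rw [hbound]
          push_cast
          ring
  · refine (Whp.of_measure_le hreg).mono ?_
    filter_upwards [eventually_gt_atTop (2 ^ (M + 1))] with n hn G hG
    refine ⟨(Spec.graphExpectedRuntime_le fun L hL => ⟨_, hspec n hn G hG L hL⟩).trans ?_,
      Spec.alwaysFinds fun L hL => ⟨_, hspec n hn G hG L hL⟩⟩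
    rw [← Nat.cast_mul]
    exact_mod_cast Nat.mul_le_mul_right n (Nat.le_add_right _ _)

theorem exists_tendsto_zero_whp {c : ℕ} (hc : 0 < c)
    (hp : ∀ᶠ n : ℕ in atTop, (n : ℝ) * (p n : ℝ) ≤ c) (e : Bool)
    {Good : ℝ → ∀ n : ℕ, SimpleGraph (Fin n) → (Fin n → Bool) → Prop}
    (hGood : ∀ (k n : ℕ) G g, 1 ≤ k → Passes G e k g → Good (1 / (k : ℝ)) n G g) :
    ∃ ε : ℕ → ℝ, (∀ n, 0 < ε n ∧ ε n < 1) ∧ Tendsto ε atTop (𝓝 0) ∧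
      Whp p fun n G => ∃ g, Good (ε n) n G g := by
  obtain ⟨K, hK, hW⟩ := Whp.exists_diagonal (p := p)
    -- The shift by 2 makes 1/(k + 2) less than 1 also for k = 0.
    (E := fun k _ G => ∃ g, Passes G e (k + 2) g)
    fun k => whp_exists_passes hc hp e (Nat.succ_le_succ (Nat.zero_le _))
  refine ⟨fun n => 1 / ((K n + 2 : ℕ) : ℝ), fun n => ⟨by positivity, ?_⟩, ?_, hW.mono ?_⟩
  · rw [div_lt_one (by positivity)]
    exact_mod_cast (by omega : 1 < K n + 2)
  · exact (tendsto_const_div_atTop_nhds_zero_nat (1 : ℝ)).comp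
      (tendsto_atTop_mono (fun n => Nat.le_add_right _ _) hK)
  · exact Eventually.of_forall fun n G ⟨g, hg⟩ => ⟨g, hGood _ n G g (by omega) hg⟩

end Whp

end AlmostBisection

theorem theorem1p5 (p : ℕ → unitInterval)
    (hp : limsup (fun n : ℕ => (((n : ℝ) * (p n : ℝ) : ℝ) : EReal)) atTop < ⊤) :
    (∃ ε : ℕ → ℝ, (∀ n, 0 < ε n ∧ ε n < 1) ∧ Tendsto ε atTop (𝓝 0) ∧
      AlmostBisection.Whp p fun n G =>
        ∃ c, AlmostBisection.IsAlmostInternalBisection (ε n) G c) ∧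
    (∃ ε : ℕ → ℝ, (∀ n, 0 < ε n ∧ ε n < 1) ∧ Tendsto ε atTop (𝓝 0) ∧
      AlmostBisection.Whp p fun n G =>
        ∃ c, AlmostBisection.IsAlmostExternalBisection (ε n) G c) ∧
    (∃ P : AlmostBisection.Prog, AlmostBisection.FindsInExpectedLinearTime p P fun k _ G c =>
      AlmostBisection.IsAlmostInternalBisection (1 / (k : ℝ)) G c) ∧
    (∃ P : AlmostBisection.Prog, AlmostBisection.FindsInExpectedLinearTime p P fun k _ G c =>
      AlmostBisection.IsAlmostExternalBisection (1 / (k : ℝ)) G c) := by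
  obtain ⟨c, hc, hcp⟩ := AlmostBisection.exists_forall_eventually_le hp
  exact ⟨AlmostBisection.exists_tendsto_zero_whp hc hcp true
      (Good := fun ε _ G g => AlmostBisection.IsAlmostInternalBisection ε G g)
      fun _ _ _ _ hk h => h.isAlmostInternalBisection hk,
    AlmostBisection.exists_tendsto_zero_whp hc hcp false
      (Good := fun ε _ G g => AlmostBisection.IsAlmostExternalBisection ε G g)
      fun _ _ _ _ hk h => h.isAlmostExternalBisection hk,
    ⟨_, AlmostBisection.algorithm_findsInExpectedLinearTime hc hcp true
      fun _ _ _ _ hk h => h.isAlmostInternalBisection hk⟩,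
    ⟨_, AlmostBisection.algorithm_findsInExpectedLinearTime hc hcp false
      fun _ _ _ _ hk h => h.isAlmostExternalBisection hk⟩⟩
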